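/- On the two-particle space $L^2(\mathbb R^3\times\mathbb R^3;\mathbb C)$, with variables $x_1,x_2\in\mathbb R^3$ and $p_j=-i\nabla_{x_j}$, let $S_j=(1+p_j^2)^{1/4}=(1-\Delta_{x_j})^{1/4}$ for $j=1,2$, with real powers $S_j^{s}=(1+p_j^2)^{s/4}$. Let $V_{1,2}$ and, for $\varepsilon>0$ and an integer $N\ge 1$, $V^{\varepsilon}_{1,2}$ be the operators of multiplication by $|x_1-x_2|^{-1}$ and by $(|x_1-x_2|+\varepsilon N^{-1})^{-1}$. Operator inequalities are in the sense of quadratic forms. Products of unbounded operators are taken on their natural domain; such a product is called bounded, with norm at most $C$, if this domain is dense and the bound holds on it. (i) For every real $a<3$ there is a constant $C(a)<\infty$, depending only on $a$, such that $$\frac{1}{|x_1-x_2|^{a}}\le C(a)\,S_1^{\alpha}S_2^{\beta}\qquad\text{for all }\alpha,\beta>0\text{ with }\alpha+\beta=2a .$$ If $a=1$, the constant can be taken to be $\pi/2$: $V_{1,2}\le \frac{\pi}{2}S_1^{\alpha}S_2^{\beta}$ for all $\alpha,\beta>0$ with $\alpha+\beta=2$; and this is sharp: for any such $\alpha,\beta$,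 if $V_{1,2}\le c\,S_1^{\alpha}S_2^{\beta}$ for a real number $c$, then $c\ge\pi/2$. (ii) The operator $S_1S_2^{-1}V_{1,2}S_1^{-1}S_2^{-1}$ is bounded, and there is a constant $C<\infty$ with $\|S_1S_2^{-1}V^{\varepsilon}_{1,2}S_1^{-1}S_2^{-1}\|\le C$ for all $\varepsilon>0$ and all integers $N\ge1$. (iii) For every $\delta>0$ there is a constant $C_\delta<\infty$ such that $$\|S_1^{-2}S_2^{-1}V^{\varepsilon}_{1,2}S_2\|\le C_\delta\,\varepsilon^{-\delta}N^{\delta}$$ for all $\varepsilon>0$ and all integers $N\ge1$, where in the case $\delta>1$ it is assumed in addition that $\varepsilon\le N$. -/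

import Mathlib

open MeasureTheory
open scoped ENNReal FourierTransform

noncomputable section

namespace TwoParticle

/-- The one-particle configuration space `ℝ³` (Euclidean norm). -/
abbrev Space : Type := EuclideanSpace ℝ (Fin 3)

/-- The two-particle configuration space `ℝ³ × ℝ³ = ℝ⁶` (Euclidean norm). A point is `x = (x₁, x₂)`
with `x₁ = x.fst` and `x₂ = x.snd`. -/
abbrev Config : Type := WithLp 2 (Space × Space)

/-- The two-particle Hilbert space `L²(ℝ⁶; ℂ)` with Lebesgue measure. -/
abbrev Hilb : Type := Lp (α := Config) ℂ 2 (volume : Measure Config)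

section Multiplication

variable {X : Type*} [MeasurableSpace X] {μ : Measure X}

theorem mul_coe_add (m : X → ℝ) (ψ φ : Lp ℂ 2 μ) :
    (fun x => (m x : ℂ) * (ψ + φ : Lp ℂ 2 μ) x) =ᵐ[μ]
      (fun x => (m x : ℂ) * ψ x) + fun x => (m x : ℂ) * φ x := by
  filter_upwards [Lp.coeFn_add ψ φ] with x hx
  rw [hx, Pi.add_apply, Pi.add_apply, mul_add]

theorem mul_coe_smul (m : X → ℝ) (c : ℂ) (ψ : Lp ℂ 2 μ) :
    (fun x => (m x : ℂ) * (c • ψ : Lp ℂ 2 μ) x) =ᵐ[μ] c • fun x => (m x : ℂ) * ψ x := by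
  filter_upwards [Lp.coeFn_smul c ψ] with x hx
  rw [hx, Pi.smul_apply, Pi.smul_apply, smul_eq_mul, smul_eq_mul, mul_left_comm]

theorem mul_coe_zero (m : X → ℝ) :
    (fun x => (m x : ℂ) * (0 : Lp ℂ 2 μ) x) =ᵐ[μ] (0 : X → ℂ) := by
  filter_upwards [Lp.coeFn_zero ℂ 2 μ] with x hx
  simp only [hx, Pi.zero_apply, mul_zero]

/-- The domain `{ψ ∈ L² | m ψ ∈ L²}` of multiplication by the real function `m`. -/
def mulDomain (μ : Measure X) (m : X → ℝ) : Submodule ℂ (Lp ℂ 2 μ) where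
  carrier := {ψ | MemLp (fun x => (m x : ℂ) * ψ x) 2 μ}
  zero_mem' := (memLp_congr_ae (mul_coe_zero m)).2 MemLp.zero
  add_mem' := fun {ψ φ} hψ hφ => (memLp_congr_ae (mul_coe_add m ψ φ)).2 (MemLp.add hψ hφ)
  smul_mem' := fun c ψ hψ => (memLp_congr_ae (mul_coe_smul m c ψ)).2 (MemLp.const_smul hψ c)

theorem mem_mulDomain {m : X → ℝ} {ψ : Lp ℂ 2 μ} :
    ψ ∈ mulDomain μ m ↔ MemLp (fun x => (m x : ℂ) * ψ x) 2 μ := Iff.rfl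

theorem toLp_mul_coe_add (m : X → ℝ) (ψ φ : Lp ℂ 2 μ)
    (h : MemLp (fun x => (m x : ℂ) * (ψ + φ : Lp ℂ 2 μ) x) 2 μ)
    (hψ : MemLp (fun x => (m x : ℂ) * ψ x) 2 μ) (hφ : MemLp (fun x => (m x : ℂ) * φ x) 2 μ) :
    h.toLp _ = hψ.toLp _ + hφ.toLp _ := by
  rw [← MemLp.toLp_add hψ hφ, MemLp.toLp_eq_toLp_iff]
  exact mul_coe_add m ψ φ

theorem toLp_mul_coe_smul (m : X → ℝ) (c : ℂ) (ψ : Lp ℂ 2 μ)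
    (h : MemLp (fun x => (m x : ℂ) * (c • ψ : Lp ℂ 2 μ) x) 2 μ)
    (hψ : MemLp (fun x => (m x : ℂ) * ψ x) 2 μ) :
    h.toLp _ = c • hψ.toLp _ := by
  rw [← MemLp.toLp_const_smul c hψ, MemLp.toLp_eq_toLp_iff]
  exact mul_coe_smul m c ψ

/-- The maximal operator of multiplication by the real function `m`: its domain consists of all
`ψ ∈ L²` with `m ψ ∈ L²`. -/
def mulOp (μ : Measure X) (m : X → ℝ) : Lp ℂ 2 μ →ₗ.[ℂ] Lp ℂ 2 μ where
  domain := mulDomain μ m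
  toFun :=
    { toFun := fun ψ => MemLp.toLp (fun x => (m x : ℂ) * (ψ : Lp ℂ 2 μ) x) (mem_mulDomain.1 ψ.2)
      map_add' := fun ψ φ => toLp_mul_coe_add m (ψ : Lp ℂ 2 μ) (φ : Lp ℂ 2 μ)
        (mem_mulDomain.1 (ψ + φ).2) (mem_mulDomain.1 ψ.2) (mem_mulDomain.1 φ.2)
      map_smul' := fun c ψ => toLp_mul_coe_smul m c (ψ : Lp ℂ 2 μ)
        (mem_mulDomain.1 (c • ψ).2) (mem_mulDomain.1 ψ.2) }

end Multiplication

/-- The composition `T ∘ R` of two unbounded operators on its natural domain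
`{ψ ∈ D(R) | R ψ ∈ D(T)}`. -/
def opComp (T R : Hilb →ₗ.[ℂ] Hilb) : Hilb →ₗ.[ℂ] Hilb :=
  T.comp (R.domRestrict ((T.domain.comap R.toFun).map R.domain.subtype)) (by
    rintro ⟨ψ, hψ⟩
    obtain ⟨⟨φ, hφT, rfl⟩, h2⟩ := hψ
    exact hφT)

/-- The function `m(p)` of the momentum operators `p = (p₁, p₂)`, `p_j = -i∇_j`. In the
normalization `f̂(ξ) = ∫ f(x) e^{-2πi⟨x,ξ⟩} dx` of the unitary Fourier transform, `p` acts as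
multiplication by `2πξ`. The domain is `{ψ | m(2πξ) ψ̂(ξ) ∈ L²}`. -/
def momentumOp (m : Config → ℝ) : Hilb →ₗ.[ℂ] Hilb where
  domain := (mulOp volume fun ξ : Config => m ((2 * Real.pi) • ξ)).domain.comap
    (Lp.fourierTransformₗᵢ Config ℂ).toLinearEquiv.toLinearMap
  toFun := (Lp.fourierTransformₗᵢ Config ℂ).symm.toLinearEquiv.toLinearMap ∘ₗ
    (mulOp volume fun ξ : Config => m ((2 * Real.pi) • ξ)).toFun ∘ₗ
      (Lp.fourierTransformₗᵢ Config ℂ).toLinearEquiv.toLinearMap.restrict (fun _ hψ => hψ)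

/-- `S₁ ^ s = (1 + p₁²)^{s/4} = (1 - Δ₁)^{s/4}`. -/
def S₁ (s : ℝ) : Hilb →ₗ.[ℂ] Hilb := momentumOp fun p => (1 + ‖p.fst‖ ^ 2) ^ (s / 4)

/-- `S₂ ^ s = (1 + p₂²)^{s/4} = (1 - Δ₂)^{s/4}`. -/
def S₂ (s : ℝ) : Hilb →ₗ.[ℂ] Hilb := momentumOp fun p => (1 + ‖p.snd‖ ^ 2) ^ (s / 4)

/-- The Coulomb potential `V(x) = |x|⁻¹`. -/
def V (x : Space) : ℝ := ‖x‖⁻¹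

/-- The regularized Coulomb potential `V^ε(x) = (|x| + ε N⁻¹)⁻¹`. -/
def Vreg (ε : ℝ) (N : ℕ) (x : Space) : ℝ := (‖x‖ + ε * (N : ℝ)⁻¹)⁻¹

/-- The operator `V₁₂` of multiplication by `V(x₁ - x₂)`. -/
def V₁₂ : Hilb →ₗ.[ℂ] Hilb := mulOp volume fun x => V (x.fst - x.snd)

/-- The operator `V^ε₁₂` of multiplication by `V^ε(x₁ - x₂)`. -/
def Vreg₁₂ (ε : ℝ) (N : ℕ) : Hilb →ₗ.[ℂ] Hilb :=
  mulOp volume fun x => Vreg ε N (x.fst - x.snd)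

/-- The quadratic form `(ψ, m(x) ψ)` of multiplication by `m ≥ 0`, with the value `∞` outside the
form domain. -/
def posForm (m : Config → ℝ) (ψ : Hilb) : ℝ≥0∞ :=
  ∫⁻ x, ENNReal.ofReal (m x) * ‖ψ x‖ₑ ^ 2 ∂(volume : Measure Config)

/-- The quadratic form `(ψ, m(p) ψ)` of the function `m(p)`, `m ≥ 0`, of the momentum operators,
with the value `∞` outside the form domain. -/
def momentumForm (m : Config → ℝ) (ψ : Hilb) : ℝ≥0∞ :=
  posForm (fun ξ => m ((2 * Real.pi) • ξ)) (Lp.fourierTransformₗᵢ Config ℂ ψ)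

/-- The operator inequality `m(x₁, x₂) ≤ c S₁^α S₂^β` in the sense of quadratic forms: every `ψ`
in the form domain of the right hand side is in that of the left hand side, and
`(ψ, m ψ) ≤ c (ψ, S₁^α S₂^β ψ)`. -/
def LeSS (m : Config → ℝ) (c α β : ℝ) : Prop :=
  ∀ ψ : Hilb, posForm m ψ ≤ ENNReal.ofReal c *
    momentumForm (fun p => (1 + ‖p.fst‖ ^ 2) ^ (α / 4) * (1 + ‖p.snd‖ ^ 2) ^ (β / 4)) ψ

/-- `T` is densely defined and bounded with `‖T‖ ≤ C`. -/
def NormLE (T : Hilb →ₗ.[ℂ] Hilb) (C : ℝ) : Prop :=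
  Dense (T.domain : Set Hilb) ∧ ∀ ψ : T.domain, ‖T ψ‖ ≤ C * ‖(ψ : Hilb)‖

/-- `S₁ S₂⁻¹ W S₁⁻¹ S₂⁻¹`. -/
def sandwichA (W : Hilb →ₗ.[ℂ] Hilb) : Hilb →ₗ.[ℂ] Hilb :=
  opComp (S₁ 1) (opComp (S₂ (-1)) (opComp W (opComp (S₁ (-1)) (S₂ (-1)))))

/-- `S₁⁻² S₂⁻¹ W S₂`. -/
def sandwichB (W : Hilb →ₗ.[ℂ] Hilb) : Hilb →ₗ.[ℂ] Hilb :=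
  opComp (S₁ (-2)) (opComp (S₂ (-1)) (opComp W (S₂ 1)))

end TwoParticle

end

/-!
Both `|y| ^ (-a)` and `(|y| + η)⁻¹` are positive mixtures of Gaussians, hence so are their Fourier
transforms. An interaction `W(x₁ - x₂)` preserves the total momentum, so in momentum space its form
is `∬ conj (g(ξ)) κ(k) f(ξ - (k, -k)) dk dξ` with a kernel `κ ≥ 0`, and it is bounded by the Schur
test with weights that are powers of `|ξ₁|` and `|ξ₂|`. The integrals that arise are convolutions of
powers, given by the composition formula of Riesz potentials.

For the sharpness of `π / 2` the trial functions are `|ξ₁| ^ (-2)` on `M ≤ |ξ₁| < S`, cut off at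
total momentum `|ξ₁ + ξ₂| ≤ 1`. Both forms then grow like `log (S / M)`, and the ratio of the
coefficients tends to the Schur constant as `M → ∞`.

For (ii) and (iii), the outer power `S_j` is moved through the interaction: a shift of `p_j` by `k`
changes its symbol by at most a constant times `|k| ^ (1 / 2)`. This leaves one term without the
outer power and one whose kernel has the additional factor `|k| ^ (1 / 2)`. In (iii) the second
term diverges logarithmically for the Coulomb kernel; the decay lost is recovered by bounding the
regularized kernel by `η ^ (-δ) |k| ^ (-2 - δ)`.
-/

noncomputable section

namespace TwoParticle

/-! ### Beta and Gamma integrals -/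

theorem lintegral_comp_mul_Ioi (f : ℝ → ℝ≥0∞) {c : ℝ} (hc : 0 < c) :
    ∫⁻ w in Set.Ioi 0, ENNReal.ofReal c * f (c * w) = ∫⁻ u in Set.Ioi 0, f u := by
  have himg : (fun w => c * w) '' Set.Ioi (0 : ℝ) = Set.Ioi 0 := by
    rw [Set.image_mul_left_Ioi hc, mul_zero]
  have h := lintegral_image_eq_lintegral_abs_deriv_mul (s := Set.Ioi (0 : ℝ))
    (f := fun w => c * w) (f' := fun _ => c) measurableSet_Ioi
    (fun x _ => by simpa using ((hasDerivAt_id x).const_mul c).hasDerivWithinAt)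
    (mul_right_injective₀ hc.ne').injOn f
  rw [← himg, h, himg, abs_of_pos hc]

theorem lintegral_comp_inv_Ioi (f : ℝ → ℝ≥0∞) :
    ∫⁻ w in Set.Ioi 0, ENNReal.ofReal (w ^ (-2 : ℝ)) * f w⁻¹ = ∫⁻ u in Set.Ioi 0, f u := by
  have himg : (fun w : ℝ => w⁻¹) '' Set.Ioi (0 : ℝ) = Set.Ioi 0 := by
    ext; simp
  have h := lintegral_image_eq_lintegral_abs_deriv_mul (s := Set.Ioi (0 : ℝ))
    (f := fun w => w⁻¹) (f' := fun w => -(w ^ 2)⁻¹) measurableSet_Ioi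
    (fun x hx => (hasDerivAt_inv (ne_of_gt hx)).hasDerivWithinAt) inv_injective.injOn f
  rw [himg] at h
  rw [h]
  refine setLIntegral_congr_fun measurableSet_Ioi fun w (hw : 0 < w) => ?_
  rw [abs_neg, abs_of_pos (by positivity), Real.rpow_neg hw.le, Real.rpow_two]

theorem lintegral_rpow_mul_exp {s r : ℝ} (hs : 0 < s) (hr : 0 < r) :
    ∫⁻ u in Set.Ioi 0, ENNReal.ofReal (u ^ (s - 1) * Real.exp (-(r * u)))
      = ENNReal.ofReal (Real.Gamma s * r ^ (-s)) := by
  rw [← ofReal_integral_eq_lintegral_ofReal, Real.integral_rpow_mul_exp_neg_mul_Ioi hs hr]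
  · rw [one_div, Real.inv_rpow hr.le, Real.rpow_neg hr.le, mul_comm]
  · simpa [IntegrableOn] using integrableOn_rpow_mul_exp_neg_mul_rpow (p := 1) (s := s - 1) (b := r)
      (by linarith) one_pos hr
  · filter_upwards [ae_restrict_mem measurableSet_Ioi] with u (hu : 0 < u)
    simp only [Pi.zero_apply]
    positivity

theorem lintegral_rpow_mul_exp_div {s r : ℝ} (hs : 0 < s) (hr : 0 < r) :
    ∫⁻ u in Set.Ioi 0, ENNReal.ofReal (u ^ (-s - 1) * Real.exp (-(r / u)))
      = ENNReal.ofReal (Real.Gamma s * r ^ (-s)) := by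
  rw [← lintegral_comp_inv_Ioi, ← lintegral_rpow_mul_exp hs hr]
  refine setLIntegral_congr_fun measurableSet_Ioi fun w (hw : 0 < w) => ?_
  rw [← ENNReal.ofReal_mul (by positivity), div_inv_eq_mul, Real.inv_rpow hw.le,
    ← Real.rpow_neg hw.le, ← mul_assoc, ← Real.rpow_add hw]
  ring_nf

theorem lintegral_rpow_mul_rpow_mul_comp_add (a b : ℝ) {F : ℝ → ℝ≥0∞} (hF : Measurable F) :
    ∫⁻ s in Set.Ioi (0 : ℝ), ∫⁻ t in Set.Ioi (0 : ℝ),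
        ENNReal.ofReal (s ^ (a - 1)) * (ENNReal.ofReal (t ^ (b - 1)) * F (s + t))
      = (∫⁻ w in Set.Ioi (0 : ℝ), ENNReal.ofReal (w ^ (b - 1) * (1 + w) ^ (-(a + b)))) *
        ∫⁻ r in Set.Ioi (0 : ℝ), ENNReal.ofReal (r ^ (a + b - 1)) * F r := by
  have inner_scale : ∀ s ∈ Set.Ioi (0 : ℝ), ∫⁻ t in Set.Ioi (0 : ℝ),
        ENNReal.ofReal (s ^ (a - 1)) * (ENNReal.ofReal (t ^ (b - 1)) * F (s + t))
      = ∫⁻ w in Set.Ioi (0 : ℝ), ENNReal.ofReal (w ^ (b - 1)) *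
          (ENNReal.ofReal (s ^ (a + b - 1)) * F ((1 + w) * s)) := by
    intro s (hs : 0 < s)
    rw [← lintegral_comp_mul_Ioi _ hs]
    refine setLIntegral_congr_fun measurableSet_Ioi fun w (hw : 0 < w) => ?_
    have hpow : s * s ^ (a - 1) * (s * w) ^ (b - 1) = w ^ (b - 1) * s ^ (a + b - 1) := by
      rw [Real.mul_rpow hs.le hw.le, show a + b - 1 = 1 + (a - 1) + (b - 1) by ring,
        Real.rpow_add hs, Real.rpow_add hs, Real.rpow_one]
      ring
    rw [← mul_assoc, ← mul_assoc, ← mul_assoc, ← ENNReal.ofReal_mul hs.le,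
      ← ENNReal.ofReal_mul (by positivity), ← ENNReal.ofReal_mul (by positivity), hpow]
    ring_nf
  rw [setLIntegral_congr_fun measurableSet_Ioi inner_scale, lintegral_lintegral_swap (by fun_prop),
    ← lintegral_mul_const _ (by fun_prop)]
  refine setLIntegral_congr_fun measurableSet_Ioi fun w (hw : 0 < w) => ?_
  have hw1 : 0 < 1 + w := by linarith
  rw [lintegral_const_mul _ (by fun_prop),
    ← lintegral_comp_mul_Ioi (fun r => ENNReal.ofReal (r ^ (a + b - 1)) * F r) hw1,
    ENNReal.ofReal_mul (by positivity), mul_assoc]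
  congr 1
  rw [← lintegral_const_mul _ (by fun_prop)]
  refine setLIntegral_congr_fun measurableSet_Ioi fun s (hs : 0 < s) => ?_
  have hpow : (1 + w) ^ (-(a + b)) * (1 + w) * ((1 + w) * s) ^ (a + b - 1) = s ^ (a + b - 1) := by
    nth_rw 2 [← Real.rpow_one (1 + w)]
    rw [Real.mul_rpow hw1.le hs.le, ← mul_assoc, ← Real.rpow_add hw1, ← Real.rpow_add hw1]
    simp
  rw [← mul_assoc, ← mul_assoc, ← ENNReal.ofReal_mul (by positivity),
    ← ENNReal.ofReal_mul (by positivity), hpow]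

/-- Take `F r = exp (-r)` in `lintegral_rpow_mul_rpow_mul_comp_add`. -/
theorem lintegral_beta {a b : ℝ} (ha : 0 < a) (hb : 0 < b) :
    ∫⁻ w in Set.Ioi (0 : ℝ), ENNReal.ofReal (w ^ (b - 1) * (1 + w) ^ (-(a + b)))
      = ENNReal.ofReal (Real.Gamma a * Real.Gamma b / Real.Gamma (a + b)) := by
  have gamma_eq {s : ℝ} (hs : 0 < s) : ∫⁻ u in Set.Ioi (0 : ℝ), ENNReal.ofReal (u ^ (s - 1)) *
      ENNReal.ofReal (Real.exp (-u)) = ENNReal.ofReal (Real.Gamma s) := by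
    have h := lintegral_rpow_mul_exp hs one_pos
    rw [Real.one_rpow, mul_one] at h
    rw [← h]
    refine setLIntegral_congr_fun measurableSet_Ioi fun u (hu : 0 < u) => ?_
    rw [one_mul, ENNReal.ofReal_mul (by positivity)]
  have h := lintegral_rpow_mul_rpow_mul_comp_add a b
    (F := fun r => ENNReal.ofReal (Real.exp (-r))) (by fun_prop)
  have hsplit (s t : ℝ) : ENNReal.ofReal (s ^ (a - 1)) *
        (ENNReal.ofReal (t ^ (b - 1)) * ENNReal.ofReal (Real.exp (-(s + t))))
      = ENNReal.ofReal (s ^ (a - 1)) * ENNReal.ofReal (Real.exp (-s)) *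
        (ENNReal.ofReal (t ^ (b - 1)) * ENNReal.ofReal (Real.exp (-t))) := by
    rw [neg_add, Real.exp_add, ENNReal.ofReal_mul (Real.exp_pos _).le]
    ring
  have hΓ : 0 < Real.Gamma (a + b) := Real.Gamma_pos_of_pos (add_pos ha hb)
  simp_rw [hsplit] at h
  rw [lintegral_congr fun s => lintegral_const_mul _ (by fun_prop),
    lintegral_mul_const _ (by fun_prop), gamma_eq ha, gamma_eq hb, gamma_eq (add_pos ha hb)] at h
  rw [ENNReal.ofReal_div_of_pos hΓ, ENNReal.ofReal_mul (Real.Gamma_pos_of_pos ha).le, h]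
  exact (ENNReal.mul_div_cancel_right (by simpa using hΓ) ENNReal.ofReal_ne_top).symm

/-! ### Gaussian kernels and the composition of Riesz potentials -/

/-- The constant in `∫₀^∞ u ^ (s - 1) * exp (-π u r²) du = gammaPi s * r ^ (-2 s)`, that is, the
archimedean Gamma factor `π ^ (-s) Γ(s)`. -/
def gammaPi (s : ℝ) : ℝ := Real.Gamma s * Real.pi ^ (-s)

theorem gammaPi_pos {s : ℝ} (hs : 0 < s) : 0 < gammaPi s :=
  mul_pos (Real.Gamma_pos_of_pos hs) (Real.rpow_pos_of_pos Real.pi_pos _)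

theorem gammaPi_one : gammaPi 1 = Real.pi⁻¹ := by
  rw [gammaPi, Real.Gamma_one, one_mul, Real.rpow_neg_one]

theorem gammaPi_half : gammaPi (1 / 2) = 1 := by
  rw [gammaPi, Real.Gamma_one_half_eq, Real.sqrt_eq_rpow, ← Real.rpow_add Real.pi_pos]
  norm_num

section Powers

variable {F : Type*} [NormedAddCommGroup F]

theorem ofReal_norm_rpow {y : F} (hy : y ≠ 0) (a : ℝ) : ENNReal.ofReal (‖y‖ ^ a) = ‖y‖ₑ ^ a := by
  rw [← ENNReal.ofReal_rpow_of_pos (norm_pos_iff.2 hy), ofReal_norm]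

theorem ofReal_gamma_mul_rpow_neg {s : ℝ} (hs : 0 < s) {y : F} (hy : y ≠ 0) :
    ENNReal.ofReal (Real.Gamma s * (Real.pi * ‖y‖ ^ 2) ^ (-s))
      = ENNReal.ofReal (gammaPi s) * ‖y‖ₑ ^ (-(2 * s)) := by
  rw [← ofReal_norm_rpow hy, ← ENNReal.ofReal_mul (gammaPi_pos hs).le,
    Real.mul_rpow Real.pi_pos.le (by positivity), gammaPi, ← Real.rpow_natCast,
    ← Real.rpow_mul (norm_nonneg y)]
  push_cast
  ring_nf

theorem lintegral_rpow_mul_gaussian {s : ℝ} (hs : 0 < s) {y : F} (hy : y ≠ 0) :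
    ∫⁻ u in Set.Ioi 0, ENNReal.ofReal (u ^ (s - 1) * Real.exp (-(Real.pi * u * ‖y‖ ^ 2)))
      = ENNReal.ofReal (gammaPi s) * ‖y‖ₑ ^ (-(2 * s)) := by
  have : 0 < ‖y‖ := norm_pos_iff.2 hy
  rw [← ofReal_gamma_mul_rpow_neg hs hy, ← lintegral_rpow_mul_exp hs (by positivity)]
  simp_rw [mul_right_comm]

end Powers

section GaussKer

variable {E : Type*} [NormedAddCommGroup E] [InnerProductSpace ℝ E]

/-- The centred Gaussian probability density on `E` of width `u`: the Fourier transform of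
`x ↦ exp (-π u ‖x‖²)`, and the heat kernel at time `u / (4 π)`. -/
def gaussKer (u : ℝ) (k : E) : ℝ :=
  u ^ (-(Module.finrank ℝ E / 2 : ℝ)) * Real.exp (-(Real.pi / u * ‖k‖ ^ 2))

theorem gaussKer_pos {u : ℝ} (hu : 0 < u) (k : E) : 0 < gaussKer u k := by
  unfold gaussKer; positivity

theorem lintegral_rpow_mul_gaussKer {s : ℝ} (hs : s < Module.finrank ℝ E / 2) {k : E}
    (hk : k ≠ 0) :
    ∫⁻ u in Set.Ioi 0, ENNReal.ofReal (u ^ (s - 1) * gaussKer u k)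
      = ENNReal.ofReal (gammaPi (Module.finrank ℝ E / 2 - s)) *
        ‖k‖ₑ ^ (2 * s - Module.finrank ℝ E) := by
  have : 0 < ‖k‖ := norm_pos_iff.2 hk
  have hpos : 0 < (Module.finrank ℝ E / 2 - s : ℝ) := by linarith
  rw [show (2 * s - Module.finrank ℝ E : ℝ) = -(2 * (Module.finrank ℝ E / 2 - s)) by ring,
    ← ofReal_gamma_mul_rpow_neg hpos hk, ← lintegral_rpow_mul_exp_div hpos (by positivity)]
  refine setLIntegral_congr_fun measurableSet_Ioi fun u (hu : 0 < u) => ?_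
  rw [gaussKer, ← mul_assoc, ← Real.rpow_add hu]
  ring_nf

variable [MeasurableSpace E] [BorelSpace E]

@[fun_prop]
theorem measurable_gaussKer : Measurable fun q : ℝ × E => gaussKer q.1 q.2 := by
  unfold gaussKer; fun_prop

variable [FiniteDimensional ℝ E]

theorem lintegral_gaussKer {u : ℝ} (hu : 0 < u) : ∫⁻ k : E, ENNReal.ofReal (gaussKer u k) = 1 := by
  have h := GaussianFourier.integral_rexp_neg_mul_sq_norm (V := E) (b := Real.pi / u)
    (by positivity)
  have hint : Integrable fun k : E => Real.exp (-(Real.pi / u) * ‖k‖ ^ 2) := by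
    refine Integrable.of_integral_ne_zero ?_
    rw [h]
    positivity
  have hone : ∫ k : E, gaussKer u k = 1 := by
    simp only [gaussKer, ← neg_mul, integral_const_mul]
    rw [h, show Real.pi / (Real.pi / u) = u by field_simp, ← Real.rpow_add hu, neg_add_cancel,
      Real.rpow_zero]
  rw [← ofReal_integral_eq_lintegral_ofReal _ (.of_forall fun k => (gaussKer_pos hu k).le), hone,
    ENNReal.ofReal_one]
  simpa only [gaussKer, ← neg_mul] using hint.const_mul _

theorem lintegral_gaussKer_mul_gaussKer {s t : ℝ} (hs : 0 < s) (ht : 0 < t) (p : E) :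
    ∫⁻ k : E, ENNReal.ofReal (gaussKer s k) * ENNReal.ofReal (gaussKer t (p - k))
      = ENNReal.ofReal (gaussKer (s + t) p) := by
  have hst : 0 < s + t := by positivity
  have complete_square (k : E) : Real.pi / s * ‖k‖ ^ 2 + Real.pi / t * ‖p - k‖ ^ 2
      = Real.pi / (s + t) * ‖p‖ ^ 2
        + Real.pi / (s * t / (s + t)) * ‖k - (s / (s + t)) • p‖ ^ 2 := by
    rw [norm_sub_sq_real, norm_sub_sq_real, norm_smul, inner_smul_right, real_inner_comm k p,
      mul_pow, Real.norm_of_nonneg (by positivity)]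
    field_simp
    ring
  have hprod (k : E) : ENNReal.ofReal (gaussKer s k) * ENNReal.ofReal (gaussKer t (p - k))
      = ENNReal.ofReal (gaussKer (s + t) p) *
        ENNReal.ofReal (gaussKer (s * t / (s + t)) (k - (s / (s + t)) • p)) := by
    rw [← ENNReal.ofReal_mul (gaussKer_pos hs k).le, ← ENNReal.ofReal_mul (gaussKer_pos hst p).le]
    simp only [gaussKer]
    rw [mul_mul_mul_comm, ← Real.exp_add, ← neg_add, complete_square, neg_add, Real.exp_add,
      mul_mul_mul_comm ((s + t) ^ _), ← Real.mul_rpow hs.le ht.le,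
      ← Real.mul_rpow hst.le (by positivity), mul_div_cancel₀ _ hst.ne']
  simp_rw [hprod]
  rw [lintegral_const_mul _ (by fun_prop),
    lintegral_sub_right_eq_self (fun k : E => ENNReal.ofReal (gaussKer (s * t / (s + t)) k)),
    lintegral_gaussKer (by positivity), mul_one]

/-- The constant of the composition formula of Riesz potentials, written symmetrically in exponents
with `a + b + c = d / 2`. -/
def rieszConst (a b c : ℝ) : ℝ :=
  gammaPi a * gammaPi b * gammaPi c / (gammaPi (a + b) * gammaPi (b + c) * gammaPi (a + c))

theorem rieszConst_half : rieszConst (1 / 2) (1 / 2) (1 / 2) = Real.pi ^ 3 := by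
  rw [rieszConst, add_halves, gammaPi_half, gammaPi_one]
  field_simp

theorem rieszConst_pos {a b c : ℝ} (ha : 0 < a) (hb : 0 < b) (hc : 0 < c) :
    0 < rieszConst a b c := by
  have := gammaPi_pos ha
  have := gammaPi_pos hb
  have := gammaPi_pos hc
  have := gammaPi_pos (add_pos ha hb)
  have := gammaPi_pos (add_pos hb hc)
  have := gammaPi_pos (add_pos ha hc)
  unfold rieszConst
  positivity

theorem gammaPi_mul_gammaPi_div {a b : ℝ} :
    gammaPi a * gammaPi b / gammaPi (a + b)
      = Real.Gamma a * Real.Gamma b / Real.Gamma (a + b) := by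
  have hpi : Real.pi ^ (-(a + b)) = Real.pi ^ (-a) * Real.pi ^ (-b) := by
    rw [neg_add, Real.rpow_add Real.pi_pos]
  have : Real.pi ^ (-a) ≠ 0 := (Real.rpow_pos_of_pos Real.pi_pos _).ne'
  have : Real.pi ^ (-b) ≠ 0 := (Real.rpow_pos_of_pos Real.pi_pos _).ne'
  rw [gammaPi, gammaPi, gammaPi, hpi, mul_mul_mul_comm, mul_div_mul_right _ _ (by positivity)]

theorem lintegral_convolution_rpow_mul_gaussKer {a b c : ℝ} (ha : 0 < a) (hb : 0 < b) (hc : 0 < c)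
    (habc : a + b + c = Module.finrank ℝ E / 2) {p : E} (hp : p ≠ 0) :
    ∫⁻ k : E, (∫⁻ s in Set.Ioi 0, ENNReal.ofReal (s ^ (a - 1) * gaussKer s k)) *
        ∫⁻ t in Set.Ioi 0, ENNReal.ofReal (t ^ (b - 1) * gaussKer t (p - k))
      = ENNReal.ofReal (gammaPi a * gammaPi b / gammaPi (a + b)) *
        (ENNReal.ofReal (gammaPi c) * ‖p‖ₑ ^ (-(2 * c))) := by
  have expand (k : E) : (∫⁻ s in Set.Ioi 0, ENNReal.ofReal (s ^ (a - 1) * gaussKer s k)) *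
        (∫⁻ t in Set.Ioi 0, ENNReal.ofReal (t ^ (b - 1) * gaussKer t (p - k)))
      = ∫⁻ s in Set.Ioi (0 : ℝ), ∫⁻ t in Set.Ioi (0 : ℝ), ENNReal.ofReal (s ^ (a - 1)) *
        (ENNReal.ofReal (t ^ (b - 1)) *
          (ENNReal.ofReal (gaussKer s k) * ENNReal.ofReal (gaussKer t (p - k)))) := by
    rw [← lintegral_mul_const _ (by fun_prop)]
    refine setLIntegral_congr_fun measurableSet_Ioi fun s (hs : 0 < s) => ?_
    rw [← lintegral_const_mul _ (by fun_prop)]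
    refine setLIntegral_congr_fun measurableSet_Ioi fun t (ht : 0 < t) => ?_
    rw [ENNReal.ofReal_mul (by positivity), ENNReal.ofReal_mul (by positivity)]
    ring
  simp_rw [expand]
  rw [lintegral_lintegral_swap (by fun_prop)]
  have integrate_k : ∀ s ∈ Set.Ioi (0 : ℝ), (∫⁻ k : E, ∫⁻ t in Set.Ioi (0 : ℝ),
        ENNReal.ofReal (s ^ (a - 1)) * (ENNReal.ofReal (t ^ (b - 1)) *
          (ENNReal.ofReal (gaussKer s k) * ENNReal.ofReal (gaussKer t (p - k)))))
      = ∫⁻ t in Set.Ioi (0 : ℝ), ENNReal.ofReal (s ^ (a - 1)) * (ENNReal.ofReal (t ^ (b - 1)) *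
          ENNReal.ofReal (gaussKer (s + t) p)) := by
    intro s hs
    rw [lintegral_lintegral_swap (by fun_prop)]
    refine setLIntegral_congr_fun measurableSet_Ioi fun t ht => ?_
    rw [lintegral_const_mul _ (by fun_prop), lintegral_const_mul _ (by fun_prop),
      lintegral_gaussKer_mul_gaussKer hs ht]
  rw [setLIntegral_congr_fun measurableSet_Ioi integrate_k,
    lintegral_rpow_mul_rpow_mul_comp_add a b (F := fun r => ENNReal.ofReal (gaussKer r p))
      (by fun_prop), lintegral_beta ha hb, gammaPi_mul_gammaPi_div]
  congr 1
  have h := lintegral_rpow_mul_gaussKer (s := a + b) (by linarith) hp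
  rw [← habc, show a + b + c - (a + b) = c by ring,
    show 2 * (a + b) - Module.finrank ℝ E = -(2 * c) by linarith] at h
  rw [← h]
  refine setLIntegral_congr_fun measurableSet_Ioi fun r (hr : 0 < r) => ?_
  rw [ENNReal.ofReal_mul (by positivity)]

theorem lintegral_enorm_rpow_mul_enorm_sub_rpow {a b c : ℝ} (ha : 0 < a) (hb : 0 < b) (hc : 0 < c)
    (habc : a + b + c = Module.finrank ℝ E / 2) {p : E} (hp : p ≠ 0) :
    ∫⁻ k : E, ‖k‖ₑ ^ (-(2 * (b + c))) * ‖p - k‖ₑ ^ (-(2 * (a + c)))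
      = ENNReal.ofReal (rieszConst a b c) * ‖p‖ₑ ^ (-(2 * c)) := by
  have : Nontrivial E := ⟨p, 0, hp⟩
  have hbc := gammaPi_pos (add_pos hb hc)
  have hac := gammaPi_pos (add_pos ha hc)
  have h := lintegral_convolution_rpow_mul_gaussKer ha hb hc habc hp
  have mixture : ∀ᵐ k : E, (∫⁻ s in Set.Ioi 0, ENNReal.ofReal (s ^ (a - 1) * gaussKer s k)) *
        (∫⁻ t in Set.Ioi 0, ENNReal.ofReal (t ^ (b - 1) * gaussKer t (p - k)))
      = ENNReal.ofReal (gammaPi (b + c) * gammaPi (a + c)) *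
        (‖k‖ₑ ^ (-(2 * (b + c))) * ‖p - k‖ₑ ^ (-(2 * (a + c)))) := by
    filter_upwards [Measure.ae_ne volume (0 : E), Measure.ae_ne volume p] with k hk hkp
    rw [lintegral_rpow_mul_gaussKer (by linarith) hk,
      lintegral_rpow_mul_gaussKer (by linarith) (sub_ne_zero.2 hkp.symm), ← habc,
      show a + b + c - a = b + c by ring, show a + b + c - b = a + c by ring,
      show 2 * a - Module.finrank ℝ E = -(2 * (b + c)) by linarith,
      show 2 * b - Module.finrank ℝ E = -(2 * (a + c)) by linarith,
      ENNReal.ofReal_mul hbc.le]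
    ring
  rw [lintegral_congr_ae mixture, lintegral_const_mul _ (by fun_prop)] at h
  have hconst : rieszConst a b c = (gammaPi (b + c) * gammaPi (a + c))⁻¹ *
      (gammaPi a * gammaPi b / gammaPi (a + b) * gammaPi c) := by
    rw [rieszConst]
    field_simp
  rw [hconst, ENNReal.ofReal_mul (by positivity), ENNReal.ofReal_mul' (gammaPi_pos hc).le,
    mul_assoc, mul_assoc, ← h, ENNReal.ofReal_inv_of_pos (by positivity), ← mul_assoc,
    ENNReal.inv_mul_cancel (by simpa using mul_pos hbc hac) ENNReal.ofReal_ne_top, one_mul]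

end GaussKer

/-! ### Interactions in momentum space and the Schur test -/

section ShiftForm

variable {E : Type*} [NormedAddCommGroup E]

/-- The shift `(k, -k)` of a pair of momenta, which preserves their sum. -/
def relShift (k : E) : WithLp 2 (E × E) := WithLp.toLp 2 (k, -k)

theorem relShift_neg (k : E) : relShift (-k) = -relShift k := rfl

@[simp] theorem sub_relShift_fst (ξ : WithLp 2 (E × E)) (k : E) :
    (ξ - relShift k).fst = ξ.fst - k := rfl

@[simp] theorem sub_relShift_snd (ξ : WithLp 2 (E × E)) (k : E) :
    (ξ - relShift k).snd = ξ.snd + k := sub_neg_eq_add _ _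

@[fun_prop]
theorem continuous_relShift : Continuous (relShift : E → WithLp 2 (E × E)) := by
  unfold relShift
  fun_prop

/-- The weight `|ξ₁| ^ a * |ξ₂| ^ c`. -/
def momentumWeight (a c : ℝ) (ξ : WithLp 2 (E × E)) : ℝ≥0∞ := ‖ξ.fst‖ₑ ^ a * ‖ξ.snd‖ₑ ^ c

theorem momentumWeight_zero : momentumWeight 0 0 = (1 : WithLp 2 (E × E) → ℝ≥0∞) := by
  ext ξ
  simp [momentumWeight]

theorem momentumWeight_mul {ξ : WithLp 2 (E × E)} (h1 : ξ.fst ≠ 0) (h2 : ξ.snd ≠ 0)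
    (a c a' c' : ℝ) :
    momentumWeight a c ξ * momentumWeight a' c' ξ = momentumWeight (a + a') (c + c') ξ := by
  unfold momentumWeight
  rw [ENNReal.rpow_add _ _ (enorm_ne_zero.2 h1) enorm_ne_top,
    ENNReal.rpow_add _ _ (enorm_ne_zero.2 h2) enorm_ne_top, mul_mul_mul_comm]

theorem momentumWeight_inv {ξ : WithLp 2 (E × E)} (h1 : ξ.fst ≠ 0) (h2 : ξ.snd ≠ 0) (a c : ℝ) :
    (momentumWeight a c ξ)⁻¹ = momentumWeight (-a) (-c) ξ := by
  refine (ENNReal.eq_inv_of_mul_eq_one_left ?_).symm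
  rw [momentumWeight_mul h1 h2, neg_add_cancel, neg_add_cancel, momentumWeight_zero,
    Pi.one_apply]

theorem momentumWeight_ne_zero_ne_top {ξ : WithLp 2 (E × E)} (h1 : ξ.fst ≠ 0) (h2 : ξ.snd ≠ 0)
    (a c : ℝ) : momentumWeight a c ξ ≠ 0 ∧ momentumWeight a c ξ ≠ ∞ := by
  have h1' : ‖ξ.fst‖ₑ ≠ 0 := enorm_ne_zero.2 h1
  have h2' : ‖ξ.snd‖ₑ ≠ 0 := enorm_ne_zero.2 h2
  constructor
  · exact mul_ne_zero (by simp [ENNReal.rpow_eq_zero_iff, h1'])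
      (by simp [ENNReal.rpow_eq_zero_iff, h2'])
  · exact ENNReal.mul_ne_top (by simp [ENNReal.rpow_eq_top_iff, h1'])
      (by simp [ENNReal.rpow_eq_top_iff, h2'])

variable [InnerProductSpace ℝ E] [FiniteDimensional ℝ E] [MeasurableSpace E] [BorelSpace E]

@[fun_prop]
theorem measurable_pair_fst : Measurable fun ξ : WithLp 2 (E × E) => ξ.fst :=
  (WithLp.continuous_fst 2 E E).measurable

@[fun_prop]
theorem measurable_pair_snd : Measurable fun ξ : WithLp 2 (E × E) => ξ.snd :=
  (WithLp.continuous_snd 2 E E).measurable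

@[fun_prop]
theorem measurable_relShift : Measurable (relShift : E → WithLp 2 (E × E)) :=
  continuous_relShift.measurable

@[fun_prop]
theorem measurable_momentumWeight (a c : ℝ) :
    Measurable (momentumWeight a c : WithLp 2 (E × E) → ℝ≥0∞) := by
  unfold momentumWeight
  fun_prop

theorem ae_pair_of_forall_ae {p : E → E → Prop} (hp : MeasurableSet {z : E × E | p z.1 z.2})
    (h : ∀ x, ∀ᵐ y : E, p x y) : ∀ᵐ ξ : WithLp 2 (E × E), p ξ.fst ξ.snd := by
  have hprod : ∀ᵐ z : E × E, p z.1 z.2 := by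
    rw [Measure.volume_eq_prod, Measure.ae_prod_iff_ae_ae hp]
    exact .of_forall h
  exact (WithLp.volume_preserving_ofLp E E).quasiMeasurePreserving.ae hprod

theorem ae_snd_ne_zero [Nontrivial E] : ∀ᵐ ξ : WithLp 2 (E × E), ξ.snd ≠ 0 :=
  ae_pair_of_forall_ae (p := fun _ y => y ≠ 0) (measurable_snd (measurableSet_singleton 0).compl)
    fun _ => Measure.ae_ne volume 0

theorem ae_fst_ne_zero [Nontrivial E] : ∀ᵐ ξ : WithLp 2 (E × E), ξ.fst ≠ 0 := by
  have hprod : ∀ᵐ z : E × E, z.1 ≠ 0 := by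
    rw [Measure.volume_eq_prod]
    exact Measure.quasiMeasurePreserving_fst.ae (Measure.ae_ne volume 0)
  exact (WithLp.volume_preserving_ofLp E E).quasiMeasurePreserving.ae hprod

theorem ae_fst_sub_snd_ne_zero [Nontrivial E] : ∀ᵐ ξ : WithLp 2 (E × E), ξ.fst - ξ.snd ≠ 0 :=
  ae_pair_of_forall_ae (p := fun x y => x - y ≠ 0)
    ((measurable_fst.sub measurable_snd) (measurableSet_singleton 0).compl)
    fun x => by simpa only [ne_eq, sub_eq_zero, eq_comm] using Measure.ae_ne volume x

theorem ae_momentumWeight_ne_zero_ne_top [Nontrivial E] (a c : ℝ) :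
    ∀ᵐ ξ : WithLp 2 (E × E), momentumWeight a c ξ ≠ 0 ∧ momentumWeight a c ξ ≠ ∞ := by
  filter_upwards [ae_fst_ne_zero, ae_snd_ne_zero] with ξ h1 h2
  exact momentumWeight_ne_zero_ne_top h1 h2 a c

/-- The form `∬ g(ξ) κ(k) f(ξ - (k, -k)) dk dξ` in momentum space of an interaction that depends on
the relative position only and whose Fourier transform is `κ`. -/
def shiftForm (κ : E → ℝ≥0∞) (g f : WithLp 2 (E × E) → ℝ≥0∞) : ℝ≥0∞ :=
  ∫⁻ k, κ k * ∫⁻ ξ, g ξ * f (ξ - relShift k)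

theorem shiftForm_mono {κ κ' : E → ℝ≥0∞} {g g' f f' : WithLp 2 (E × E) → ℝ≥0∞}
    (hκ : ∀ᵐ k, κ k ≤ κ' k) (hg : ∀ᵐ ξ, g ξ ≤ g' ξ) (hf : ∀ᵐ ξ, f ξ ≤ f' ξ) :
    shiftForm κ g f ≤ shiftForm κ' g' f' := by
  refine lintegral_mono_ae ?_
  filter_upwards [hκ] with k hk
  refine mul_le_mul' hk (lintegral_mono_ae ?_)
  have hf' := (measurePreserving_sub_right volume (relShift k)).quasiMeasurePreserving.ae hf
  filter_upwards [hg, hf'] with ξ h1 h2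
  exact mul_le_mul' h1 h2

theorem shiftForm_const_mul {κ : E → ℝ≥0∞} (hκ : Measurable κ) {g f : WithLp 2 (E × E) → ℝ≥0∞}
    (hg : Measurable g) (hf : Measurable f) (c : ℝ≥0∞) :
    shiftForm (fun k => c * κ k) g f = c * shiftForm κ g f := by
  unfold shiftForm
  rw [← lintegral_const_mul _ (by fun_prop)]
  exact lintegral_congr fun k => mul_assoc _ _ _

theorem shiftForm_le_lintegral_mul {κ : E → ℝ≥0∞} (hκ : Measurable κ)
    {g f : WithLp 2 (E × E) → ℝ≥0∞} (hg : Measurable g) (hf : Measurable f) :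
    shiftForm κ g f ≤ (∫⁻ k, κ k) * ((∫⁻ ξ, g ξ ^ 2) ^ (1 / 2 : ℝ) *
      (∫⁻ ξ, f ξ ^ 2) ^ (1 / 2 : ℝ)) := by
  rw [← lintegral_mul_const _ hκ]
  refine lintegral_mono fun k => ?_
  gcongr
  have h := ENNReal.lintegral_mul_le_Lp_mul_Lq volume Real.HolderConjugate.two_two
    hg.aemeasurable (g := fun ξ => f (ξ - relShift k)) (by fun_prop)
  simp only [ENNReal.rpow_two] at h
  rwa [lintegral_sub_right_eq_self (fun ξ => f ξ ^ 2)] at h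

theorem lintegral_mul_le_of_weights {X : Type*} [MeasurableSpace X] {μ : Measure X}
    {w g f A B : X → ℝ≥0∞} (hw : Measurable w) (hg : Measurable g) (hf : Measurable f)
    (hA : Measurable A) (hB : Measurable B) (hA0 : ∀ᵐ x ∂μ, A x ≠ 0 ∧ A x ≠ ∞)
    (hB0 : ∀ᵐ x ∂μ, B x ≠ 0 ∧ B x ≠ ∞) :
    ∫⁻ x, w x * (g x * f x) ∂μ ≤
      (∫⁻ x, g x ^ 2 * (A x)⁻¹ * (w x * B x) ∂μ) ^ (1 / 2 : ℝ) *
      (∫⁻ x, f x ^ 2 * (B x)⁻¹ * (w x * A x) ∂μ) ^ (1 / 2 : ℝ) := by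
  have sqrt_sq (x : ℝ≥0∞) : (x ^ (1 / 2 : ℝ)) ^ (2 : ℝ) = x := by
    rw [← ENNReal.rpow_mul]; norm_num
  have sq_sqrt (x : ℝ≥0∞) : (x ^ 2) ^ (1 / 2 : ℝ) = x := by
    rw [← ENNReal.rpow_two, ← ENNReal.rpow_mul]; norm_num
  have h := ENNReal.lintegral_mul_le_Lp_mul_Lq μ Real.HolderConjugate.two_two
    (f := fun x => (g x ^ 2 * (A x)⁻¹ * (w x * B x)) ^ (1 / 2 : ℝ))
    (g := fun x => (f x ^ 2 * (B x)⁻¹ * (w x * A x)) ^ (1 / 2 : ℝ)) (by fun_prop) (by fun_prop)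
  simp only [sqrt_sq] at h
  refine (lintegral_congr_ae ?_).trans_le h
  filter_upwards [hA0, hB0] with x ha hb
  have hsq : g x ^ 2 * (A x)⁻¹ * (w x * B x) * (f x ^ 2 * (B x)⁻¹ * (w x * A x))
      = (w x * (g x * f x)) ^ 2 := by
    calc _ = (w x * (g x * f x)) ^ 2 * (A x * (A x)⁻¹) * (B x * (B x)⁻¹) := by ring
      _ = _ := by rw [ENNReal.mul_inv_cancel ha.1 ha.2, ENNReal.mul_inv_cancel hb.1 hb.2,
        mul_one, mul_one]
  rw [Pi.mul_apply, ← ENNReal.mul_rpow_of_nonneg _ _ (by norm_num), hsq, sq_sqrt]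

theorem shiftForm_schur {κ : E → ℝ≥0∞} (hκ : Measurable κ) {g f A B : WithLp 2 (E × E) → ℝ≥0∞}
    (hg : Measurable g) (hf : Measurable f) (hA : Measurable A) (hB : Measurable B)
    (hA0 : ∀ᵐ ξ, A ξ ≠ 0 ∧ A ξ ≠ ∞) (hB0 : ∀ᵐ ξ, B ξ ≠ 0 ∧ B ξ ≠ ∞) :
    shiftForm κ g f ≤
      (∫⁻ ξ, g ξ ^ 2 * (A ξ)⁻¹ * ∫⁻ k, κ k * B (ξ - relShift k)) ^ (1 / 2 : ℝ) *
      (∫⁻ ξ, f ξ ^ 2 * (B ξ)⁻¹ * ∫⁻ k, κ k * A (ξ + relShift k)) ^ (1 / 2 : ℝ) := by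
  have unfold_form : shiftForm κ g f
      = ∫⁻ z : E × WithLp 2 (E × E), κ z.1 * (g z.2 * f (z.2 - relShift z.1)) := by
    rw [Measure.volume_eq_prod, lintegral_prod _ (by fun_prop)]
    exact lintegral_congr fun k => (lintegral_const_mul _ (by fun_prop)).symm
  have hB0' : ∀ᵐ z : E × WithLp 2 (E × E),
      B (z.2 - relShift z.1) ≠ 0 ∧ B (z.2 - relShift z.1) ≠ ∞ := by
    rw [Measure.volume_eq_prod, Measure.ae_prod_iff_ae_ae (by measurability)]
    exact .of_forall fun k =>
      (measurePreserving_sub_right volume (relShift k)).quasiMeasurePreserving.ae hB0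
  have hA0' : ∀ᵐ z : E × WithLp 2 (E × E), A z.2 ≠ 0 ∧ A z.2 ≠ ∞ :=
    Measure.quasiMeasurePreserving_snd.ae hA0
  rw [unfold_form]
  refine (lintegral_mul_le_of_weights (by fun_prop) (by fun_prop) (by fun_prop)
    (A := fun z => A z.2) (B := fun z => B (z.2 - relShift z.1)) (by fun_prop) (by fun_prop)
    hA0' hB0').trans_eq ?_
  congr 2
  · rw [Measure.volume_eq_prod, lintegral_prod_symm _ (by fun_prop)]
    exact lintegral_congr fun ξ => lintegral_const_mul (g ξ ^ 2 * (A ξ)⁻¹)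
      (f := fun k => κ k * B (ξ - relShift k)) (by fun_prop)
  · rw [Measure.volume_eq_prod, lintegral_prod _ (by fun_prop)]
    have shift_back (k : E) : ∫⁻ ξ, f (ξ - relShift k) ^ 2 * (B (ξ - relShift k))⁻¹ * (κ k * A ξ)
        = ∫⁻ ξ, f ξ ^ 2 * (B ξ)⁻¹ * (κ k * A (ξ + relShift k)) := by
      rw [← lintegral_add_right_eq_self _ (relShift k)]
      simp only [add_sub_cancel_right]
    simp only [shift_back]
    rw [lintegral_lintegral_swap (by fun_prop)]
    refine lintegral_congr fun ξ => ?_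
    rw [lintegral_const_mul _ (by fun_prop)]

/-- The constant in the convolution `|·| ^ (b - d) ∗ |·| ^ (-Z) = powConvConst d b Z |·| ^ (b - Z)`
on a `d`-dimensional space, `0 < b < Z < d`. -/
def powConvConst (d b Z : ℝ) : ℝ := rieszConst (b / 2) ((d - Z) / 2) ((Z - b) / 2)

theorem lintegral_enorm_rpow_sub_finrank_mul {b Z : ℝ} (hb : 0 < b) (hbZ : b < Z)
    (hZ : Z < Module.finrank ℝ E) {p : E} (hp : p ≠ 0) :
    ∫⁻ k : E, ‖k‖ₑ ^ (b - Module.finrank ℝ E) * ‖p - k‖ₑ ^ (-Z)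
      = ENNReal.ofReal (powConvConst (Module.finrank ℝ E) b Z) * ‖p‖ₑ ^ (-(Z - b)) := by
  have h := lintegral_enorm_rpow_mul_enorm_sub_rpow (a := b / 2)
    (b := (Module.finrank ℝ E - Z) / 2) (c := (Z - b) / 2) (by linarith) (by linarith)
    (by linarith) (by ring) hp
  rw [powConvConst]
  convert h using 4 <;> ring_nf

theorem lintegral_rpow_mul_momentumWeight_sub_le {b Z θ : ℝ} (hb : 0 < b) (hbZ : b < Z)
    (hZ : Z < Module.finrank ℝ E) (hθ : 0 ≤ θ) (hθ' : θ ≤ 1) {ξ : WithLp 2 (E × E)}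
    (h1 : ξ.fst ≠ 0) (h2 : ξ.snd ≠ 0) :
    ∫⁻ k : E, ‖k‖ₑ ^ (b - Module.finrank ℝ E) *
        momentumWeight (-(θ * Z)) (-((1 - θ) * Z)) (ξ - relShift k)
      ≤ ENNReal.ofReal (powConvConst (Module.finrank ℝ E) b Z) *
        momentumWeight (-(θ * (Z - b))) (-((1 - θ) * (Z - b))) ξ := by
  have : Nontrivial E := ⟨_, _, h1⟩
  have hθ1 : 0 ≤ 1 - θ := by linarith
  have factor : ∀ᵐ k : E, ‖k‖ₑ ^ (b - Module.finrank ℝ E) *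
        momentumWeight (-(θ * Z)) (-((1 - θ) * Z)) (ξ - relShift k)
      = (‖k‖ₑ ^ (b - Module.finrank ℝ E) * ‖ξ.fst - k‖ₑ ^ (-Z)) ^ θ *
        (‖k‖ₑ ^ (b - Module.finrank ℝ E) * ‖ξ.snd + k‖ₑ ^ (-Z)) ^ (1 - θ) := by
    filter_upwards [Measure.ae_ne volume (0 : E)] with k hk
    rw [ENNReal.mul_rpow_of_nonneg _ _ hθ, ENNReal.mul_rpow_of_nonneg _ _ hθ1, momentumWeight,
      ← ENNReal.rpow_mul, ← ENNReal.rpow_mul, ← ENNReal.rpow_mul, ← ENNReal.rpow_mul,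
      mul_mul_mul_comm, ← ENNReal.rpow_add _ _ (enorm_ne_zero.2 hk) enorm_ne_top,
      sub_relShift_fst, sub_relShift_snd]
    ring_nf
  have reflected : ∫⁻ k : E, ‖k‖ₑ ^ (b - Module.finrank ℝ E) * ‖ξ.snd + k‖ₑ ^ (-Z)
      = ENNReal.ofReal (powConvConst (Module.finrank ℝ E) b Z) * ‖ξ.snd‖ₑ ^ (-(Z - b)) := by
    rw [← lintegral_enorm_rpow_sub_finrank_mul hb hbZ hZ h2, ← lintegral_neg_eq_self]
    simp only [enorm_neg, sub_eq_add_neg]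
  rw [lintegral_congr_ae factor]
  refine (ENNReal.lintegral_mul_norm_pow_le (by fun_prop) (by fun_prop) hθ hθ1
    (by ring)).trans_eq ?_
  rw [lintegral_enorm_rpow_sub_finrank_mul hb hbZ hZ h1, reflected,
    ENNReal.mul_rpow_of_nonneg _ _ hθ, ENNReal.mul_rpow_of_nonneg _ _ hθ1, mul_mul_mul_comm,
    ← ENNReal.rpow_add_of_nonneg _ _ hθ hθ1, add_sub_cancel, ENNReal.rpow_one, momentumWeight,
    ← ENNReal.rpow_mul, ← ENNReal.rpow_mul]
  ring_nf

theorem lintegral_rpow_mul_momentumWeight_add_le {b Z θ : ℝ} (hb : 0 < b) (hbZ : b < Z)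
    (hZ : Z < Module.finrank ℝ E) (hθ : 0 ≤ θ) (hθ' : θ ≤ 1) {ξ : WithLp 2 (E × E)}
    (h1 : ξ.fst ≠ 0) (h2 : ξ.snd ≠ 0) :
    ∫⁻ k : E, ‖k‖ₑ ^ (b - Module.finrank ℝ E) *
        momentumWeight (-(θ * Z)) (-((1 - θ) * Z)) (ξ + relShift k)
      ≤ ENNReal.ofReal (powConvConst (Module.finrank ℝ E) b Z) *
        momentumWeight (-(θ * (Z - b))) (-((1 - θ) * (Z - b))) ξ := by
  rw [← lintegral_neg_eq_self]
  simp only [enorm_neg, relShift_neg, ← sub_eq_add_neg]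
  exact lintegral_rpow_mul_momentumWeight_sub_le hb hbZ hZ hθ hθ' h1 h2

/-- Schur test with the weights `|ξ₁| ^ (-θ' W) |ξ₂| ^ (-(1 - θ') W)` and
`|ξ₁| ^ (-θ Z) |ξ₂| ^ (-(1 - θ) Z)`. -/
theorem shiftForm_rpow_le [Nontrivial E] {b Z W θ θ' : ℝ} (hb : 0 < b) (hbZ : b < Z)
    (hZ : Z < Module.finrank ℝ E) (hbW : b < W) (hW : W < Module.finrank ℝ E)
    (hθ : 0 ≤ θ) (hθ1 : θ ≤ 1) (hθ' : 0 ≤ θ') (hθ1' : θ' ≤ 1)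
    {g f : WithLp 2 (E × E) → ℝ≥0∞} (hg : Measurable g) (hf : Measurable f) :
    shiftForm (fun k => ‖k‖ₑ ^ (b - Module.finrank ℝ E)) g f ≤
      (ENNReal.ofReal (powConvConst (Module.finrank ℝ E) b Z) * ∫⁻ ξ, g ξ ^ 2 *
        momentumWeight (θ' * W - θ * (Z - b)) ((1 - θ') * W - (1 - θ) * (Z - b)) ξ) ^ (1 / 2 : ℝ) *
      (ENNReal.ofReal (powConvConst (Module.finrank ℝ E) b W) * ∫⁻ ξ, f ξ ^ 2 *
        momentumWeight (θ * Z - θ' * (W - b)) ((1 - θ) * Z - (1 - θ') * (W - b)) ξ)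
          ^ (1 / 2 : ℝ) := by
  refine (shiftForm_schur (by fun_prop) hg hf
    (measurable_momentumWeight (-(θ' * W)) (-((1 - θ') * W)))
    (measurable_momentumWeight (-(θ * Z)) (-((1 - θ) * Z)))
    (ae_momentumWeight_ne_zero_ne_top _ _) (ae_momentumWeight_ne_zero_ne_top _ _)).trans ?_
  gcongr ?_ ^ _ * ?_ ^ _
  · rw [← lintegral_const_mul _ (by fun_prop)]
    refine lintegral_mono_ae ?_
    filter_upwards [ae_fst_ne_zero, ae_snd_ne_zero] with ξ h1 h2
    grw [lintegral_rpow_mul_momentumWeight_sub_le hb hbZ hZ hθ hθ1 h1 h2]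
    rw [momentumWeight_inv h1 h2, neg_neg, neg_neg, sub_eq_add_neg (θ' * W),
      sub_eq_add_neg ((1 - θ') * W), ← momentumWeight_mul h1 h2]
    exact le_of_eq (by ring)
  · rw [← lintegral_const_mul _ (by fun_prop)]
    refine lintegral_mono_ae ?_
    filter_upwards [ae_fst_ne_zero, ae_snd_ne_zero] with ξ h1 h2
    grw [lintegral_rpow_mul_momentumWeight_add_le hb hbW hW hθ' hθ1' h1 h2]
    rw [momentumWeight_inv h1 h2, neg_neg, neg_neg, sub_eq_add_neg (θ * Z),
      sub_eq_add_neg ((1 - θ) * Z), ← momentumWeight_mul h1 h2]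
    exact le_of_eq (by ring)

end ShiftForm

/-! ### Gaussian potentials and the Fourier transform -/

section Fourier

variable {W : Type*} [NormedAddCommGroup W] [InnerProductSpace ℝ W] [FiniteDimensional ℝ W]
  [MeasurableSpace W] [BorelSpace W]

variable (W) in
/-- The Hilbert space `L²(W; ℂ)` with respect to Lebesgue measure. -/
abbrev SquareIntegrable : Type _ := Lp (α := W) ℂ 2 (volume : Measure W)

/-- The unitary Fourier transform of `L²(W; ℂ)`. -/
abbrev ft : SquareIntegrable W ≃ₗᵢ[ℂ] SquareIntegrable W := Lp.fourierTransformₗᵢ W ℂ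

/-- The translation `f ↦ f(· - a)`. -/
def translate (a : W) : SquareIntegrable W →ₗᵢ[ℂ] SquareIntegrable W :=
  Lp.compMeasurePreservingₗᵢ ℂ (fun x => x - a) (measurePreserving_sub_right volume a)

theorem coeFn_translate (a : W) (f : SquareIntegrable W) :
    translate a f =ᵐ[volume] fun x => f (x - a) :=
  Lp.coeFn_compMeasurePreserving f (measurePreserving_sub_right volume a)

theorem memLp_fourierChar (a : W) :
    MemLp (fun x : W => (𝐞 (inner ℝ a x) : ℂ)) ∞ (volume : Measure W) :=
  memLp_top_of_bound (Continuous.aestronglyMeasurable (by fun_prop)) 1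
    (.of_forall fun _ => (Circle.norm_coe _).le)

/-- Multiplication by the character `x ↦ e^{2πi⟨a,x⟩}`. -/
def modulate (a : W) : SquareIntegrable W →L[ℂ] SquareIntegrable W :=
  (ContinuousLinearMap.mul ℂ ℂ).holderL volume ∞ 2 2 (memLp_fourierChar a).toLp

theorem coeFn_modulate (a : W) (f : SquareIntegrable W) :
    modulate a f =ᵐ[volume] fun x => (𝐞 (inner ℝ a x) : ℂ) * f x := by
  have h := (ContinuousLinearMap.mul ℂ ℂ).coeFn_holder (r := 2) (memLp_fourierChar a).toLp f
  filter_upwards [h, (memLp_fourierChar a).coeFn_toLp] with x h1 h2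
  change ((ContinuousLinearMap.mul ℂ ℂ).holder 2 (memLp_fourierChar a).toLp f) x = _
  rw [h1, h2]
  rfl

theorem toLp_compSubConst (a : W) (φ : SchwartzMap W ℂ) :
    (SchwartzMap.compSubConstCLM ℂ a φ).toLp 2 = translate a (φ.toLp 2) := by
  refine Lp.ext ?_
  have hs := (measurePreserving_sub_right volume a).quasiMeasurePreserving.ae
    (φ.coeFn_toLp 2 (volume : Measure W))
  filter_upwards [coeFn_translate a (φ.toLp 2), hs,
    (SchwartzMap.compSubConstCLM ℂ a φ).coeFn_toLp 2 (volume : Measure W)] with x e1 e2 e3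
  rw [e1, e2, e3]
  rfl

theorem fourierInv_compSubConst (a : W) (φ : SchwartzMap W ℂ) (x : W) :
    (𝓕⁻ (SchwartzMap.compSubConstCLM ℂ a φ)) x = (𝐞 (inner ℝ a x) : ℂ) * (𝓕⁻ φ) x := by
  rw [SchwartzMap.fourierInv_coe, SchwartzMap.fourierInv_coe, Real.fourierInv_eq,
    Real.fourierInv_eq, ← integral_add_right_eq_self _ a, ← integral_const_mul]
  refine integral_congr_ae (.of_forall fun v => ?_)
  simp only [SchwartzMap.compSubConstCLM_apply, add_sub_cancel_right, Circle.smul_def, smul_eq_mul]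
  rw [inner_add_left, AddChar.map_add_eq_mul, Circle.coe_mul]
  ring

theorem ft_symm_translate (a : W) (f : SquareIntegrable W) :
    ft.symm (translate a f) = modulate a (ft.symm f) := by
  refine DenseRange.induction_on
    (p := fun f : SquareIntegrable W => ft.symm (translate a f) = modulate a (ft.symm f))
    (SchwartzMap.denseRange_toLpCLM (p := 2) ENNReal.ofNat_ne_top) f ?_ ?_
  · exact isClosed_eq (by fun_prop) (by fun_prop)
  intro φ
  change 𝓕⁻ (translate a (φ.toLp 2)) = modulate a (𝓕⁻ (φ.toLp 2))
  rw [← toLp_compSubConst, SchwartzMap.toLp_fourierInv_eq, SchwartzMap.toLp_fourierInv_eq]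
  refine Lp.ext ?_
  filter_upwards [(𝓕⁻ (SchwartzMap.compSubConstCLM ℂ a φ)).coeFn_toLp 2 (volume : Measure W),
    coeFn_modulate a ((𝓕⁻ φ).toLp 2), (𝓕⁻ φ).coeFn_toLp 2 (volume : Measure W)] with x e1 e2 e3
  rw [e1, e2, e3, fourierInv_compSubConst]

theorem inner_modulate (a : W) (ψ φ : SquareIntegrable W) :
    inner ℂ ψ (modulate a φ) = inner ℂ (ft ψ) (translate a (ft φ)) := by
  rw [← ft.symm.inner_map_map (ft ψ), ft_symm_translate, LinearIsometryEquiv.symm_apply_apply,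
    LinearIsometryEquiv.symm_apply_apply]

theorem gaussian_eq_integral {u : ℝ} (hu : 0 < u) (y : W) :
    (Real.exp (-(Real.pi * u * ‖y‖ ^ 2)) : ℂ)
      = ∫ k : W, (gaussKer u k : ℂ) * (𝐞 (inner ℝ k y) : ℂ) := by
  have h := GaussianFourier.integral_cexp_neg_mul_sq_norm_add (b := ((Real.pi / u : ℝ) : ℂ))
    (by rw [Complex.ofReal_re]; positivity) (2 * Real.pi * Complex.I) y
  have hb : (Real.pi : ℂ) / ((Real.pi / u : ℝ) : ℂ) = (u : ℂ) := by
    push_cast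
    field_simp
  have he : (2 * Real.pi * Complex.I) ^ 2 * (‖y‖ : ℂ) ^ 2 / (4 * ((Real.pi / u : ℝ) : ℂ))
      = ((-(Real.pi * u * ‖y‖ ^ 2) : ℝ) : ℂ) := by
    push_cast
    field_simp
    rw [Complex.I_sq]
    ring
  have hc : (u : ℂ) ^ ((Module.finrank ℝ W : ℂ) / 2)
      = ((u ^ (Module.finrank ℝ W / 2 : ℝ) : ℝ) : ℂ) := by
    rw [Complex.ofReal_cpow hu.le]
    push_cast
    rfl
  rw [hb, he, hc, ← Complex.ofReal_exp] at h
  have hu' : ((u ^ (-(Module.finrank ℝ W / 2 : ℝ)) : ℝ) : ℂ) *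
      ((u ^ (Module.finrank ℝ W / 2 : ℝ) : ℝ) : ℂ) = 1 := by
    rw [← Complex.ofReal_mul, ← Real.rpow_add hu, neg_add_cancel, Real.rpow_zero,
      Complex.ofReal_one]
  rw [← one_mul (Real.exp _ : ℂ), ← hu', mul_assoc, ← h, ← integral_const_mul]
  refine integral_congr_ae (.of_forall fun k => ?_)
  simp only [gaussKer]
  rw [Complex.exp_add, Complex.ofReal_mul, ← mul_assoc, Real.fourierChar_apply,
    real_inner_comm y k, Complex.ofReal_exp]
  congr 1
  · congr 2
    push_cast
    ring
  · congr 1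
    push_cast
    ring

end Fourier

section Enorm

theorem enorm_ofReal_complex {r : ℝ} (hr : 0 ≤ r) : ‖(r : ℂ)‖ₑ = ENNReal.ofReal r := by
  rw [← ofReal_norm, Complex.norm_real, Real.norm_of_nonneg hr]

theorem enorm_inner_complex (a b : ℂ) : ‖inner ℂ a b‖ₑ = ‖a‖ₑ * ‖b‖ₑ := by
  rw [RCLike.inner_apply, enorm_mul, mul_comm, RCLike.enorm_conj]

variable {X : Type*} [MeasurableSpace X] {μ : Measure X}

theorem enorm_integral_eq_lintegral_of_eq_norm {f : X → ℂ} (hf : Integrable f μ)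
    (h : ∀ᵐ x ∂μ, f x = (‖f x‖ : ℂ)) : ‖∫ x, f x ∂μ‖ₑ = ∫⁻ x, ‖f x‖ₑ ∂μ := by
  rw [integral_congr_ae h, integral_complex_ofReal, ← ofReal_integral_norm_eq_lintegral_enorm hf,
    enorm_ofReal_complex (by positivity)]

theorem enorm_inner_le_lintegral (ψ φ : Lp ℂ 2 μ) :
    ‖inner ℂ ψ φ‖ₑ ≤ ∫⁻ x, ‖ψ x‖ₑ * ‖φ x‖ₑ ∂μ := by
  rw [L2.inner_def]
  refine (enorm_integral_le_lintegral_enorm _).trans (lintegral_mono fun x => ?_)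
  exact (enorm_inner_complex _ _).le

end Enorm

section NonnegativeTransform

variable {W : Type*} [NormedAddCommGroup W] [InnerProductSpace ℝ W] [FiniteDimensional ℝ W]
  [MeasurableSpace W] [BorelSpace W] {ψ : SquareIntegrable W}

theorem inner_translate_ae_eq (hψ : ∀ᵐ ξ, ψ ξ = (‖ψ ξ‖ : ℂ)) (a : W) :
    ∀ᵐ ξ, inner ℂ (ψ ξ) (translate a ψ ξ) = ((‖ψ ξ‖ * ‖ψ (ξ - a)‖ : ℝ) : ℂ) := by
  have hψ' := (measurePreserving_sub_right volume a).quasiMeasurePreserving.ae hψ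
  filter_upwards [hψ, hψ', coeFn_translate a ψ] with ξ h1 h2 h3
  rw [h3, RCLike.inner_apply, h1, h2, Complex.conj_ofReal]
  simp only [Complex.norm_real, norm_norm]
  rw [← Complex.ofReal_mul, mul_comm]

theorem enorm_inner_translate (hψ : ∀ᵐ ξ, ψ ξ = (‖ψ ξ‖ : ℂ)) (a : W) :
    ‖inner ℂ ψ (translate a ψ)‖ₑ = ∫⁻ ξ, ‖ψ ξ‖ₑ * ‖ψ (ξ - a)‖ₑ := by
  rw [L2.inner_def, enorm_integral_eq_lintegral_of_eq_norm (L2.integrable_inner _ _)]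
  · refine lintegral_congr_ae ?_
    filter_upwards [coeFn_translate a ψ] with ξ h
    rw [enorm_inner_complex, h]
  · filter_upwards [inner_translate_ae_eq hψ a] with ξ h
    rw [h, Complex.norm_real, Real.norm_of_nonneg (by positivity)]

theorem inner_translate_eq_norm (hψ : ∀ᵐ ξ, ψ ξ = (‖ψ ξ‖ : ℂ)) (a : W) :
    inner ℂ ψ (translate a ψ) = (‖inner ℂ ψ (translate a ψ)‖ : ℂ) := by
  rw [L2.inner_def, integral_congr_ae (inner_translate_ae_eq hψ a), integral_complex_ofReal,
    Complex.norm_real, Real.norm_of_nonneg (by positivity)]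

end NonnegativeTransform

section RelativeGaussian

variable {E : Type*} [NormedAddCommGroup E] [InnerProductSpace ℝ E]

theorem inner_relShift (k : E) (x : WithLp 2 (E × E)) :
    inner ℝ (relShift k) x = inner ℝ k (x.fst - x.snd) := by
  rw [inner_sub_right, sub_eq_add_neg, ← inner_neg_left]
  rfl

variable [FiniteDimensional ℝ E] [MeasurableSpace E] [BorelSpace E]

theorem integrable_gaussKer {u : ℝ} (hu : 0 < u) : Integrable (gaussKer u : E → ℝ) := by
  refine ⟨by unfold gaussKer; fun_prop, ?_⟩
  rw [hasFiniteIntegral_iff_ofReal (.of_forall fun k => (gaussKer_pos hu k).le),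
    lintegral_gaussKer hu]
  exact ENNReal.one_lt_top

theorem integrable_fourierChar_mul {u : ℝ} (hu : 0 < u)
    (ψ φ : SquareIntegrable (WithLp 2 (E × E))) :
    Integrable (Function.uncurry fun (x : WithLp 2 (E × E)) (k : E) =>
      (𝐞 (inner ℝ (relShift k) x) : ℂ) * (inner ℂ (ψ x) (φ x) * (gaussKer u k : ℂ)))
      (volume.prod volume) := by
  refine Integrable.bdd_mul (c := 1) ((L2.integrable_inner ψ φ).mul_prod
    (integrable_gaussKer hu).ofReal) (Continuous.aestronglyMeasurable (by fun_prop)) ?_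
  exact .of_forall fun z => (Circle.norm_coe _).le

theorem gaussKer_mul_inner_translate (u : ℝ) (ψ φ : SquareIntegrable (WithLp 2 (E × E))) (k : E) :
    (gaussKer u k : ℂ) * inner ℂ (ft ψ) (translate (relShift k) (ft φ))
      = ∫ x, (𝐞 (inner ℝ (relShift k) x) : ℂ) * (inner ℂ (ψ x) (φ x) * (gaussKer u k : ℂ)) := by
  rw [← inner_modulate, L2.inner_def, ← integral_const_mul]
  refine integral_congr_ae ?_
  filter_upwards [coeFn_modulate (relShift k) φ] with x hx
  rw [hx, ← smul_eq_mul (𝐞 (inner ℝ (relShift k) x) : ℂ) (φ x), inner_smul_right]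
  ring

theorem integral_gaussian_mul_inner {u : ℝ} (hu : 0 < u)
    (ψ φ : SquareIntegrable (WithLp 2 (E × E))) :
    ∫ x, (Real.exp (-(Real.pi * u * ‖x.fst - x.snd‖ ^ 2)) : ℂ) * inner ℂ (ψ x) (φ x)
      = ∫ k : E, (gaussKer u k : ℂ) * inner ℂ (ft ψ) (translate (relShift k) (ft φ)) := by
  have expand (x : WithLp 2 (E × E)) : (Real.exp (-(Real.pi * u * ‖x.fst - x.snd‖ ^ 2)) : ℂ) *
      inner ℂ (ψ x) (φ x) = ∫ k : E, (𝐞 (inner ℝ (relShift k) x) : ℂ) *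
        (inner ℂ (ψ x) (φ x) * (gaussKer u k : ℂ)) := by
    rw [gaussian_eq_integral hu, ← integral_mul_const]
    refine integral_congr_ae (.of_forall fun k => ?_)
    simp only [inner_relShift]
    ring
  simp_rw [expand, gaussKer_mul_inner_translate]
  exact integral_integral_swap (integrable_fourierChar_mul hu ψ φ)

theorem enorm_integral_gaussian_mul_inner_le {u : ℝ} (hu : 0 < u)
    (ψ φ : SquareIntegrable (WithLp 2 (E × E))) :
    ‖∫ x, (Real.exp (-(Real.pi * u * ‖x.fst - x.snd‖ ^ 2)) : ℂ) * inner ℂ (ψ x) (φ x)‖ₑ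
      ≤ shiftForm (fun k : E => ENNReal.ofReal (gaussKer u k))
          (fun ξ => ‖ft ψ ξ‖ₑ) (fun ξ => ‖ft φ ξ‖ₑ) := by
  rw [integral_gaussian_mul_inner hu]
  refine (enorm_integral_le_lintegral_enorm _).trans (lintegral_mono fun k => ?_)
  rw [enorm_mul]
  gcongr
  · rw [enorm_ofReal_complex (gaussKer_pos hu k).le]
  · refine (enorm_inner_le_lintegral _ _).trans_eq (lintegral_congr_ae ?_)
    filter_upwards [coeFn_translate (relShift k) (ft φ)] with ξ hξ
    rw [hξ]

theorem lintegral_gaussian_mul_sq {u : ℝ} (hu : 0 < u)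
    (ψ : SquareIntegrable (WithLp 2 (E × E))) :
    ∫⁻ x, ENNReal.ofReal (Real.exp (-(Real.pi * u * ‖x.fst - x.snd‖ ^ 2))) * ‖ψ x‖ₑ ^ 2
      = ‖∫ x, (Real.exp (-(Real.pi * u * ‖x.fst - x.snd‖ ^ 2)) : ℂ) *
          inner ℂ (ψ x) (ψ x)‖ₑ := by
  rw [enorm_integral_eq_lintegral_of_eq_norm]
  · refine lintegral_congr fun x => ?_
    rw [enorm_mul, enorm_inner_complex, enorm_ofReal_complex (Real.exp_pos _).le, sq ‖ψ x‖ₑ]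
  · refine (L2.integrable_inner ψ ψ).bdd_mul (c := 1)
      (Continuous.aestronglyMeasurable (by fun_prop)) (.of_forall fun x => ?_)
    rw [Complex.norm_real, Real.norm_of_nonneg (Real.exp_pos _).le]
    exact Real.exp_le_one_iff.2 (neg_nonpos.2 (by positivity))
  · refine .of_forall fun x => ?_
    rw [norm_mul, Complex.norm_real, Real.norm_of_nonneg (Real.exp_pos _).le,
      inner_self_eq_norm_sq_to_K, norm_pow]
    simp

theorem lintegral_gaussian_mul_sq_eq_shiftForm {u : ℝ} (hu : 0 < u)
    {ψ : SquareIntegrable (WithLp 2 (E × E))} (hψ : ∀ᵐ ξ, ft ψ ξ = (‖ft ψ ξ‖ : ℂ)) :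
    ∫⁻ x, ENNReal.ofReal (Real.exp (-(Real.pi * u * ‖x.fst - x.snd‖ ^ 2))) * ‖ψ x‖ₑ ^ 2
      = shiftForm (fun k : E => ENNReal.ofReal (gaussKer u k))
          (fun ξ => ‖ft ψ ξ‖ₑ) (fun ξ => ‖ft ψ ξ‖ₑ) := by
  rw [lintegral_gaussian_mul_sq hu, integral_gaussian_mul_inner hu,
    enorm_integral_eq_lintegral_of_eq_norm]
  · refine lintegral_congr fun k => ?_
    rw [enorm_mul, enorm_ofReal_complex (gaussKer_pos hu k).le, enorm_inner_translate hψ]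
  · simp_rw [gaussKer_mul_inner_translate]
    exact (integrable_fourierChar_mul hu ψ ψ).integral_prod_right
  · refine .of_forall fun k => ?_
    rw [inner_translate_eq_norm hψ, ← Complex.ofReal_mul, Complex.norm_real,
      Real.norm_of_nonneg (mul_nonneg (gaussKer_pos hu k).le (norm_nonneg _))]

end RelativeGaussian

section Mixture

variable {E : Type*} [NormedAddCommGroup E]

/-- The Gaussian mixture `∫ exp (-π u |y|²) dμ(u)`. -/
def mix (μ : Measure ℝ) (y : E) : ℝ≥0∞ :=
  ∫⁻ u, ENNReal.ofReal (Real.exp (-(Real.pi * u * ‖y‖ ^ 2))) ∂μ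

theorem measurable_mix [MeasurableSpace E] [BorelSpace E] {μ : Measure ℝ} [SFinite μ] :
    Measurable (mix μ : E → ℝ≥0∞) := by
  unfold mix
  fun_prop

variable [InnerProductSpace ℝ E]

/-- The Fourier transform of the Gaussian mixture `mix μ`. -/
def mixKer (μ : Measure ℝ) (k : E) : ℝ≥0∞ := ∫⁻ u, ENNReal.ofReal (gaussKer u k) ∂μ

variable [MeasurableSpace E] [BorelSpace E] {μ : Measure ℝ} [SFinite μ]

theorem measurable_mixKer : Measurable (mixKer μ : E → ℝ≥0∞) := by
  unfold mixKer
  fun_prop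

variable [FiniteDimensional ℝ E]

theorem lintegral_mixKer (hμ : ∀ᵐ u ∂μ, 0 < u) : ∫⁻ k : E, mixKer μ k = mix μ (0 : E) := by
  unfold mixKer mix
  rw [lintegral_lintegral_swap (by fun_prop)]
  refine lintegral_congr_ae ?_
  filter_upwards [hμ] with u hu
  rw [lintegral_gaussKer hu]
  simp

theorem lintegral_shiftForm_gaussKer {g f : WithLp 2 (E × E) → ℝ≥0∞} (hg : Measurable g)
    (hf : Measurable f) :
    ∫⁻ u, shiftForm (fun k => ENNReal.ofReal (gaussKer u k)) g f ∂μ = shiftForm (mixKer μ) g f := by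
  unfold shiftForm mixKer
  rw [lintegral_lintegral_swap (by fun_prop)]
  exact lintegral_congr fun k => lintegral_mul_const _ (by fun_prop)

theorem lintegral_mix_mul_sq (ψ : SquareIntegrable (WithLp 2 (E × E))) :
    ∫⁻ x, mix μ (x.fst - x.snd) * ‖ψ x‖ₑ ^ 2
      = ∫⁻ u, (∫⁻ x, ENNReal.ofReal (Real.exp (-(Real.pi * u * ‖x.fst - x.snd‖ ^ 2))) *
          ‖ψ x‖ₑ ^ 2) ∂μ := by
  unfold mix
  rw [lintegral_lintegral_swap (by fun_prop)]
  exact lintegral_congr fun x => (lintegral_mul_const _ (by fun_prop)).symm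

theorem lintegral_mix_mul_sq_le_shiftForm (hμ : ∀ᵐ u ∂μ, 0 < u)
    (ψ : SquareIntegrable (WithLp 2 (E × E))) :
    ∫⁻ x, mix μ (x.fst - x.snd) * ‖ψ x‖ₑ ^ 2
      ≤ shiftForm (mixKer μ) (fun ξ => ‖ft ψ ξ‖ₑ) (fun ξ => ‖ft ψ ξ‖ₑ) := by
  rw [lintegral_mix_mul_sq, ← lintegral_shiftForm_gaussKer (by fun_prop) (by fun_prop)]
  refine lintegral_mono_ae ?_
  filter_upwards [hμ] with u hu
  rw [lintegral_gaussian_mul_sq hu]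
  exact enorm_integral_gaussian_mul_inner_le hu ψ ψ

theorem lintegral_mix_mul_sq_eq_shiftForm (hμ : ∀ᵐ u ∂μ, 0 < u)
    {ψ : SquareIntegrable (WithLp 2 (E × E))} (hψ : ∀ᵐ ξ, ft ψ ξ = (‖ft ψ ξ‖ : ℂ)) :
    ∫⁻ x, mix μ (x.fst - x.snd) * ‖ψ x‖ₑ ^ 2
      = shiftForm (mixKer μ) (fun ξ => ‖ft ψ ξ‖ₑ) (fun ξ => ‖ft ψ ξ‖ₑ) := by
  rw [lintegral_mix_mul_sq, ← lintegral_shiftForm_gaussKer (by fun_prop) (by fun_prop)]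
  refine lintegral_congr_ae ?_
  filter_upwards [hμ] with u hu
  exact lintegral_gaussian_mul_sq_eq_shiftForm hu hψ

theorem integrable_gaussian_mul_inner {ψ φ : SquareIntegrable (WithLp 2 (E × E))}
    (hfin : ∫⁻ x, mix μ (x.fst - x.snd) * (‖ψ x‖ₑ * ‖φ x‖ₑ) ≠ ∞) :
    Integrable (Function.uncurry fun (x : WithLp 2 (E × E)) (u : ℝ) =>
      (Real.exp (-(Real.pi * u * ‖x.fst - x.snd‖ ^ 2)) : ℂ) * inner ℂ (ψ x) (φ x))
      (volume.prod μ) := by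
  have hm : AEStronglyMeasurable (Function.uncurry fun (x : WithLp 2 (E × E)) (u : ℝ) =>
      (Real.exp (-(Real.pi * u * ‖x.fst - x.snd‖ ^ 2)) : ℂ) * inner ℂ (ψ x) (φ x))
      (volume.prod μ) := by
    refine AEStronglyMeasurable.mul (Continuous.aestronglyMeasurable (by fun_prop)) ?_
    exact (L2.integrable_inner ψ φ).aestronglyMeasurable.comp_fst
  refine ⟨hm, ?_⟩
  rw [HasFiniteIntegral, lintegral_prod _ hm.enorm]
  refine (lintegral_congr fun x => ?_).trans_lt (lt_top_iff_ne_top.2 hfin)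
  simp only [Function.uncurry, enorm_mul, enorm_inner_complex]
  rw [lintegral_mul_const _ (by fun_prop), mix]
  congr 1
  exact lintegral_congr fun u => enorm_ofReal_complex (Real.exp_pos _).le

theorem enorm_integral_mix_mul_inner_le (hμ : ∀ᵐ u ∂μ, 0 < u)
    (ψ φ : SquareIntegrable (WithLp 2 (E × E)))
    (hfin : ∫⁻ x, mix μ (x.fst - x.snd) * (‖ψ x‖ₑ * ‖φ x‖ₑ) ≠ ∞) :
    ‖∫ x, ((mix μ (x.fst - x.snd)).toReal : ℂ) * inner ℂ (ψ x) (φ x)‖ₑ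
      ≤ shiftForm (mixKer μ) (fun ξ => ‖ft ψ ξ‖ₑ) (fun ξ => ‖ft φ ξ‖ₑ) := by
  have expand (x : WithLp 2 (E × E)) :
      ((mix μ (x.fst - x.snd)).toReal : ℂ) * inner ℂ (ψ x) (φ x)
        = ∫ u, (Real.exp (-(Real.pi * u * ‖x.fst - x.snd‖ ^ 2)) : ℂ) *
          inner ℂ (ψ x) (φ x) ∂μ := by
    rw [integral_mul_const, integral_complex_ofReal, integral_eq_lintegral_of_nonneg_ae
      (.of_forall fun u => (Real.exp_pos _).le) (by fun_prop), mix]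
  simp_rw [expand]
  rw [integral_integral_swap (integrable_gaussian_mul_inner hfin),
    ← lintegral_shiftForm_gaussKer (by fun_prop) (by fun_prop)]
  refine (enorm_integral_le_lintegral_enorm _).trans (lintegral_mono_ae ?_)
  filter_upwards [hμ] with u hu
  exact enorm_integral_gaussian_mul_inner_le hu ψ φ

end Mixture

/-! ### Powers and `(|x₁ - x₂| + η)⁻¹` as Gaussian mixtures -/

section MixMeasure

/-- The measure on `(0, ∞)` with density `ρ`, as a measure on `ℝ`. -/
def mixMeasure (ρ : ℝ → ℝ≥0∞) : Measure ℝ := (volume.restrict (Set.Ioi 0)).withDensity ρ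

instance (ρ : ℝ → ℝ≥0∞) : SFinite (mixMeasure ρ) := by
  unfold mixMeasure
  infer_instance

theorem ae_mixMeasure_pos (ρ : ℝ → ℝ≥0∞) : ∀ᵐ u ∂mixMeasure ρ, 0 < u :=
  withDensity_absolutelyContinuous _ _ (ae_restrict_mem measurableSet_Ioi)

theorem lintegral_mixMeasure {ρ : ℝ → ℝ≥0∞} (hρ : Measurable ρ) {f : ℝ → ℝ≥0∞}
    (hf : Measurable f) : ∫⁻ u, f u ∂mixMeasure ρ = ∫⁻ u in Set.Ioi 0, ρ u * f u := by
  rw [mixMeasure, lintegral_withDensity_eq_lintegral_mul _ hρ hf]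
  rfl

/-- The density whose Gaussian mixture is `gammaPi s * |y| ^ (-2 s)`. -/
def powDensity (s : ℝ) (u : ℝ) : ℝ≥0∞ := ENNReal.ofReal (u ^ (s - 1))

@[fun_prop]
theorem measurable_powDensity (s : ℝ) : Measurable (powDensity s) := by
  unfold powDensity
  fun_prop

theorem mix_powDensity {F : Type*} [NormedAddCommGroup F] {s : ℝ} (hs : 0 < s) {y : F}
    (hy : y ≠ 0) :
    mix (mixMeasure (powDensity s)) y = ENNReal.ofReal (gammaPi s) * ‖y‖ₑ ^ (-(2 * s)) := by
  rw [mix, lintegral_mixMeasure (by fun_prop) (by fun_prop), ← lintegral_rpow_mul_gaussian hs hy]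
  refine setLIntegral_congr_fun measurableSet_Ioi fun u (hu : 0 < u) => ?_
  rw [powDensity, ← ENNReal.ofReal_mul (by positivity)]

variable {E : Type*} [NormedAddCommGroup E] [InnerProductSpace ℝ E] [MeasurableSpace E]
  [BorelSpace E]

theorem mixKer_mono {ρ ρ' : ℝ → ℝ≥0∞} (hρ : Measurable ρ) (hρ' : Measurable ρ') {c : ℝ≥0∞}
    (h : ∀ u, 0 < u → ρ u ≤ c * ρ' u) (k : E) :
    mixKer (mixMeasure ρ) k ≤ c * mixKer (mixMeasure ρ') k := by
  unfold mixKer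
  rw [lintegral_mixMeasure hρ (by fun_prop), lintegral_mixMeasure hρ' (by fun_prop),
    ← lintegral_const_mul _ (by fun_prop)]
  refine setLIntegral_mono' measurableSet_Ioi fun u hu => ?_
  rw [← mul_assoc]
  exact mul_le_mul_left (h u hu) _

theorem mixKer_powDensity {s : ℝ} (hs : s < Module.finrank ℝ E / 2) {k : E} (hk : k ≠ 0) :
    mixKer (mixMeasure (powDensity s)) k = ENNReal.ofReal (gammaPi (Module.finrank ℝ E / 2 - s)) *
      ‖k‖ₑ ^ (2 * s - Module.finrank ℝ E) := by
  rw [mixKer, lintegral_mixMeasure (by fun_prop) (by fun_prop), ← lintegral_rpow_mul_gaussKer hs hk]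
  refine setLIntegral_congr_fun measurableSet_Ioi fun u (hu : 0 < u) => ?_
  rw [powDensity, ← ENNReal.ofReal_mul (by positivity)]

end MixMeasure

section PoissonKernel

theorem lintegral_Ioi_of_hasDerivAt_of_nonneg {F F' : ℝ → ℝ} {a L : ℝ}
    (hcont : ContinuousWithinAt F (Set.Ici a) a) (hF : ∀ v, a < v → HasDerivAt F (F' v) v)
    (hpos : ∀ v, a < v → 0 ≤ F' v) (hL : Filter.Tendsto F Filter.atTop (nhds L)) :
    ∫⁻ v in Set.Ioi a, ENNReal.ofReal (F' v) = ENNReal.ofReal (L - F a) := by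
  rw [← integral_Ioi_of_hasDerivAt_of_nonneg hcont hF hpos hL,
    ofReal_integral_eq_lintegral_ofReal (integrableOn_Ioi_deriv_of_nonneg hcont hF hpos hL)]
  filter_upwards [ae_restrict_mem measurableSet_Ioi] with v hv
  exact hpos v hv

theorem hasDerivAt_arctan_div {r : ℝ} (hr : 0 < r) (v : ℝ) :
    HasDerivAt (fun v => Real.arctan (v / r)) (r / (v ^ 2 + r ^ 2)) v := by
  refine ((hasDerivAt_id v).div_const r).arctan.congr_deriv ?_
  simp only [id]
  field_simp
  ring

theorem tendsto_arctan_div_atTop {r : ℝ} (hr : 0 < r) :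
    Filter.Tendsto (fun v => Real.arctan (v / r)) Filter.atTop (nhds (Real.pi / 2)) :=
  (Real.tendsto_arctan_atTop.mono_right nhdsWithin_le_nhds).comp
    (Filter.tendsto_id.atTop_div_const hr)

theorem lintegral_sq_add_sq_inv {η : ℝ} (hη : 0 < η) :
    ∫⁻ v in Set.Ioi (0 : ℝ), ENNReal.ofReal (v ^ 2 + η ^ 2)⁻¹
      = ENNReal.ofReal (Real.pi / (2 * η)) := by
  rw [lintegral_Ioi_of_hasDerivAt_of_nonneg (F := fun v => Real.arctan (v / η) / η)
    (L := Real.pi / 2 / η) (by fun_prop) (fun v _ => ?_) (fun v _ => by positivity)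
    ((tendsto_arctan_div_atTop hη).div_const η)]
  · rw [zero_div, Real.arctan_zero, zero_div, sub_zero, div_div]
  · exact ((hasDerivAt_arctan_div hη v).div_const η).congr_deriv (by field_simp)

theorem lintegral_sq_add_mul_div {η r : ℝ} (hη : 0 < η) (hr : 0 < r) :
    ∫⁻ v in Set.Ioi (0 : ℝ), ENNReal.ofReal
        ((v ^ 2 + r * η) / ((v ^ 2 + η ^ 2) * (v ^ 2 + r ^ 2)))
      = ENNReal.ofReal (Real.pi / (r + η)) := by
  rw [lintegral_Ioi_of_hasDerivAt_of_nonneg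
    (F := fun v => (Real.arctan (v / r) + Real.arctan (v / η)) / (r + η))
    (L := (Real.pi / 2 + Real.pi / 2) / (r + η)) (by fun_prop) (fun v _ => ?_)
    (fun v _ => by positivity)
    (((tendsto_arctan_div_atTop hr).add (tendsto_arctan_div_atTop hη)).div_const _)]
  · simp
  · refine (((hasDerivAt_arctan_div hr v).add (hasDerivAt_arctan_div hη v)).div_const
      (r + η)).congr_deriv ?_
    field_simp
    ring

theorem lintegral_sq_div_eq_lintegral_mul_div {η r : ℝ} (hη : 0 < η) (hr : 0 < r) :
    ∫⁻ v in Set.Ioi (0 : ℝ), ENNReal.ofReal (v ^ 2 / ((v ^ 2 + η ^ 2) * (v ^ 2 + r ^ 2)))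
      = ∫⁻ v in Set.Ioi (0 : ℝ), ENNReal.ofReal (r * η / ((v ^ 2 + η ^ 2) * (v ^ 2 + r ^ 2))) := by
  rw [← lintegral_comp_mul_Ioi _ (mul_pos hr hη), ← lintegral_comp_inv_Ioi]
  refine setLIntegral_congr_fun measurableSet_Ioi fun w (hw : 0 < w) => ?_
  rw [← ENNReal.ofReal_mul (by positivity), ← ENNReal.ofReal_mul (by positivity),
    Real.rpow_neg hw.le, Real.rpow_two]
  congr 1
  field_simp
  ring

theorem lintegral_sq_div {η r : ℝ} (hη : 0 < η) (hr : 0 ≤ r) :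
    ∫⁻ v in Set.Ioi (0 : ℝ), ENNReal.ofReal (v ^ 2 / ((v ^ 2 + η ^ 2) * (v ^ 2 + r ^ 2)))
      = ENNReal.ofReal (Real.pi / (2 * (r + η))) := by
  rcases hr.eq_or_lt with rfl | hr
  · rw [zero_add, ← lintegral_sq_add_sq_inv hη]
    refine setLIntegral_congr_fun measurableSet_Ioi fun v (hv : 0 < v) => ?_
    congr 1
    field_simp
    ring
  · have double : 2 * ∫⁻ v in Set.Ioi (0 : ℝ), ENNReal.ofReal
        (v ^ 2 / ((v ^ 2 + η ^ 2) * (v ^ 2 + r ^ 2))) = ENNReal.ofReal (Real.pi / (r + η)) := by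
      rw [two_mul]
      nth_rewrite 2 [lintegral_sq_div_eq_lintegral_mul_div hη hr]
      rw [← lintegral_add_left (by fun_prop), ← lintegral_sq_add_mul_div hη hr]
      refine lintegral_congr fun v => ?_
      rw [← ENNReal.ofReal_add (by positivity) (by positivity), add_div]
    rw [← ENNReal.mul_right_inj two_ne_zero ENNReal.ofNat_ne_top, double,
      ← ENNReal.ofReal_ofNat 2, ← ENNReal.ofReal_mul zero_le_two]
    congr 1
    field_simp

/-- The density whose Gaussian mixture is `(|y| + η)⁻¹`. -/
def regDensity (η : ℝ) (u : ℝ) : ℝ≥0∞ :=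
  ∫⁻ v in Set.Ioi (0 : ℝ), ENNReal.ofReal (2 * (v ^ 2 / (v ^ 2 + η ^ 2)) *
    Real.exp (-(Real.pi * u * v ^ 2)))

@[fun_prop]
theorem measurable_regDensity (η : ℝ) : Measurable (regDensity η) := by
  unfold regDensity
  fun_prop

theorem lintegral_gaussian_mul_gaussian {r v : ℝ} (hv : 0 < v) {c : ℝ} (hc : 0 ≤ c) :
    ∫⁻ u in Set.Ioi (0 : ℝ), ENNReal.ofReal (c * Real.exp (-(Real.pi * u * v ^ 2))) *
        ENNReal.ofReal (Real.exp (-(Real.pi * u * r ^ 2)))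
      = ENNReal.ofReal (c / (Real.pi * (v ^ 2 + r ^ 2))) := by
  have merge (u : ℝ) : ENNReal.ofReal (c * Real.exp (-(Real.pi * u * v ^ 2))) *
      ENNReal.ofReal (Real.exp (-(Real.pi * u * r ^ 2)))
      = ENNReal.ofReal c * ENNReal.ofReal (u ^ ((1 : ℝ) - 1) *
        Real.exp (-(Real.pi * (v ^ 2 + r ^ 2) * u))) := by
    rw [← ENNReal.ofReal_mul (by positivity), ← ENNReal.ofReal_mul hc, sub_self,
      Real.rpow_zero, one_mul, mul_assoc, ← Real.exp_add]
    ring_nf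
  simp only [merge]
  rw [lintegral_const_mul _ (by fun_prop), lintegral_rpow_mul_exp one_pos (by positivity),
    ← ENNReal.ofReal_mul hc, Real.Gamma_one, Real.rpow_neg_one, one_mul, div_eq_mul_inv]

theorem mix_regDensity {F : Type*} [NormedAddCommGroup F] {η : ℝ} (hη : 0 < η) (y : F) :
    mix (mixMeasure (regDensity η)) y = ENNReal.ofReal (‖y‖ + η)⁻¹ := by
  rw [mix, lintegral_mixMeasure (by fun_prop) (by fun_prop)]
  unfold regDensity
  rw [lintegral_congr fun u => (lintegral_mul_const _ (by fun_prop)).symm,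
    lintegral_lintegral_swap (by fun_prop)]
  calc _ = ∫⁻ v in Set.Ioi (0 : ℝ), ENNReal.ofReal (2 / Real.pi) *
        ENNReal.ofReal (v ^ 2 / ((v ^ 2 + η ^ 2) * (v ^ 2 + ‖y‖ ^ 2))) := by
        refine setLIntegral_congr_fun measurableSet_Ioi fun v (hv : 0 < v) => ?_
        rw [lintegral_gaussian_mul_gaussian hv (by positivity),
          ← ENNReal.ofReal_mul (by positivity)]
        congr 1
        field_simp
    _ = _ := by
        rw [lintegral_const_mul _ (by fun_prop), lintegral_sq_div hη (norm_nonneg y),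
          ← ENNReal.ofReal_mul (by positivity)]
        congr 1
        field_simp

theorem sq_div_sq_add_sq_le {η v δ : ℝ} (hη : 0 < η) (hv : 0 < v) (hδ : 0 ≤ δ) (hδ' : δ ≤ 2) :
    v ^ 2 / (v ^ 2 + η ^ 2) ≤ (v / η) ^ δ := by
  rcases le_total v η with h | h
  · calc v ^ 2 / (v ^ 2 + η ^ 2) ≤ v ^ 2 / η ^ 2 := by gcongr; nlinarith
      _ = (v / η) ^ (2 : ℝ) := by rw [Real.rpow_two, div_pow]
      _ ≤ (v / η) ^ δ :=
        Real.rpow_le_rpow_of_exponent_ge (by positivity) (div_le_one_of_le₀ h hη.le) hδ'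
  · calc v ^ 2 / (v ^ 2 + η ^ 2) ≤ 1 := div_le_one_of_le₀ (by nlinarith) (by positivity)
      _ ≤ (v / η) ^ δ := Real.one_le_rpow ((one_le_div hη).2 h) hδ

theorem lintegral_rpow_mul_gaussian_real {δ u : ℝ} (hδ : -1 < δ) (hu : 0 < u) :
    ∫⁻ v in Set.Ioi (0 : ℝ), ENNReal.ofReal (v ^ δ * Real.exp (-(Real.pi * u * v ^ 2)))
      = ENNReal.ofReal (gammaPi ((1 + δ) / 2) / 2 * u ^ (-((1 + δ) / 2))) := by
  have h1 := integral_rpow_mul_exp_neg_mul_rpow (p := 2) (q := δ) (b := Real.pi * u) two_pos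
    hδ (by positivity)
  have h2 := integrableOn_rpow_mul_exp_neg_mul_rpow (p := 2) (s := δ) (b := Real.pi * u)
    hδ two_pos (by positivity)
  simp only [Real.rpow_two, neg_mul] at h1 h2
  rw [← ofReal_integral_eq_lintegral_ofReal h2, h1, gammaPi, Real.mul_rpow Real.pi_pos.le hu.le]
  · ring_nf
  · filter_upwards [ae_restrict_mem measurableSet_Ioi] with v (hv : 0 < v)
    simp only [Pi.zero_apply]
    positivity

theorem regDensity_le {η δ u : ℝ} (hη : 0 < η) (hδ : 0 ≤ δ) (hδ' : δ ≤ 2) (hu : 0 < u) :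
    regDensity η u ≤ ENNReal.ofReal (η ^ (-δ) * gammaPi ((1 + δ) / 2)) *
      powDensity ((1 - δ) / 2) u := by
  have hg := gammaPi_pos (s := (1 + δ) / 2) (by linarith)
  calc regDensity η u ≤ ∫⁻ v in Set.Ioi (0 : ℝ), ENNReal.ofReal (2 * η ^ (-δ)) *
        ENNReal.ofReal (v ^ δ * Real.exp (-(Real.pi * u * v ^ 2))) := by
        refine setLIntegral_mono' measurableSet_Ioi fun v (hv : 0 < v) => ?_
        rw [← ENNReal.ofReal_mul (by positivity)]
        refine ENNReal.ofReal_le_ofReal ?_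
        calc _ ≤ 2 * (v / η) ^ δ * Real.exp (-(Real.pi * u * v ^ 2)) := by
              gcongr
              exact sq_div_sq_add_sq_le hη hv hδ hδ'
          _ = _ := by
              rw [Real.div_rpow hv.le hη.le, Real.rpow_neg hη.le]
              ring
    _ = _ := by
        rw [lintegral_const_mul _ (by fun_prop), lintegral_rpow_mul_gaussian_real (by linarith) hu,
          powDensity, ← ENNReal.ofReal_mul (by positivity), ← ENNReal.ofReal_mul (by positivity)]
        ring_nf

theorem mixKer_regDensity_le {E : Type*} [NormedAddCommGroup E] [InnerProductSpace ℝ E]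
    [MeasurableSpace E] [BorelSpace E] {η δ : ℝ} (hη : 0 < η) (hδ : 0 ≤ δ) (hδ' : δ ≤ 2)
    (hd : 1 - δ < Module.finrank ℝ E) {k : E} (hk : k ≠ 0) :
    mixKer (mixMeasure (regDensity η)) k ≤ ENNReal.ofReal (η ^ (-δ)) *
      (ENNReal.ofReal (gammaPi ((1 + δ) / 2) * gammaPi ((Module.finrank ℝ E - (1 - δ)) / 2)) *
        ‖k‖ₑ ^ (1 - δ - Module.finrank ℝ E)) := by
  refine (mixKer_mono (by fun_prop) (by fun_prop)
    (fun u hu => regDensity_le hη hδ hδ' hu) k).trans_eq ?_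
  have hg := gammaPi_pos (s := (1 + δ) / 2) (by linarith)
  rw [mixKer_powDensity (by linarith) hk, ENNReal.ofReal_mul (by positivity),
    ENNReal.ofReal_mul hg.le]
  ring_nf

end PoissonKernel

/-! ### Form bounds for `|x₁ - x₂| ^ (-a)` -/

/-- The constant in the bound of `|x₁ - x₂| ^ (-a)` by `|ξ₁| ^ (a t) |ξ₂| ^ (a (1 - t))` for two
particles in dimension `d`. -/
def hardyConst (d a : ℝ) : ℝ :=
  (gammaPi (a / 2))⁻¹ * gammaPi ((d - a) / 2) * powConvConst d a ((d + a) / 2)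

theorem hardyConst_pos {d a : ℝ} (ha : 0 < a) (ha' : a < d) : 0 < hardyConst d a := by
  have h1 := gammaPi_pos (half_pos ha)
  have h2 := gammaPi_pos (half_pos (sub_pos.2 ha'))
  have h3 : 0 < powConvConst d a ((d + a) / 2) :=
    rieszConst_pos (half_pos ha) (half_pos (by linarith)) (half_pos (by linarith))
  unfold hardyConst
  positivity

theorem hardyConst_three_one : hardyConst 3 1 = Real.pi ^ 2 := by
  have hsum : ((3 - (3 + 1) / 2) / 2 : ℝ) = 1 / 2 ∧ (((3 + 1) / 2 - 1) / 2 : ℝ) = 1 / 2 := by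
    norm_num
  rw [hardyConst, powConvConst, hsum.1, hsum.2, rieszConst_half, gammaPi_half,
    show ((3 - 1) / 2 : ℝ) = 1 by norm_num, gammaPi_one]
  field_simp

theorem hardyConst_three_one_mul_rpow :
    hardyConst 3 1 * (2 * Real.pi) ^ (-1 : ℝ) = Real.pi / 2 := by
  rw [hardyConst_three_one, Real.rpow_neg_one]
  field_simp

section Hardy

variable {E : Type*} [NormedAddCommGroup E] [InnerProductSpace ℝ E]

theorem nontrivial_of_pos_lt_finrank {a : ℝ} (ha : 0 < a) (ha' : a < Module.finrank ℝ E) :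
    Nontrivial E :=
  Module.nontrivial_of_finrank_pos (R := ℝ) (by exact_mod_cast ha.trans ha')

variable [FiniteDimensional ℝ E] [MeasurableSpace E] [BorelSpace E]

theorem shiftForm_rpow_self_le {a t : ℝ} (ha : 0 < a) (ha' : a < Module.finrank ℝ E)
    (ht : 0 ≤ t) (ht' : t ≤ 1) {f : WithLp 2 (E × E) → ℝ≥0∞} (hf : Measurable f) :
    shiftForm (fun k => ‖k‖ₑ ^ (a - Module.finrank ℝ E)) f f
      ≤ ENNReal.ofReal (powConvConst (Module.finrank ℝ E) a ((Module.finrank ℝ E + a) / 2)) *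
        ∫⁻ ξ, f ξ ^ 2 * momentumWeight (a * t) (a * (1 - t)) ξ := by
  have := nontrivial_of_pos_lt_finrank ha ha'
  have h := shiftForm_rpow_le (Z := (Module.finrank ℝ E + a) / 2)
    (W := (Module.finrank ℝ E + a) / 2) ha (by linarith) (by linarith) (by linarith)
    (by linarith) ht ht' ht ht' hf hf
  rw [← ENNReal.rpow_add_of_nonneg _ _ (by norm_num) (by norm_num), add_halves,
    ENNReal.rpow_one] at h
  convert h using 6 <;> ring

theorem rpow_eq_mix_powDensity {F : Type*} [NormedAddCommGroup F] {a : ℝ} (ha : 0 < a) {y : F}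
    (hy : y ≠ 0) : ‖y‖ₑ ^ (-a)
      = ENNReal.ofReal (gammaPi (a / 2))⁻¹ * mix (mixMeasure (powDensity (a / 2))) y := by
  have hg := gammaPi_pos (half_pos ha)
  rw [mix_powDensity (half_pos ha) hy, ← mul_assoc, ← ENNReal.ofReal_mul (by positivity),
    inv_mul_cancel₀ hg.ne', ENNReal.ofReal_one, one_mul, mul_div_cancel₀ a two_ne_zero]

theorem ae_mixKer_powDensity {a : ℝ} (ha : 0 < a) (ha' : a < Module.finrank ℝ E) :
    ∀ᵐ k : E, mixKer (mixMeasure (powDensity (a / 2))) k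
      = ENNReal.ofReal (gammaPi ((Module.finrank ℝ E - a) / 2)) *
        ‖k‖ₑ ^ (a - Module.finrank ℝ E) := by
  have := nontrivial_of_pos_lt_finrank ha ha'
  filter_upwards [Measure.ae_ne volume (0 : E)] with k hk
  rw [mixKer_powDensity (by linarith) hk, mul_div_cancel₀ a two_ne_zero, sub_div]

theorem shiftForm_mixKer_powDensity {a : ℝ} (ha : 0 < a) (ha' : a < Module.finrank ℝ E)
    {g f : WithLp 2 (E × E) → ℝ≥0∞} (hg : Measurable g) (hf : Measurable f) :
    shiftForm (mixKer (mixMeasure (powDensity (a / 2)))) g f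
      = ENNReal.ofReal (gammaPi ((Module.finrank ℝ E - a) / 2)) *
        shiftForm (fun k => ‖k‖ₑ ^ (a - Module.finrank ℝ E)) g f := by
  rw [← shiftForm_const_mul (by fun_prop) hg hf]
  refine lintegral_congr_ae ?_
  filter_upwards [ae_mixKer_powDensity ha ha'] with k hk
  rw [hk]

theorem lintegral_rpow_mul_sq_eq_mix {a : ℝ} (ha : 0 < a) (ha' : a < Module.finrank ℝ E)
    (ψ : SquareIntegrable (WithLp 2 (E × E))) :
    ∫⁻ x, ‖x.fst - x.snd‖ₑ ^ (-a) * ‖ψ x‖ₑ ^ 2 = ENNReal.ofReal (gammaPi (a / 2))⁻¹ *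
      ∫⁻ x, mix (mixMeasure (powDensity (a / 2))) (x.fst - x.snd) * ‖ψ x‖ₑ ^ 2 := by
  have := nontrivial_of_pos_lt_finrank ha ha'
  have := measurable_mix (E := E) (μ := mixMeasure (powDensity (a / 2)))
  rw [← lintegral_const_mul _ (by fun_prop)]
  refine lintegral_congr_ae ?_
  filter_upwards [ae_fst_sub_snd_ne_zero] with x hx
  rw [rpow_eq_mix_powDensity ha hx, mul_assoc]

theorem lintegral_rpow_mul_sq_le {a t : ℝ} (ha : 0 < a) (ha' : a < Module.finrank ℝ E)
    (ht : 0 ≤ t) (ht' : t ≤ 1) (ψ : SquareIntegrable (WithLp 2 (E × E))) :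
    ∫⁻ x, ‖x.fst - x.snd‖ₑ ^ (-a) * ‖ψ x‖ₑ ^ 2
      ≤ ENNReal.ofReal (hardyConst (Module.finrank ℝ E) a) *
        ∫⁻ ξ, momentumWeight (a * t) (a * (1 - t)) ξ * ‖ft ψ ξ‖ₑ ^ 2 := by
  have hg := gammaPi_pos (half_pos ha)
  have hg' := gammaPi_pos (half_pos (sub_pos.2 ha'))
  rw [lintegral_rpow_mul_sq_eq_mix ha ha', hardyConst, ENNReal.ofReal_mul (by positivity),
    ENNReal.ofReal_mul (by positivity), mul_assoc, mul_assoc]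
  gcongr
  refine (lintegral_mix_mul_sq_le_shiftForm (ae_mixMeasure_pos _) ψ).trans ?_
  rw [shiftForm_mixKer_powDensity ha ha' (by fun_prop) (by fun_prop)]
  gcongr
  simpa only [mul_comm] using
    shiftForm_rpow_self_le ha ha' ht ht' (f := fun ξ => ‖ft ψ ξ‖ₑ) (by fun_prop)

end Hardy

section FormBounds

theorem finrank_space : (Module.finrank ℝ Space : ℝ) = 3 := by simp

theorem enorm_rpow_of_nonneg {F : Type*} [NormedAddCommGroup F] (v : F) {s : ℝ} (hs : 0 ≤ s) :
    ‖v‖ₑ ^ s = ENNReal.ofReal (‖v‖ ^ s) := by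
  rw [← ofReal_norm, ENNReal.ofReal_rpow_of_nonneg (norm_nonneg v) hs]

theorem norm_rpow_le_one_add_sq_rpow {F : Type*} [NormedAddCommGroup F] (v : F) {s : ℝ}
    (hs : 0 ≤ s) : ‖v‖ ^ (s / 2) ≤ (1 + ‖v‖ ^ 2) ^ (s / 4) := by
  calc ‖v‖ ^ (s / 2) = (‖v‖ ^ 2) ^ (s / 4) := by
        rw [← Real.rpow_natCast, ← Real.rpow_mul (norm_nonneg v)]
        ring_nf
    _ ≤ (1 + ‖v‖ ^ 2) ^ (s / 4) := by gcongr; linarith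

theorem momentumWeight_two_pi_smul {E : Type*} [NormedAddCommGroup E] [NormedSpace ℝ E] {a c : ℝ}
    (ha : 0 ≤ a) (hc : 0 ≤ c) (ξ : WithLp 2 (E × E)) :
    momentumWeight a c ((2 * Real.pi) • ξ)
      = ENNReal.ofReal ((2 * Real.pi) ^ (a + c)) * momentumWeight a c ξ := by
  have hpi : ‖2 * Real.pi‖ₑ = ENNReal.ofReal (2 * Real.pi) :=
    Real.enorm_of_nonneg (by positivity)
  simp only [momentumWeight, WithLp.smul_fst, WithLp.smul_snd, enorm_smul, hpi]
  rw [ENNReal.mul_rpow_of_nonneg _ _ ha, ENNReal.mul_rpow_of_nonneg _ _ hc,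
    ENNReal.ofReal_rpow_of_nonneg (by positivity) ha,
    ENNReal.ofReal_rpow_of_nonneg (by positivity) hc, mul_mul_mul_comm,
    ← ENNReal.ofReal_mul (by positivity), ← Real.rpow_add (by positivity)]

theorem momentumWeight_le_symbol {E : Type*} [NormedAddCommGroup E] {α β : ℝ} (hα : 0 ≤ α)
    (hβ : 0 ≤ β) (p : WithLp 2 (E × E)) : momentumWeight (α / 2) (β / 2) p ≤
      ENNReal.ofReal ((1 + ‖p.fst‖ ^ 2) ^ (α / 4) * (1 + ‖p.snd‖ ^ 2) ^ (β / 4)) := by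
  rw [momentumWeight, enorm_rpow_of_nonneg _ (by positivity),
    enorm_rpow_of_nonneg _ (by positivity), ENNReal.ofReal_mul (by positivity)]
  gcongr
  · exact norm_rpow_le_one_add_sq_rpow _ hα
  · exact norm_rpow_le_one_add_sq_rpow _ hβ

theorem lintegral_momentumWeight_mul_sq_le_momentumForm {α β : ℝ} (hα : 0 ≤ α) (hβ : 0 ≤ β)
    (ψ : Hilb) : ∫⁻ ξ, momentumWeight (α / 2) (β / 2) ξ * ‖ft ψ ξ‖ₑ ^ 2
      ≤ ENNReal.ofReal ((2 * Real.pi) ^ (-((α + β) / 2))) * momentumForm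
        (fun p => (1 + ‖p.fst‖ ^ 2) ^ (α / 4) * (1 + ‖p.snd‖ ^ 2) ^ (β / 4)) ψ := by
  rw [momentumForm, posForm, ← lintegral_const_mul' _ _ ENNReal.ofReal_ne_top]
  refine lintegral_mono fun ξ => ?_
  rw [← mul_assoc]
  refine mul_le_mul_left ?_ _
  grw [← momentumWeight_le_symbol hα hβ]
  rw [momentumWeight_two_pi_smul (by positivity) (by positivity), ← mul_assoc,
    ← ENNReal.ofReal_mul (by positivity), ← Real.rpow_add (by positivity), add_div,
    neg_add_cancel, Real.rpow_zero, ENNReal.ofReal_one, one_mul]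

theorem leSS_of_le_rpow {a α β : ℝ} (ha : 0 < a) (ha' : a < 3) (hα : 0 ≤ α) (hβ : 0 ≤ β)
    (h : α + β = 2 * a) {m : Config → ℝ}
    (hm : ∀ᵐ x : Config, ENNReal.ofReal (m x) ≤ ‖x.fst - x.snd‖ₑ ^ (-a)) :
    LeSS m (hardyConst 3 a * (2 * Real.pi) ^ (-a)) α β := by
  intro ψ
  have hα2 : a * (α / (2 * a)) = α / 2 := by field_simp
  have hβ2 : a * (1 - α / (2 * a)) = β / 2 := by
    rw [mul_sub, hα2]
    linarith
  have hardy := lintegral_rpow_mul_sq_le (E := Space) (t := α / (2 * a)) ha (by rwa [finrank_space])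
    (by positivity) ((div_le_one (by positivity)).2 (by linarith)) ψ
  rw [finrank_space, hα2, hβ2] at hardy
  calc posForm m ψ ≤ ∫⁻ x : Config, ‖x.fst - x.snd‖ₑ ^ (-a) * ‖ψ x‖ₑ ^ 2 := by
        refine lintegral_mono_ae ?_
        filter_upwards [hm] with x hx
        gcongr
    _ ≤ _ := hardy
    _ ≤ _ := by
        rw [ENNReal.ofReal_mul' (by positivity), mul_assoc]
        gcongr
        refine (lintegral_momentumWeight_mul_sq_le_momentumForm hα hβ ψ).trans_eq ?_
        rw [h, mul_div_cancel_left₀ a two_ne_zero]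

theorem exists_leSS_rpow {a : ℝ} (ha : a < 3) : ∃ C : ℝ, ∀ α β : ℝ, 0 < α → 0 < β →
    α + β = 2 * a → LeSS (fun x => 1 / ‖x.fst - x.snd‖ ^ a) C α β := by
  refine ⟨hardyConst 3 a * (2 * Real.pi) ^ (-a), fun α β hα hβ h =>
    leSS_of_le_rpow (by linarith) ha hα.le hβ.le h ?_⟩
  filter_upwards [ae_fst_sub_snd_ne_zero] with x hx
  rw [one_div, ← Real.rpow_neg (norm_nonneg _), ofReal_norm_rpow hx]

theorem ofReal_V {y : Space} (hy : y ≠ 0) : ENNReal.ofReal (V y) = ‖y‖ₑ ^ (-1 : ℝ) := by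
  rw [V, ← Real.rpow_neg_one, ofReal_norm_rpow hy]

theorem leSS_coulomb {α β : ℝ} (hα : 0 ≤ α) (hβ : 0 ≤ β) (h : α + β = 2) :
    LeSS (fun x => V (x.fst - x.snd)) (Real.pi / 2) α β := by
  rw [← hardyConst_three_one_mul_rpow]
  refine leSS_of_le_rpow one_pos (by norm_num) hα hβ (by linarith) ?_
  filter_upwards [ae_fst_sub_snd_ne_zero] with x hx
  rw [ofReal_V hx]

end FormBounds

/-! ### Radial integrals of powers -/

section Radial

variable {E : Type*} [NormedAddCommGroup E] [InnerProductSpace ℝ E] [FiniteDimensional ℝ E]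
  [MeasurableSpace E] [BorelSpace E]

theorem lintegral_comp_norm [Nontrivial E] {f : ℝ → ℝ≥0∞} (hf : Measurable f) :
    ∫⁻ x : E, f ‖x‖ = (volume : Measure E).toSphere Set.univ *
      ∫⁻ r in Set.Ioi (0 : ℝ), ENNReal.ofReal (r ^ (Module.finrank ℝ E - 1)) * f r := by
  have hg : Measurable fun z : Metric.sphere (0 : E) 1 × Set.Ioi (0 : ℝ) => f z.2 := by fun_prop
  have polar := (volume : Measure E).measurePreserving_homeomorphUnitSphereProd.lintegral_comp hg
  simp only [homeomorphUnitSphereProd_apply_snd_coe] at polar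
  calc ∫⁻ x : E, f ‖x‖ = ∫⁻ x in ({0}ᶜ : Set E), f ‖x‖ := by
        rw [restrict_compl_singleton]
    _ = (volume : Measure E).toSphere Set.univ *
        ∫⁻ r : Set.Ioi (0 : ℝ), f r ∂Measure.volumeIoiPow (Module.finrank ℝ E - 1) := by
        rw [← lintegral_subtype_comap (measurableSet_singleton _).compl (fun x => f ‖x‖), polar,
          lintegral_prod _ (by fun_prop)]
        simp only [lintegral_const, mul_comm]
    _ = _ := by
        rw [Measure.volumeIoiPow, lintegral_withDensity_eq_lintegral_mul _ (by fun_prop)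
          (by fun_prop), ← lintegral_subtype_comap measurableSet_Ioi]
        rfl

theorem setLIntegral_norm_preimage_rpow [Nontrivial E] {T : Set ℝ} (hT : MeasurableSet T)
    (hT0 : T ⊆ Set.Ioi 0) (s : ℝ) :
    ∫⁻ x in (fun x : E => ‖x‖) ⁻¹' T, ‖x‖ₑ ^ (s - Module.finrank ℝ E)
      = (volume : Measure E).toSphere Set.univ * ∫⁻ r in T, ENNReal.ofReal (r ^ (s - 1)) := by
  have hd : 1 ≤ Module.finrank ℝ E := Module.finrank_pos
  have h := lintegral_comp_norm (E := E) (f := T.indicator fun r =>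
    ENNReal.ofReal r ^ (s - Module.finrank ℝ E)) ((by fun_prop : Measurable _).indicator hT)
  rw [← lintegral_indicator (measurable_norm hT)]
  simp only [Set.indicator, Set.mem_preimage, ofReal_norm, mul_ite, mul_zero] at h ⊢
  refine h.trans ?_
  congr 1
  rw [← lintegral_indicator hT, ← lintegral_indicator measurableSet_Ioi]
  refine lintegral_congr fun r => ?_
  by_cases hr : r ∈ T
  · have hr0 : 0 < r := hT0 hr
    rw [Set.indicator_of_mem hr, Set.indicator_of_mem (hT0 hr), if_pos hr,
      ENNReal.ofReal_rpow_of_pos hr0, ← ENNReal.ofReal_mul (by positivity), ← Real.rpow_natCast,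
      ← Real.rpow_add hr0, Nat.cast_sub hd]
    ring_nf
  · simp [hr, Set.indicator]

theorem setLIntegral_Ioo_rpow_sub_one {M η : ℝ} (hM : 0 ≤ M) (hη : 0 < η) :
    ∫⁻ r in Set.Ioo 0 M, ENNReal.ofReal (r ^ (η - 1)) = ENNReal.ofReal (M ^ η / η) := by
  have hint := (intervalIntegral.intervalIntegrable_rpow' (a := 0) (b := M)
    (show -1 < η - 1 by linarith)).1
  rw [setLIntegral_congr Ioo_ae_eq_Ioc, ← ofReal_integral_eq_lintegral_ofReal hint,
    ← intervalIntegral.integral_of_le hM, integral_rpow (Or.inl (by linarith)),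
    sub_add_cancel, Real.zero_rpow hη.ne', sub_zero]
  filter_upwards [ae_restrict_mem measurableSet_Ioc] with r hr
  exact Real.rpow_nonneg hr.1.le _

theorem setLIntegral_Ici_rpow_neg_sub_one {S η : ℝ} (hS : 0 < S) (hη : 0 < η) :
    ∫⁻ r in Set.Ici S, ENNReal.ofReal (r ^ (-η - 1)) = ENNReal.ofReal (S ^ (-η) / η) := by
  rw [setLIntegral_congr Ioi_ae_eq_Ici.symm, ← ofReal_integral_eq_lintegral_ofReal
    (integrableOn_Ioi_rpow_of_lt (by linarith) hS), integral_Ioi_rpow_of_lt (by linarith) hS,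
    sub_add_cancel, neg_div_neg_eq]
  filter_upwards [ae_restrict_mem measurableSet_Ioi] with r hr
  exact Real.rpow_nonneg (hS.trans hr).le _

theorem setLIntegral_Ico_rpow_zero_sub_one {M S : ℝ} (hM : 0 < M) (hMS : M ≤ S) :
    ∫⁻ r in Set.Ico M S, ENNReal.ofReal (r ^ ((0 : ℝ) - 1))
      = ENNReal.ofReal (Real.log (S / M)) := by
  have hint := (intervalIntegral.intervalIntegrable_rpow (a := M) (b := S) (r := 0 - 1)
    (μ := volume) (Or.inr (Set.notMem_uIcc_of_lt hM (hM.trans_le hMS)))).1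
  rw [setLIntegral_congr Ico_ae_eq_Ioc, ← ofReal_integral_eq_lintegral_ofReal hint,
    ← intervalIntegral.integral_of_le hMS]
  · simp only [zero_sub, Real.rpow_neg_one, integral_inv_of_pos hM (hM.trans_le hMS)]
  filter_upwards [ae_restrict_mem measurableSet_Ioc] with r hr
  exact Real.rpow_nonneg (hM.trans hr.1).le _

end Radial

/-! ### Optimality of the constant -/

section LogDivergence

variable {E : Type*} [NormedAddCommGroup E]

/-- The spherical shell `M ≤ |x| < S`, with half-open radii so that adjacent shells are disjoint. -/
def shell (M S : ℝ) : Set E := (fun x : E => ‖x‖) ⁻¹' Set.Ico M S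

theorem mem_shell {M S : ℝ} {x : E} : x ∈ shell M S ↔ M ≤ ‖x‖ ∧ ‖x‖ < S := Iff.rfl

theorem ne_zero_of_mem_shell {M S : ℝ} (hM : 0 < M) {x : E} (hx : x ∈ shell M S) : x ≠ 0 :=
  norm_pos_iff.1 (hM.trans_le hx.1)

theorem enorm_rpow_le_mul_enorm_rpow {r s t : ℝ} {x : E} (hx : x ≠ 0)
    (h : ‖x‖ ^ (s - t) ≤ r) : ‖x‖ₑ ^ s ≤ ENNReal.ofReal r * ‖x‖ₑ ^ t := by
  rw [← sub_add_cancel s t, ENNReal.rpow_add _ _ (enorm_ne_zero.2 hx) enorm_ne_top,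
    ← ofReal_norm_rpow hx (s - t)]
  gcongr

theorem ofReal_mul_mul_ofReal {x y C η : ℝ} (hx : 0 ≤ x) (hy : 0 ≤ y) (h : x * y = η⁻¹)
    (σ : ℝ≥0∞) : ENNReal.ofReal x * (ENNReal.ofReal C * (σ * ENNReal.ofReal y))
      = σ * ENNReal.ofReal (C / η) := by
  calc _ = σ * (ENNReal.ofReal C * (ENNReal.ofReal x * ENNReal.ofReal y)) := by ring
    _ = σ * ENNReal.ofReal (C / η) := by
      rw [← ENNReal.ofReal_mul hx, h, ← ENNReal.ofReal_mul' (h ▸ mul_nonneg hx hy), div_eq_mul_inv]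

variable [MeasurableSpace E] [BorelSpace E]

theorem measurableSet_shell (M S : ℝ) : MeasurableSet (shell M S : Set E) :=
  measurable_norm measurableSet_Ico

variable [InnerProductSpace ℝ E] [FiniteDimensional ℝ E]

theorem setLIntegral_rpow_mul_setLIntegral_le {a p Z : ℝ} (ha : 0 < a) (haZ : a < Z)
    (hZ : Z < Module.finrank ℝ E) {A T : Set E} (hA : MeasurableSet A) {c : ℝ≥0∞}
    (hAc : ∀ x ∈ A, ‖x‖ₑ ^ (-p) ≤ c * ‖x‖ₑ ^ (-Z)) :
    ∫⁻ x in A, ‖x‖ₑ ^ (-p) * ∫⁻ q in T, ‖q‖ₑ ^ (-p) * ‖x - q‖ₑ ^ (a - Module.finrank ℝ E)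
      ≤ c * (ENNReal.ofReal (powConvConst (Module.finrank ℝ E) a Z) *
        ∫⁻ q in T, ‖q‖ₑ ^ (-p - (Z - a))) := by
  have := nontrivial_of_pos_lt_finrank (E := E) (ha.trans haZ) hZ
  calc _ ≤ ∫⁻ x in A, ∫⁻ q in T, c * ‖x‖ₑ ^ (-Z) *
          (‖q‖ₑ ^ (-p) * ‖x - q‖ₑ ^ (a - Module.finrank ℝ E)) := by
        refine setLIntegral_mono' hA fun x hx => ?_
        rw [lintegral_const_mul _ (by fun_prop)]
        gcongr
        exact hAc x hx
    _ ≤ ∫⁻ x, ∫⁻ q in T, c * ‖x‖ₑ ^ (-Z) *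
          (‖q‖ₑ ^ (-p) * ‖x - q‖ₑ ^ (a - Module.finrank ℝ E)) := setLIntegral_le_lintegral _ _
    _ = ∫⁻ q in T, c * ‖q‖ₑ ^ (-p) *
          ∫⁻ x, ‖x - q‖ₑ ^ (a - Module.finrank ℝ E) * ‖x‖ₑ ^ (-Z) := by
        rw [lintegral_lintegral_swap (by fun_prop)]
        refine lintegral_congr fun q => ?_
        rw [← lintegral_const_mul _ (by fun_prop)]
        exact lintegral_congr fun x => by ring
    _ = ∫⁻ q in T, c * (ENNReal.ofReal (powConvConst (Module.finrank ℝ E) a Z) *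
          ‖q‖ₑ ^ (-p - (Z - a))) := by
        refine lintegral_congr_ae (ae_restrict_of_ae ?_)
        filter_upwards [Measure.ae_ne volume (0 : E)] with q hq
        rw [← lintegral_sub_left_eq_self _ q]
        simp only [sub_sub_cancel_left, enorm_neg]
        rw [lintegral_enorm_rpow_sub_finrank_mul ha haZ hZ hq, sub_eq_add_neg (-p),
          ENNReal.rpow_add _ _ (enorm_ne_zero.2 hq) enorm_ne_top]
        ring
    _ = _ := by
        rw [lintegral_const_mul _ (by fun_prop), lintegral_const_mul _ (by fun_prop)]

theorem setLIntegral_shell_mul_inner_le {a η M S : ℝ} (ha : 0 < a) (hη : 0 < η)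
    (hη' : η < (Module.finrank ℝ E - a) / 2) (hM : 0 < M) :
    ∫⁻ x in shell M S, ‖x‖ₑ ^ (-((Module.finrank ℝ E + a) / 2)) *
        ∫⁻ q in (fun q : E => ‖q‖) ⁻¹' Set.Ioo 0 M,
          ‖q‖ₑ ^ (-((Module.finrank ℝ E + a) / 2)) * ‖x - q‖ₑ ^ (a - Module.finrank ℝ E)
      ≤ (volume : Measure E).toSphere Set.univ * ENNReal.ofReal
        (powConvConst (Module.finrank ℝ E) a ((Module.finrank ℝ E + a) / 2 - η) / η) := by
  have := nontrivial_of_pos_lt_finrank (E := E) ha (by linarith)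
  refine (setLIntegral_rpow_mul_setLIntegral_le (Z := (Module.finrank ℝ E + a) / 2 - η) ha
    (by linarith) (by linarith) (measurableSet_shell M S) (c := ENNReal.ofReal (M ^ (-η)))
    fun x hx => enorm_rpow_le_mul_enorm_rpow (ne_zero_of_mem_shell hM hx) ?_).trans_eq ?_
  · rw [neg_sub_neg, sub_sub_cancel_left]
    exact Real.rpow_le_rpow_of_nonpos hM hx.1 (by linarith)
  · rw [show -((Module.finrank ℝ E + a) / 2) - ((Module.finrank ℝ E + a) / 2 - η - a)
        = η - Module.finrank ℝ E by ring,
      setLIntegral_norm_preimage_rpow measurableSet_Ioo (fun r hr => hr.1),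
      setLIntegral_Ioo_rpow_sub_one hM.le hη,
      ofReal_mul_mul_ofReal (by positivity) (by positivity)]
    rw [Real.rpow_neg hM.le]
    field_simp

theorem setLIntegral_shell_mul_outer_le {a η M S : ℝ} (ha : 0 < a) (hη : 0 < η)
    (hη' : η < (Module.finrank ℝ E - a) / 2) (hM : 0 < M) (hS : 0 < S) :
    ∫⁻ x in shell M S, ‖x‖ₑ ^ (-((Module.finrank ℝ E + a) / 2)) *
        ∫⁻ q in (fun q : E => ‖q‖) ⁻¹' Set.Ici S,
          ‖q‖ₑ ^ (-((Module.finrank ℝ E + a) / 2)) * ‖x - q‖ₑ ^ (a - Module.finrank ℝ E)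
      ≤ (volume : Measure E).toSphere Set.univ * ENNReal.ofReal
        (powConvConst (Module.finrank ℝ E) a ((Module.finrank ℝ E + a) / 2 + η) / η) := by
  have := nontrivial_of_pos_lt_finrank (E := E) ha (by linarith)
  refine (setLIntegral_rpow_mul_setLIntegral_le (Z := (Module.finrank ℝ E + a) / 2 + η) ha
    (by linarith) (by linarith) (measurableSet_shell M S) (c := ENNReal.ofReal (S ^ η))
    fun x hx => enorm_rpow_le_mul_enorm_rpow (ne_zero_of_mem_shell hM hx) ?_).trans_eq ?_
  · rw [neg_sub_neg, add_sub_cancel_left]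
    exact Real.rpow_le_rpow (norm_nonneg x) hx.2.le hη.le
  · rw [show -((Module.finrank ℝ E + a) / 2) - ((Module.finrank ℝ E + a) / 2 + η - a)
        = -η - Module.finrank ℝ E by ring,
      setLIntegral_norm_preimage_rpow measurableSet_Ici (fun r hr => hS.trans_le hr),
      setLIntegral_Ici_rpow_neg_sub_one hS hη,
      ofReal_mul_mul_ofReal (by positivity) (by positivity)]
    rw [Real.rpow_neg hS.le]
    field_simp

theorem lintegral_le_inner_add_shell_add_outer [Nontrivial E] (M S : ℝ) (g : E → ℝ≥0∞) :
    ∫⁻ q, g q ≤ (∫⁻ q in (fun q : E => ‖q‖) ⁻¹' Set.Ioo 0 M, g q) + (∫⁻ q in shell M S, g q) +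
      ∫⁻ q in (fun q : E => ‖q‖) ⁻¹' Set.Ici S, g q := by
  have hcover : ({0}ᶜ : Set E) ⊆ (fun q : E => ‖q‖) ⁻¹' Set.Ioo 0 M ∪ shell M S ∪
      (fun q : E => ‖q‖) ⁻¹' Set.Ici S := by
    intro q hq
    have hq0 : 0 < ‖q‖ := norm_pos_iff.2 hq
    simp only [Set.mem_union, Set.mem_preimage, Set.mem_Ioo, Set.mem_Ici, mem_shell]
    grind
  calc ∫⁻ q, g q = ∫⁻ q in ({0}ᶜ : Set E), g q := by rw [restrict_compl_singleton]
    _ ≤ _ := (lintegral_mono_set hcover).trans (lintegral_union_le _ _ _)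
    _ ≤ _ := add_le_add (lintegral_union_le _ _ _) le_rfl

theorem setLIntegral_shell_mul_convolution {a M S : ℝ} (ha : 0 < a)
    (ha' : a < Module.finrank ℝ E) (hM : 0 < M) (hMS : M ≤ S) :
    ∫⁻ x : E in shell M S, ‖x‖ₑ ^ (-((Module.finrank ℝ E + a) / 2)) *
        ∫⁻ q : E, ‖q‖ₑ ^ (-((Module.finrank ℝ E + a) / 2)) * ‖x - q‖ₑ ^ (a - Module.finrank ℝ E)
      = (volume : Measure E).toSphere Set.univ * ENNReal.ofReal
        (powConvConst (Module.finrank ℝ E) a ((Module.finrank ℝ E + a) / 2) *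
          Real.log (S / M)) := by
  have := nontrivial_of_pos_lt_finrank ha ha'
  rw [ENNReal.ofReal_mul' (Real.log_nonneg ((one_le_div hM).2 hMS)), mul_left_comm,
    ← setLIntegral_Ico_rpow_zero_sub_one hM hMS,
    ← setLIntegral_norm_preimage_rpow measurableSet_Ico (fun r hr => hM.trans_le hr.1),
    ← lintegral_const_mul _ (by fun_prop)]
  refine setLIntegral_congr_fun (measurableSet_shell M S) fun x hx => ?_
  have hx0 := ne_zero_of_mem_shell hM hx
  have conv := lintegral_enorm_rpow_sub_finrank_mul (Z := (Module.finrank ℝ E + a) / 2) ha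
    (by linarith) (by linarith) hx0
  rw [← lintegral_sub_left_eq_self _ x] at conv
  simp only [sub_sub_cancel, mul_comm (_ ^ ((a : ℝ) - Module.finrank ℝ E))] at conv
  rw [conv, mul_left_comm, ← ENNReal.rpow_add _ _ (enorm_ne_zero.2 hx0) enorm_ne_top]
  congr 2
  ring

/-- The factor `log (S / M)` comes from the part of the convolution `|·| ^ (a - d) * |·| ^ (-p)`,
`p = (d + a) / 2`, over the whole space; the parts inside and outside the shell cost `O(1)`. -/
theorem exists_log_le_setLIntegral_shell {a : ℝ} (ha : 0 < a) (ha' : a < Module.finrank ℝ E) :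
    ∃ k : ℝ, ∀ M S : ℝ, 0 < M → M ≤ S →
      (volume : Measure E).toSphere Set.univ * ENNReal.ofReal
        (powConvConst (Module.finrank ℝ E) a ((Module.finrank ℝ E + a) / 2) * Real.log (S / M))
      ≤ (∫⁻ x : E in shell M S, ‖x‖ₑ ^ (-((Module.finrank ℝ E + a) / 2)) *
          ∫⁻ q in shell M S, ‖q‖ₑ ^ (-((Module.finrank ℝ E + a) / 2)) *
            ‖x - q‖ₑ ^ (a - Module.finrank ℝ E)) +
        (volume : Measure E).toSphere Set.univ * ENNReal.ofReal k := by
  have := nontrivial_of_pos_lt_finrank ha ha'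
  obtain ⟨η, hη, hη'⟩ := exists_between (half_pos (sub_pos.2 ha'))
  set p : ℝ := (Module.finrank ℝ E + a) / 2
  set σ := (volume : Measure E).toSphere Set.univ
  let k₁ := powConvConst (Module.finrank ℝ E) a (p - η) / η
  let k₂ := powConvConst (Module.finrank ℝ E) a (p + η) / η
  refine ⟨max k₁ 0 + max k₂ 0, fun M S hM hMS => ?_⟩
  let g (x q : E) : ℝ≥0∞ := ‖q‖ₑ ^ (-p) * ‖x - q‖ₑ ^ (a - Module.finrank ℝ E)
  have hg : Measurable (Function.uncurry g) := by unfold g Function.uncurry; fun_prop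
  calc _ = ∫⁻ x in shell M S, ‖x‖ₑ ^ (-p) * ∫⁻ q, g x q :=
        (setLIntegral_shell_mul_convolution ha ha' hM hMS).symm
    _ ≤ ∫⁻ x in shell M S, (‖x‖ₑ ^ (-p) * (∫⁻ q in (fun q : E => ‖q‖) ⁻¹' Set.Ioo 0 M, g x q) +
          ‖x‖ₑ ^ (-p) * (∫⁻ q in shell M S, g x q) +
          ‖x‖ₑ ^ (-p) * ∫⁻ q in (fun q : E => ‖q‖) ⁻¹' Set.Ici S, g x q) := by
        refine lintegral_mono fun x => ?_
        rw [← mul_add, ← mul_add]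
        gcongr
        exact lintegral_le_inner_add_shell_add_outer M S (g x)
    _ ≤ σ * ENNReal.ofReal k₁ + (∫⁻ x in shell M S, ‖x‖ₑ ^ (-p) * ∫⁻ q in shell M S, g x q) +
          σ * ENNReal.ofReal k₂ := by
        rw [lintegral_add_left (by fun_prop), lintegral_add_left (by fun_prop)]
        gcongr
        · exact setLIntegral_shell_mul_inner_le ha hη hη' hM
        · exact setLIntegral_shell_mul_outer_le ha hη hη' hM (hM.trans_le hMS)
    _ ≤ _ := by
        rw [ENNReal.ofReal_add (le_max_right _ _) (le_max_right _ _), mul_add, add_right_comm,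
          add_comm]
        gcongr <;> exact le_max_left _ _

end LogDivergence

section TrialFunction

variable {E : Type*} [NormedAddCommGroup E]

/-- The support of the trial functions in momentum space: the momenta `ξ₁` and `-ξ₂` lie in a
shell, at distance at most `1` of each other. -/
def trialSet (M S : ℝ) : Set (WithLp 2 (E × E)) :=
  {ξ | ξ.fst ∈ shell M S ∧ ξ.fst + ξ.snd ∈ Metric.closedBall 0 1}

/-- The trial function `|ξ₁| ^ (-p)` on `trialSet M S`, in momentum space. -/
def trialFun (p M S : ℝ) : WithLp 2 (E × E) → ℂ :=
  (trialSet M S).indicator fun ξ => ((‖ξ.fst‖ ^ (-p) : ℝ) : ℂ)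

/-- The dependence of `trialFun p M S` on `ξ₁`. -/
def trialProfile (p M S : ℝ) : E → ℝ≥0∞ := (shell M S).indicator fun x => ‖x‖ₑ ^ (-p)

theorem trialFun_eq_norm (p M S : ℝ) (ξ : WithLp 2 (E × E)) :
    trialFun p M S ξ = (‖trialFun p M S ξ‖ : ℂ) := by
  by_cases h : ξ ∈ trialSet M S
  · rw [trialFun, Set.indicator_of_mem h, Complex.norm_real, Real.norm_of_nonneg (by positivity)]
  · rw [trialFun, Set.indicator_of_notMem h, norm_zero, Complex.ofReal_zero]

theorem enorm_trialFun {p M S : ℝ} (hM : 0 < M) (ξ : WithLp 2 (E × E)) : ‖trialFun p M S ξ‖ₑ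
    = trialProfile p M S ξ.fst * (Metric.closedBall (0 : E) 1).indicator 1 (ξ.fst + ξ.snd) := by
  by_cases h₁ : ξ.fst ∈ shell M S
  · by_cases h₂ : ξ.fst + ξ.snd ∈ Metric.closedBall (0 : E) 1
    · rw [trialFun, Set.indicator_of_mem (show ξ ∈ trialSet M S from ⟨h₁, h₂⟩), trialProfile,
        Set.indicator_of_mem h₁, Set.indicator_of_mem h₂, enorm_ofReal_complex (by positivity),
        ofReal_norm_rpow (ne_zero_of_mem_shell hM h₁), Pi.one_apply, mul_one]
    · rw [trialFun, Set.indicator_of_notMem fun h : ξ ∈ trialSet M S => h₂ h.2,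
        Set.indicator_of_notMem h₂, enorm_zero, mul_zero]
  · rw [trialFun, Set.indicator_of_notMem fun h : ξ ∈ trialSet M S => h₁ h.1, trialProfile,
      Set.indicator_of_notMem h₁, enorm_zero, zero_mul]

theorem norm_trialFun_le {p M S : ℝ} (hp : 0 ≤ p) (hM : 0 < M) (ξ : WithLp 2 (E × E)) :
    ‖trialFun p M S ξ‖ ≤ M ^ (-p) := by
  by_cases h : ξ ∈ trialSet M S
  · rw [trialFun, Set.indicator_of_mem h, Complex.norm_real, Real.norm_of_nonneg (by positivity)]
    exact Real.rpow_le_rpow_of_nonpos hM h.1.1 (neg_nonpos.2 hp)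
  · rw [trialFun, Set.indicator_of_notMem h, norm_zero]
    positivity

variable [MeasurableSpace E] [BorelSpace E]

@[fun_prop]
theorem measurable_indicator_closedBall_one :
    Measurable ((Metric.closedBall (0 : E) 1).indicator (1 : E → ℝ≥0∞)) :=
  measurable_one.indicator measurableSet_closedBall

@[fun_prop]
theorem measurable_trialProfile (p M S : ℝ) : Measurable (trialProfile p M S : E → ℝ≥0∞) :=
  Measurable.indicator (by fun_prop) (measurableSet_shell M S)

variable [InnerProductSpace ℝ E] [FiniteDimensional ℝ E]

theorem measurableSet_trialSet (M S : ℝ) :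
    MeasurableSet (trialSet M S : Set (WithLp 2 (E × E))) :=
  (measurable_pair_fst (measurableSet_shell M S)).inter
    ((measurable_pair_fst.add measurable_pair_snd) measurableSet_closedBall)

theorem lintegral_fst_mul_comp_add {u w : E → ℝ≥0∞} (hu : Measurable u) (hw : Measurable w) :
    ∫⁻ ξ : WithLp 2 (E × E), u ξ.fst * w (ξ.fst + ξ.snd) = (∫⁻ x, u x) * ∫⁻ x, w x := by
  have h := (WithLp.volume_preserving_ofLp E E).lintegral_comp
    (f := fun z => u z.1 * w (z.1 + z.2)) (by fun_prop)
  refine h.trans ?_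
  rw [Measure.volume_eq_prod, lintegral_prod _ (by fun_prop), ← lintegral_mul_const _ hu]
  refine lintegral_congr fun x => ?_
  simp only
  rw [lintegral_const_mul _ (by fun_prop), lintegral_add_left_eq_self w x]

theorem shiftForm_fst_mul_comp_add {κ u w : E → ℝ≥0∞} (hκ : Measurable κ) (hu : Measurable u)
    (hw : Measurable w) :
    shiftForm κ (fun ξ => u ξ.fst * w (ξ.fst + ξ.snd)) (fun ξ => u ξ.fst * w (ξ.fst + ξ.snd))
      = (∫⁻ x, u x * ∫⁻ q, u q * κ (x - q)) * ∫⁻ x, w x ^ 2 := by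
  have shifted (k : E) : ∫⁻ ξ : WithLp 2 (E × E), u ξ.fst * w (ξ.fst + ξ.snd) *
      (u (ξ - relShift k).fst * w ((ξ - relShift k).fst + (ξ - relShift k).snd))
      = (∫⁻ x, u x * u (x - k)) * ∫⁻ x, w x ^ 2 := by
    rw [← lintegral_fst_mul_comp_add (by fun_prop) (by fun_prop)]
    refine lintegral_congr fun ξ => ?_
    rw [sub_relShift_fst, sub_relShift_snd,
      show ξ.fst - k + (ξ.snd + k) = ξ.fst + ξ.snd by abel]
    ring
  calc _ = ∫⁻ k, (∫⁻ x, κ k * (u x * u (x - k))) * ∫⁻ x, w x ^ 2 := by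
        refine lintegral_congr fun k => ?_
        rw [shifted, ← mul_assoc, lintegral_const_mul _ (by fun_prop)]
    _ = (∫⁻ x, ∫⁻ k, κ k * (u x * u (x - k))) * ∫⁻ x, w x ^ 2 := by
        rw [lintegral_mul_const _ (by fun_prop), lintegral_lintegral_swap (by fun_prop)]
    _ = (∫⁻ x, u x * ∫⁻ q, u q * κ (x - q)) * ∫⁻ x, w x ^ 2 := by
        congr 1
        refine lintegral_congr fun x => ?_
        rw [← lintegral_const_mul _ (by fun_prop), ← lintegral_sub_left_eq_self _ x]
        refine lintegral_congr fun k => ?_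
        rw [sub_sub_cancel]
        ring

theorem lintegral_indicator_closedBall_one_sq :
    ∫⁻ x : E, (Metric.closedBall (0 : E) 1).indicator 1 x ^ 2
      = volume (Metric.closedBall (0 : E) 1) := by
  rw [← lintegral_indicator_one measurableSet_closedBall]
  refine lintegral_congr fun x => ?_
  by_cases hx : x ∈ Metric.closedBall (0 : E) 1 <;> simp [Set.indicator, hx]

theorem volume_trialSet_ne_top (M S : ℝ) :
    volume (trialSet M S : Set (WithLp 2 (E × E))) ≠ ∞ := by
  have hshell : volume (shell M S : Set E) ≠ ∞ :=
    ne_top_of_le_ne_top measure_ball_lt_top.ne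
      (measure_mono fun x (hx : x ∈ shell M S) => mem_ball_zero_iff.2 hx.2)
  have h : volume (trialSet M S : Set (WithLp 2 (E × E)))
      = volume (shell M S : Set E) * volume (Metric.closedBall (0 : E) 1) := by
    rw [← lintegral_indicator_one (measurableSet_trialSet M S),
      ← lintegral_indicator_one (measurableSet_shell M S),
      ← lintegral_indicator_one measurableSet_closedBall, ← lintegral_fst_mul_comp_add
        (measurable_one.indicator (measurableSet_shell M S)) (by fun_prop)]
    refine lintegral_congr fun ξ => ?_
    classical
    simp only [Set.indicator_apply, Pi.one_apply, trialSet, Set.mem_ofPred_eq, ite_and, ite_mul,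
      one_mul, zero_mul]
  rw [h]
  exact ENNReal.mul_ne_top hshell measure_closedBall_lt_top.ne

theorem memLp_trialFun {p M : ℝ} (hp : 0 ≤ p) (hM : 0 < M) (S : ℝ) :
    MemLp (trialFun p M S : WithLp 2 (E × E) → ℂ) 2 volume := by
  have hm := measurableSet_trialSet (E := E) M S
  have : IsFiniteMeasure ((volume : Measure (WithLp 2 (E × E))).restrict (trialSet M S)) :=
    ⟨by simpa using (volume_trialSet_ne_top M S).lt_top⟩
  rw [trialFun, memLp_indicator_iff_restrict hm]
  refine MemLp.of_bound (Complex.measurable_ofReal.comp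
    (measurable_pair_fst.norm.pow_const _)).aestronglyMeasurable (M ^ (-p)) ?_
  filter_upwards [ae_restrict_mem hm] with ξ hξ
  simpa only [trialFun, Set.indicator_of_mem hξ] using norm_trialFun_le (S := S) hp hM ξ

/-- The square-integrable function with Fourier transform `trialFun p M S`. -/
def trialVec {p M : ℝ} (hp : 0 ≤ p) (hM : 0 < M) (S : ℝ) : SquareIntegrable (WithLp 2 (E × E)) :=
  ft.symm (memLp_trialFun hp hM S).toLp

theorem ft_trialVec {p M : ℝ} (hp : 0 ≤ p) (hM : 0 < M) (S : ℝ) :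
    ft (trialVec (E := E) hp hM S) =ᵐ[volume] trialFun p M S := by
  rw [trialVec, LinearIsometryEquiv.apply_symm_apply]
  exact (memLp_trialFun hp hM S).coeFn_toLp

end TrialFunction

section Symbol

variable {E : Type*} [NormedAddCommGroup E] [NormedSpace ℝ E]

theorem one_add_sq_norm_two_pi_smul_le {M q : ℝ} {v : E} (hM : 1 ≤ M) (hq : M ≤ q)
    (hv : ‖v‖ ≤ q + 1) : 1 + ‖(2 * Real.pi) • v‖ ^ 2 ≤ (2 * Real.pi * (1 + 2 / M) * q) ^ 2 := by
  have hM0 : 0 < M := one_pos.trans_le hM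
  have hpi : 1 ≤ 2 * Real.pi := by linarith [Real.pi_gt_three]
  have h2 : 2 ≤ 2 / M * q := by
    rw [div_mul_eq_mul_div, le_div_iff₀ hM0]
    linarith
  rw [norm_smul, Real.norm_of_nonneg (by positivity)]
  calc 1 + (2 * Real.pi * ‖v‖) ^ 2 ≤ (2 * Real.pi) ^ 2 * (1 + ‖v‖ ^ 2) := by nlinarith
    _ ≤ (2 * Real.pi) ^ 2 * (‖v‖ + 1) ^ 2 := by
        gcongr
        nlinarith [norm_nonneg v]
    _ ≤ (2 * Real.pi) ^ 2 * ((1 + 2 / M) * q) ^ 2 := by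
        gcongr
        linarith
    _ = _ := by ring

theorem symbol_le_of_mem_trialSet {α β a M S : ℝ} (hα : 0 ≤ α) (hβ : 0 ≤ β) (h : α + β = 2 * a)
    (hM : 1 ≤ M) {ξ : WithLp 2 (E × E)} (hξ : ξ ∈ trialSet M S) :
    (1 + ‖(2 * Real.pi) • ξ.fst‖ ^ 2) ^ (α / 4) * (1 + ‖(2 * Real.pi) • ξ.snd‖ ^ 2) ^ (β / 4)
      ≤ (2 * Real.pi * (1 + 2 / M)) ^ a * ‖ξ.fst‖ ^ a := by
  have hM0 : 0 < M := one_pos.trans_le hM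
  have hfst : M ≤ ‖ξ.fst‖ := hξ.1.1
  have hfst0 : 0 < ‖ξ.fst‖ := hM0.trans_le hfst
  have hsnd : ‖ξ.snd‖ ≤ ‖ξ.fst‖ + 1 := by
    have hsum := mem_closedBall_zero_iff.1 hξ.2
    have := norm_sub_le (ξ.fst + ξ.snd) ξ.fst
    rw [add_sub_cancel_left] at this
    linarith
  set R := 2 * Real.pi * (1 + 2 / M) * ‖ξ.fst‖
  have hR : 0 < R := by positivity
  calc _ ≤ (R ^ 2) ^ (α / 4) * (R ^ 2) ^ (β / 4) := by
        gcongr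
        · exact one_add_sq_norm_two_pi_smul_le hM hfst (by linarith)
        · exact one_add_sq_norm_two_pi_smul_le hM hfst hsnd
    _ = R ^ a := by
        rw [← Real.rpow_add (by positivity), ← Real.rpow_natCast, ← Real.rpow_mul hR.le,
          show ((2 : ℕ) : ℝ) * (α / 4 + β / 4) = a by push_cast; linarith]
    _ = _ := Real.mul_rpow (by positivity) (by positivity)

end Symbol

section Sharpness

variable {E : Type*} [NormedAddCommGroup E] [InnerProductSpace ℝ E] [FiniteDimensional ℝ E]
  [MeasurableSpace E] [BorelSpace E]

theorem shiftForm_congr_ae {κ : E → ℝ≥0∞} {g f : WithLp 2 (E × E) → ℝ≥0∞} (h : g =ᵐ[volume] f) :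
    shiftForm κ g g = shiftForm κ f f :=
  le_antisymm (shiftForm_mono (.of_forall fun _ => le_rfl) h.le h.le)
    (shiftForm_mono (.of_forall fun _ => le_rfl) h.symm.le h.symm.le)

theorem lintegral_rpow_mul_sq_eq_shiftForm {a : ℝ} (ha : 0 < a) (ha' : a < Module.finrank ℝ E)
    {ψ : SquareIntegrable (WithLp 2 (E × E))} (hψ : ∀ᵐ ξ, ft ψ ξ = (‖ft ψ ξ‖ : ℂ)) :
    ∫⁻ x, ‖x.fst - x.snd‖ₑ ^ (-a) * ‖ψ x‖ₑ ^ 2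
      = ENNReal.ofReal ((gammaPi (a / 2))⁻¹ * gammaPi ((Module.finrank ℝ E - a) / 2)) *
        shiftForm (fun k => ‖k‖ₑ ^ (a - Module.finrank ℝ E)) (fun ξ => ‖ft ψ ξ‖ₑ)
          (fun ξ => ‖ft ψ ξ‖ₑ) := by
  have hg := gammaPi_pos (half_pos ha)
  rw [lintegral_rpow_mul_sq_eq_mix ha ha',
    lintegral_mix_mul_sq_eq_shiftForm (ae_mixMeasure_pos _) hψ,
    shiftForm_mixKer_powDensity ha ha' (by fun_prop) (by fun_prop),
    ENNReal.ofReal_mul (by positivity), mul_assoc]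

theorem shiftForm_trialFun {κ : E → ℝ≥0∞} (hκ : Measurable κ) {p M : ℝ} (hM : 0 < M) (S : ℝ) :
    shiftForm κ (fun ξ => ‖trialFun p M S ξ‖ₑ) (fun ξ => ‖trialFun p M S ξ‖ₑ)
      = (∫⁻ x in shell M S, ‖x‖ₑ ^ (-p) * ∫⁻ q in shell M S, ‖q‖ₑ ^ (-p) * κ (x - q)) *
        volume (Metric.closedBall (0 : E) 1) := by
  have hshell := measurableSet_shell (E := E) M S
  simp only [enorm_trialFun hM]
  rw [shiftForm_fst_mul_comp_add hκ (by fun_prop) (by fun_prop),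
    lintegral_indicator_closedBall_one_sq, ← lintegral_indicator hshell]
  congr 1
  refine lintegral_congr fun x => ?_
  rw [trialProfile, Set.indicator_mul_left, ← lintegral_indicator hshell]
  simp only [Set.indicator_mul_left]

theorem exists_le_lintegral_trialVec {a : ℝ} (ha : 0 < a) (ha' : a < Module.finrank ℝ E)
    (hp : 0 ≤ (Module.finrank ℝ E + a) / 2) :
    ∃ k : ℝ, ∀ (M S : ℝ) (hM : 0 < M), M ≤ S →
      (volume : Measure E).toSphere Set.univ * volume (Metric.closedBall (0 : E) 1) *
          ENNReal.ofReal (hardyConst (Module.finrank ℝ E) a * Real.log (S / M))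
        ≤ (∫⁻ x, ‖x.fst - x.snd‖ₑ ^ (-a) * ‖trialVec (E := E) hp hM S x‖ₑ ^ 2) +
          (volume : Measure E).toSphere Set.univ * volume (Metric.closedBall (0 : E) 1) *
            ENNReal.ofReal k := by
  obtain ⟨k, hk⟩ := exists_log_le_setLIntegral_shell (E := E) ha ha'
  have hg := gammaPi_pos (half_pos ha)
  have hg' := gammaPi_pos (half_pos (sub_pos.2 ha'))
  set σ := (volume : Measure E).toSphere Set.univ
  set B := volume (Metric.closedBall (0 : E) 1)
  set G := (gammaPi (a / 2))⁻¹ * gammaPi ((Module.finrank ℝ E - a) / 2)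
  have hG : 0 ≤ G := by positivity
  refine ⟨G * k, fun M S hM hMS => ?_⟩
  have hft := ft_trialVec (E := E) hp hM S
  rw [lintegral_rpow_mul_sq_eq_shiftForm ha ha'
      (hft.mono fun ξ hξ => hξ ▸ trialFun_eq_norm _ _ _ ξ),
    shiftForm_congr_ae (hft.mono fun ξ hξ => congrArg enorm hξ),
    shiftForm_trialFun (by fun_prop) hM, hardyConst, mul_assoc _ _ (Real.log _),
    ENNReal.ofReal_mul hG, ENNReal.ofReal_mul hG]
  calc _ = ENNReal.ofReal G * B * (σ * ENNReal.ofReal (powConvConst (Module.finrank ℝ E) a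
          ((Module.finrank ℝ E + a) / 2) * Real.log (S / M))) := by ring
    _ ≤ _ := by grw [hk M S hM hMS]
    _ = _ := by ring

theorem lintegral_rpow_mul_sq_trialFun {a M S : ℝ} (ha : 0 < a)
    (ha' : a < Module.finrank ℝ E) (hM : 0 < M) (hMS : M ≤ S) :
    ∫⁻ ξ, ‖ξ.fst‖ₑ ^ a * ‖trialFun (E := E) ((Module.finrank ℝ E + a) / 2) M S ξ‖ₑ ^ 2
      = (volume : Measure E).toSphere Set.univ * volume (Metric.closedBall (0 : E) 1) *
        ENNReal.ofReal (Real.log (S / M)) := by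
  have := nontrivial_of_pos_lt_finrank ha ha'
  have hshell := measurableSet_shell (E := E) M S
  set p : ℝ := (Module.finrank ℝ E + a) / 2
  have hp : a + (-p + -p) = 0 - Module.finrank ℝ E := by ring
  calc _ = ∫⁻ ξ : WithLp 2 (E × E), ‖ξ.fst‖ₑ ^ a * trialProfile p M S ξ.fst ^ 2 *
          (Metric.closedBall (0 : E) 1).indicator 1 (ξ.fst + ξ.snd) ^ 2 := by
        simp only [enorm_trialFun hM, mul_pow, mul_assoc]
    _ = (∫⁻ x : E in shell M S, ‖x‖ₑ ^ ((0 : ℝ) - Module.finrank ℝ E)) *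
          volume (Metric.closedBall (0 : E) 1) := by
        rw [← lintegral_indicator_closedBall_one_sq, ← lintegral_indicator hshell,
          ← lintegral_fst_mul_comp_add (Measurable.indicator (by fun_prop) hshell) (by fun_prop)]
        congr 1 with ξ
        congr 1
        generalize ξ.fst = x
        by_cases hx : x ∈ shell M S
        · have hx0 := enorm_ne_zero.2 (ne_zero_of_mem_shell hM hx)
          rw [trialProfile, Set.indicator_of_mem hx, Set.indicator_of_mem hx, sq,
            ← ENNReal.rpow_add _ _ hx0 enorm_ne_top, ← ENNReal.rpow_add _ _ hx0 enorm_ne_top, hp]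
        · rw [trialProfile, Set.indicator_of_notMem hx, Set.indicator_of_notMem hx,
            zero_pow two_ne_zero, mul_zero]
    _ = _ := by
        rw [shell, setLIntegral_norm_preimage_rpow measurableSet_Ico
          fun r hr => hM.trans_le hr.1, setLIntegral_Ico_rpow_zero_sub_one hM hMS, mul_right_comm]

end Sharpness

theorem momentumForm_trialVec_le {α β a M S : ℝ} (ha : 0 < a) (ha' : a < 3) (hα : 0 ≤ α)
    (hβ : 0 ≤ β) (h : α + β = 2 * a) (hp : 0 ≤ (3 + a) / 2) (hM : 1 ≤ M) (hM0 : 0 < M)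
    (hMS : M ≤ S) :
    momentumForm (fun p => (1 + ‖p.fst‖ ^ 2) ^ (α / 4) * (1 + ‖p.snd‖ ^ 2) ^ (β / 4))
        (trialVec (E := Space) hp hM0 S)
      ≤ ENNReal.ofReal ((2 * Real.pi * (1 + 2 / M)) ^ a) *
        ((volume : Measure Space).toSphere Set.univ * volume (Metric.closedBall (0 : Space) 1) *
          ENNReal.ofReal (Real.log (S / M))) := by
  rw [← lintegral_rpow_mul_sq_trialFun (a := a) ha (by rwa [finrank_space]) hM0 hMS, finrank_space,
    ← lintegral_const_mul' _ _ ENNReal.ofReal_ne_top]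
  refine lintegral_mono_ae ?_
  filter_upwards [ft_trialVec (E := Space) hp hM0 S] with ξ hξ
  rw [hξ, ← mul_assoc]
  by_cases hmem : ξ ∈ trialSet M S
  · gcongr
    rw [enorm_rpow_of_nonneg _ ha.le, ← ENNReal.ofReal_mul (by positivity)]
    exact ENNReal.ofReal_le_ofReal (symbol_le_of_mem_trialSet hα hβ h hM hmem)
  · rw [trialFun, Set.indicator_of_notMem hmem, enorm_zero, zero_pow two_ne_zero, mul_zero,
      mul_zero]

theorem le_mul_rpow_of_forall_nat {H c k a b : ℝ} (hb : 0 < b)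
    (h : ∀ n : ℕ, 1 ≤ n → H * n ≤ c * (b * (1 + 2 / n)) ^ a * n + k) : H ≤ c * b ^ a := by
  have lim : Filter.Tendsto (fun n : ℕ => c * (b * (1 + 2 / n)) ^ a + k / n) Filter.atTop
      (nhds (c * (b * (1 + 0)) ^ a + 0)) := by
    refine Filter.Tendsto.add (Filter.Tendsto.const_mul c (Filter.Tendsto.rpow_const ?_ ?_))
      (tendsto_const_div_atTop_nhds_zero_nat k)
    · exact ((tendsto_const_div_atTop_nhds_zero_nat 2).const_add 1).const_mul b
    · exact Or.inl (by positivity)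
  rw [add_zero, add_zero, mul_one] at lim
  refine ge_of_tendsto lim ?_
  filter_upwards [Filter.eventually_ge_atTop 1] with n hn
  have hn0 : (0 : ℝ) < n := by exact_mod_cast hn
  calc H = H * n / n := (mul_div_cancel_right₀ H hn0.ne').symm
    _ ≤ (c * (b * (1 + 2 / n)) ^ a * n + k) / n := by
        gcongr
        exact h n hn
    _ = _ := by rw [add_div, mul_div_cancel_right₀ _ hn0.ne']

theorem exists_hardyConst_mul_nat_le {m : Config → ℝ} {c α β a : ℝ} (ha : 0 < a)
    (ha' : a < 3) (hc : 0 ≤ c) (hα : 0 ≤ α) (hβ : 0 ≤ β) (h : α + β = 2 * a)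
    (hm : ∀ᵐ x : Config, ‖x.fst - x.snd‖ₑ ^ (-a) ≤ ENNReal.ofReal (m x)) (hle : LeSS m c α β) :
    ∃ k : ℝ, ∀ n : ℕ, 1 ≤ n →
      hardyConst 3 a * n ≤ c * (2 * Real.pi * (1 + 2 / n)) ^ a * n + k := by
  obtain ⟨k, hk⟩ := exists_le_lintegral_trialVec (E := Space) ha (by rwa [finrank_space])
    (by positivity)
  refine ⟨max k 0, fun n hn => ?_⟩
  have hn1 : (1 : ℝ) ≤ n := by exact_mod_cast hn
  have hn0 : (0 : ℝ) < n := one_pos.trans_le hn1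
  have hexp : (n : ℝ) ≤ n * Real.exp n := le_mul_of_one_le_right hn0.le (Real.one_le_exp hn0.le)
  have hlog : Real.log (n * Real.exp n / n) = n := by
    rw [mul_div_cancel_left₀ _ hn0.ne', Real.log_exp]
  have lower := hk n (n * Real.exp n) hn0 hexp
  have upper := momentumForm_trialVec_le ha ha' hα hβ h (by linarith) hn1 hn0 hexp
  simp only [finrank_space, hlog] at lower upper
  set A := (volume : Measure Space).toSphere Set.univ * volume (Metric.closedBall (0 : Space) 1)
  set ψ := trialVec (E := Space) (p := (3 + a) / 2) _ hn0 (n * Real.exp n)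
  have hA0 : A ≠ 0 := mul_ne_zero (Measure.measure_univ_ne_zero.2 (Measure.toSphere_ne_zero _))
    (Metric.measure_closedBall_pos volume _ one_pos).ne'
  have hA : A ≠ ∞ := ENNReal.mul_ne_top (measure_ne_top _ _) measure_closedBall_lt_top.ne
  have le_form : ∫⁻ x : Config, ‖x.fst - x.snd‖ₑ ^ (-a) * ‖ψ x‖ₑ ^ 2 ≤ posForm m ψ := by
    refine lintegral_mono_ae ?_
    filter_upwards [hm] with x hx
    gcongr
  rw [← ENNReal.ofReal_le_ofReal_iff (by positivity), ← ENNReal.mul_le_mul_iff_right hA0 hA]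
  calc _ ≤ ENNReal.ofReal c * (ENNReal.ofReal ((2 * Real.pi * (1 + 2 / n)) ^ a) *
          (A * ENNReal.ofReal n)) + A * ENNReal.ofReal (max k 0) := by
        refine lower.trans (add_le_add (le_form.trans ((hle ψ).trans ?_)) ?_)
        · gcongr
        · gcongr
          exact le_max_left k 0
    _ = _ := by
        rw [ENNReal.ofReal_add (by positivity) (by positivity), ENNReal.ofReal_mul (by positivity),
          ENNReal.ofReal_mul hc]
        ring

theorem hardyConst_le_of_leSS {m : Config → ℝ} {c α β a : ℝ} (ha : 0 < a) (ha' : a < 3)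
    (hα : 0 ≤ α) (hβ : 0 ≤ β) (h : α + β = 2 * a)
    (hm : ∀ᵐ x : Config, ‖x.fst - x.snd‖ₑ ^ (-a) ≤ ENNReal.ofReal (m x)) (hle : LeSS m c α β) :
    hardyConst 3 a * (2 * Real.pi) ^ (-a) ≤ c := by
  have hpi : 0 < (2 * Real.pi) ^ a := by positivity
  have hle' : LeSS m (max c 0) α β := fun ψ => (hle ψ).trans (by gcongr; exact le_max_left c 0)
  obtain ⟨k, hk⟩ := exists_hardyConst_mul_nat_le ha ha' (le_max_right c 0) hα hβ h hm hle'
  have bound : hardyConst 3 a ≤ max c 0 * (2 * Real.pi) ^ a :=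
    le_mul_rpow_of_forall_nat (by positivity) hk
  have hc : 0 < c := by
    have := pos_of_mul_pos_left ((hardyConst_pos ha ha').trans_le bound) hpi.le
    simpa using this
  rwa [max_eq_left hc.le, ← div_le_iff₀ hpi, div_eq_mul_inv, ← Real.rpow_neg (by positivity)]
    at bound

theorem pi_div_two_le_of_leSS {c α β : ℝ} (hα : 0 ≤ α) (hβ : 0 ≤ β) (h : α + β = 2)
    (hle : LeSS (fun x => V (x.fst - x.snd)) c α β) : Real.pi / 2 ≤ c := by
  rw [← hardyConst_three_one_mul_rpow]
  refine hardyConst_le_of_leSS one_pos (by norm_num) hα hβ (by linarith) ?_ hle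
  filter_upwards [ae_fst_sub_snd_ne_zero] with x hx
  rw [ofReal_V hx]

/-! ### Products of unbounded multiplication operators -/

section MultiplicationOperator

variable {X : Type*} [MeasurableSpace X] {μ : Measure X}

theorem mem_graph_mulOp {m : X → ℝ} {f g : Lp ℂ 2 μ} :
    (f, g) ∈ (mulOp μ m).graph ↔ ∀ᵐ x ∂μ, g x = (m x : ℂ) * f x := by
  rw [LinearPMap.mem_graph_iff]
  constructor
  · rintro ⟨⟨_, h⟩, rfl, rfl⟩
    exact (mem_mulDomain.1 h).coeFn_toLp
  · intro h
    have hm : MemLp (fun x => (m x : ℂ) * f x) 2 μ := (memLp_congr_ae h).1 (Lp.memLp g)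
    refine ⟨⟨f, hm⟩, rfl, Lp.ext ?_⟩
    filter_upwards [hm.coeFn_toLp, h] with x h1 h2
    rw [h2]
    exact h1

theorem mem_graph_mulOp_mul {m m' : X → ℝ} {f g h : Lp ℂ 2 μ} (hfg : (f, g) ∈ (mulOp μ m').graph) :
    (f, h) ∈ (mulOp μ fun x => m x * m' x).graph ↔ (g, h) ∈ (mulOp μ m).graph := by
  rw [mem_graph_mulOp, mem_graph_mulOp]
  refine Filter.eventually_congr ?_
  filter_upwards [mem_graph_mulOp.1 hfg] with x hx
  rw [hx, Complex.ofReal_mul, mul_assoc]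

theorem exists_mem_graph_mulOp_of_abs_le {m : X → ℝ} (hm : Measurable m) {C : ℝ}
    (hC : ∀ x, |m x| ≤ C) (f : Lp ℂ 2 μ) : ∃ g, (f, g) ∈ (mulOp μ m).graph := by
  have h : MemLp (fun x => (m x : ℂ) * f x) 2 μ := by
    refine MemLp.of_le_mul (c := C) (Lp.memLp f)
      (AEStronglyMeasurable.mul (by fun_prop) (Lp.aestronglyMeasurable f)) (.of_forall fun x => ?_)
    rw [norm_mul, Complex.norm_real]
    gcongr
    exact hC x
  exact LinearPMap.mem_domain_iff.1 h

theorem inner_eq_inner_of_mem_graph_mulOp {m : X → ℝ} {f f' g g' : Lp ℂ 2 μ}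
    (hf : (f, f') ∈ (mulOp μ m).graph) (hg : (g, g') ∈ (mulOp μ m).graph) :
    inner ℂ g' f = inner ℂ g f' := by
  rw [L2.inner_def, L2.inner_def]
  refine integral_congr_ae ?_
  filter_upwards [mem_graph_mulOp.1 hf, mem_graph_mulOp.1 hg] with x hfx hgx
  simp only [RCLike.inner_apply]
  rw [hfx, hgx, map_mul, Complex.conj_ofReal]
  ring

theorem eq_zero_of_mem_graph_mulOp {m : X → ℝ} (hm : ∀ x, m x ≠ 0) {f : Lp ℂ 2 μ}
    (h : (f, 0) ∈ (mulOp μ m).graph) : f = 0 := by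
  refine Lp.ext ?_
  filter_upwards [mem_graph_mulOp.1 h, Lp.coeFn_zero ℂ 2 μ] with x hx h0
  rw [h0] at hx ⊢
  simpa [hm x] using hx.symm

theorem dense_domain_mulOp {m : X → ℝ} (hm : Measurable m) :
    Dense ((mulOp μ m).domain : Set (Lp ℂ 2 μ)) := by
  rw [Submodule.dense_iff_topologicalClosure_eq_top, Submodule.topologicalClosure_eq_top_iff,
    Submodule.eq_bot_iff]
  intro f hf
  let w : X → ℝ := fun x => (√(1 + m x ^ 2))⁻¹
  have hw (x : X) : |w x| ≤ 1 := by
    rw [abs_of_nonneg (by positivity)]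
    exact inv_le_one_of_one_le₀ (Real.one_le_sqrt.2 (by nlinarith [sq_nonneg (m x)]))
  have hmw (x : X) : |m x * w x| ≤ 1 := by
    rw [abs_mul, abs_of_nonneg (show 0 ≤ w x by positivity), ← div_eq_mul_inv,
      div_le_one (by positivity)]
    exact Real.abs_le_sqrt (by linarith)
  obtain ⟨g, hg⟩ := exists_mem_graph_mulOp_of_abs_le (by fun_prop) hw f
  obtain ⟨h, hh⟩ := exists_mem_graph_mulOp_of_abs_le (by fun_prop) hw g
  obtain ⟨k, hk⟩ := exists_mem_graph_mulOp_of_abs_le (by fun_prop) hmw g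
  have hdom : h ∈ (mulOp μ m).domain :=
    LinearPMap.mem_domain_iff.2 ⟨k, (mem_graph_mulOp_mul hh).1 hk⟩
  have hg0 : g = 0 := by
    rw [← inner_self_eq_zero (𝕜 := ℂ), ← inner_eq_inner_of_mem_graph_mulOp hg hh]
    exact Submodule.inner_right_of_mem_orthogonal hdom hf
  rw [hg0] at hg
  exact eq_zero_of_mem_graph_mulOp (fun x => by positivity) hg

theorem enorm_sq_eq_lintegral (f : Lp ℂ 2 μ) : ‖f‖ₑ ^ 2 = ∫⁻ x, ‖f x‖ₑ ^ 2 ∂μ := by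
  rw [Lp.enorm_def, eLpNorm_eq_lintegral_rpow_enorm_toReal (by norm_num) (by norm_num),
    ← ENNReal.rpow_natCast, ← ENNReal.rpow_mul]
  norm_num

theorem mem_domain_mulOp_of_lintegral_lt_top {m : X → ℝ} (hm : AEMeasurable m μ) {f : Lp ℂ 2 μ}
    (h : ∫⁻ x, ‖(m x : ℂ) * f x‖ₑ ^ 2 ∂μ < ∞) : f ∈ (mulOp μ m).domain := by
  refine ⟨hm.complex_ofReal.aestronglyMeasurable.mul (Lp.aestronglyMeasurable f), ?_⟩
  rw [eLpNorm_lt_top_iff_lintegral_rpow_enorm_lt_top (by norm_num) (by norm_num)]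
  simpa using h

theorem setLIntegral_mul_sq_le_of_inner {m : X → ℝ} (hm : Measurable m) {C : ℝ≥0∞} {f : Lp ℂ 2 μ}
    (h : ∀ g g', (g, g') ∈ (mulOp μ m).graph → ‖inner ℂ g' f‖ₑ ≤ C * ‖g‖ₑ) (R : ℝ) :
    ∫⁻ x in {x | |m x| ≤ R}, ‖(m x : ℂ) * f x‖ₑ ^ 2 ∂μ ≤ C ^ 2 := by
  have hS : MeasurableSet {x | |m x| ≤ R} := measurableSet_le (by fun_prop) measurable_const
  set m' : X → ℝ := {x | |m x| ≤ R}.indicator m with hm'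
  have hbound (x : X) : |m' x| ≤ max R 0 := by
    by_cases hx : |m x| ≤ R
    · simp [hm', hx]
    · simp [hm', hx]
  obtain ⟨g, hg⟩ := exists_mem_graph_mulOp_of_abs_le (hm.indicator hS) hbound f
  obtain ⟨g', hg'⟩ := exists_mem_graph_mulOp_of_abs_le (hm.indicator hS) hbound g
  have hgm : (g, g') ∈ (mulOp μ m).graph := by
    refine mem_graph_mulOp.2 ?_
    filter_upwards [mem_graph_mulOp.1 hg, mem_graph_mulOp.1 hg'] with x hx hx'
    by_cases hxR : |m x| ≤ R <;> simp [Set.indicator, hxR, hx, hx']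
  have hgC : ‖g‖ₑ ≤ C := by
    have hinner : ‖g‖ₑ * ‖g‖ₑ ≤ C * ‖g‖ₑ := by
      calc ‖g‖ₑ * ‖g‖ₑ = ‖inner ℂ g g‖ₑ := by
            rw [← sq, inner_self_eq_norm_sq_to_K, enorm_pow]
            congr 1
            exact (enorm_norm g).symm.trans (enorm_eq_iff_norm_eq.2 (Complex.norm_real _).symm)
        _ ≤ C * ‖g‖ₑ := inner_eq_inner_of_mem_graph_mulOp hg hg' ▸ h g g' hgm
    rcases eq_or_ne ‖g‖ₑ 0 with h0 | h0
    · exact h0.trans_le bot_le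
    · exact (ENNReal.mul_le_mul_iff_left h0 enorm_ne_top).1 hinner
  calc ∫⁻ x in {x | |m x| ≤ R}, ‖(m x : ℂ) * f x‖ₑ ^ 2 ∂μ = ∫⁻ x, ‖g x‖ₑ ^ 2 ∂μ := by
        rw [← lintegral_indicator hS]
        refine lintegral_congr_ae ?_
        filter_upwards [mem_graph_mulOp.1 hg] with x hx
        by_cases hxR : |m x| ≤ R <;> simp [Set.indicator, hxR, hx]
    _ ≤ C ^ 2 := by rw [← enorm_sq_eq_lintegral]; gcongr

theorem exists_mem_graph_mulOp_of_inner {m : X → ℝ} (hm : Measurable m) {C : ℝ≥0∞} (hC : C ≠ ∞)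
    {f : Lp ℂ 2 μ} (h : ∀ g g', (g, g') ∈ (mulOp μ m).graph → ‖inner ℂ g' f‖ₑ ≤ C * ‖g‖ₑ) :
    ∃ f', (f, f') ∈ (mulOp μ m).graph ∧ ‖f'‖ₑ ≤ C := by
  have hmono : Monotone fun n : ℕ => {x | |m x| ≤ n} := fun a b hab x (hx : |m x| ≤ a) =>
    hx.trans (by exact_mod_cast hab)
  have hcover : ⋃ n : ℕ, {x | |m x| ≤ n} = Set.univ :=
    Set.eq_univ_of_forall fun x => Set.mem_iUnion.2 (exists_nat_ge |m x|)
  have hle : ∫⁻ x, ‖(m x : ℂ) * f x‖ₑ ^ 2 ∂μ ≤ C ^ 2 := by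
    rw [← setLIntegral_univ, ← hcover, setLIntegral_iUnion_of_directed _ hmono.directed_le]
    exact iSup_le fun n => setLIntegral_mul_sq_le_of_inner hm h n
  obtain ⟨f', hf'⟩ := LinearPMap.mem_domain_iff.1 (mem_domain_mulOp_of_lintegral_lt_top
    hm.aemeasurable (hle.trans_lt (ENNReal.pow_lt_top hC.lt_top)))
  refine ⟨f', hf', ?_⟩
  rw [← ENNReal.pow_le_pow_left_iff two_ne_zero, enorm_sq_eq_lintegral]
  refine (lintegral_congr_ae ?_).trans_le hle
  filter_upwards [mem_graph_mulOp.1 hf'] with x hx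
  rw [hx]

end MultiplicationOperator

section UnboundedOperators

theorem mem_graph_opComp {T R : Hilb →ₗ.[ℂ] Hilb} {ψ χ : Hilb} :
    (ψ, χ) ∈ (opComp T R).graph ↔ ∃ φ, (ψ, φ) ∈ R.graph ∧ (φ, χ) ∈ T.graph := by
  simp only [LinearPMap.mem_graph_iff]
  constructor
  · rintro ⟨⟨_, ⟨φ, hφ, rfl⟩, h⟩, rfl, rfl⟩
    exact ⟨R φ, ⟨φ, rfl, rfl⟩, ⟨_, hφ⟩, rfl, rfl⟩
  · rintro ⟨_, ⟨φ, rfl, rfl⟩, ⟨_, h⟩, rfl, rfl⟩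
    exact ⟨⟨φ, ⟨φ, h, rfl⟩, φ.2⟩, rfl, rfl⟩

theorem mem_graph_momentumOp {m : Config → ℝ} {ψ φ : Hilb} :
    (ψ, φ) ∈ (momentumOp m).graph ↔
      (ft ψ, ft φ) ∈ (mulOp volume fun ξ : Config => m ((2 * Real.pi) • ξ)).graph := by
  simp only [LinearPMap.mem_graph_iff]
  constructor
  · rintro ⟨⟨_, h⟩, rfl, rfl⟩
    exact ⟨⟨_, h⟩, rfl, (LinearIsometryEquiv.apply_symm_apply _ _).symm⟩
  · rintro ⟨⟨_, h⟩, rfl, hφ⟩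
    exact ⟨⟨ψ, h⟩, rfl, (ft.symm_apply_eq).2 hφ⟩

theorem dense_domain_momentumOp {m : Config → ℝ} (hm : Measurable m) :
    Dense ((momentumOp m).domain : Set Hilb) :=
  (dense_domain_mulOp (by fun_prop)).preimage (ft (W := Config)).toHomeomorph.isOpenMap

end UnboundedOperators

section SymbolShift

variable {E : Type*} [NormedAddCommGroup E]

/-- The bound `√(2π|k|)` for the change of the symbol of `S_j` under a shift of its frequency
by `k`. -/
def shiftError (k : E) : ℝ≥0∞ := ENNReal.ofReal √(2 * Real.pi) * ‖k‖ₑ ^ (1 / 2 : ℝ)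

theorem shiftError_mul_le_of_le {k : E} {κ : ℝ≥0∞} {C a : ℝ} (hk : k ≠ 0)
    (hκ : κ ≤ ENNReal.ofReal C * ‖k‖ₑ ^ a) :
    shiftError k * κ ≤ ENNReal.ofReal (√(2 * Real.pi) * C) * ‖k‖ₑ ^ (1 / 2 + a) := by
  grw [hκ]
  rw [shiftError, ENNReal.ofReal_mul (Real.sqrt_nonneg _),
    ENNReal.rpow_add _ _ (enorm_ne_zero.2 hk) enorm_ne_top]
  exact le_of_eq (by ring)

variable [NormedSpace ℝ E]

/-- The symbol `(1 + p²)^(s/4)` of `S_j ^ s` at the momentum `p = 2πv`, as a function of the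
frequency `v`. -/
def symbol (s : ℝ) (v : E) : ℝ := (1 + ‖(2 * Real.pi) • v‖ ^ 2) ^ (s / 4)

theorem symbol_pos (s : ℝ) (v : E) : 0 < symbol s v := by
  unfold symbol
  positivity

theorem symbol_mul (s t : ℝ) (v : E) : symbol s v * symbol t v = symbol (s + t) v := by
  unfold symbol
  rw [← Real.rpow_add (by positivity), add_div]

theorem symbol_zero (v : E) : symbol 0 v = 1 := by
  rw [symbol, zero_div, Real.rpow_zero]

theorem abs_symbol_le_one {s : ℝ} (hs : s ≤ 0) (v : E) : |symbol s v| ≤ 1 := by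
  rw [abs_of_pos (symbol_pos s v)]
  exact Real.rpow_le_one_of_one_le_of_nonpos (le_add_of_nonneg_right (by positivity)) (by linarith)

@[fun_prop]
theorem measurable_symbol [MeasurableSpace E] [BorelSpace E] (s : ℝ) :
    Measurable (symbol s : E → ℝ) := by
  unfold symbol
  fun_prop

theorem norm_rpow_le_symbol {s a : ℝ} (ha : 0 ≤ a) (has : a ≤ s) (v : E) :
    ‖v‖ ^ a ≤ symbol (2 * s) v := by
  have hv : ‖v‖ ≤ ‖(2 * Real.pi) • v‖ := by
    rw [norm_smul, Real.norm_of_nonneg (by positivity)]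
    exact le_mul_of_one_le_left (norm_nonneg v) (by linarith [Real.pi_gt_three])
  calc ‖v‖ ^ a = ‖v‖ ^ (2 * a / 2) := by rw [mul_div_cancel_left₀ a two_ne_zero]
    _ ≤ ‖(2 * Real.pi) • v‖ ^ (2 * a / 2) := by gcongr
    _ ≤ symbol (2 * a) v := norm_rpow_le_one_add_sq_rpow _ (by positivity)
    _ ≤ symbol (2 * s) v := Real.rpow_le_rpow_of_exponent_le
        (le_add_of_nonneg_right (by positivity)) (by linarith)

theorem enorm_symbol_neg_sq_mul_le {s a : ℝ} (ha : 0 ≤ a) (has : a ≤ s) (v : E) :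
    ‖symbol (-s) v‖ₑ ^ 2 * ‖v‖ₑ ^ a ≤ 1 := by
  calc ‖symbol (-s) v‖ₑ ^ 2 * ‖v‖ₑ ^ a ≤ ‖symbol (-s) v‖ₑ ^ 2 * ‖symbol (2 * s) v‖ₑ := by
        rw [enorm_rpow_of_nonneg v ha, Real.enorm_of_nonneg (symbol_pos (2 * s) v).le]
        gcongr
        exact norm_rpow_le_symbol ha has v
    _ = ‖symbol 0 v‖ₑ := by
        rw [sq, ← enorm_mul, ← enorm_mul, symbol_mul, symbol_mul]
        ring_nf
    _ = 1 := by rw [symbol_zero, enorm_one]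

theorem symbol_one_eq_sqrt (v : E) : symbol 1 v = √√(1 + ‖(2 * Real.pi) • v‖ ^ 2) := by
  rw [symbol, Real.sqrt_eq_rpow, Real.sqrt_eq_rpow, ← Real.rpow_mul (by positivity)]
  norm_num

theorem sqrt_one_add_sq_le_add {x y c : ℝ} (hc : 0 ≤ c) (hx : 0 ≤ x)
    (h : x ≤ y + c) : √(1 + x ^ 2) ≤ √(1 + y ^ 2) + c := by
  have hsq : √(1 + y ^ 2) ^ 2 = 1 + y ^ 2 := Real.sq_sqrt (by positivity)
  have hyc : y * c ≤ √(1 + y ^ 2) * c := by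
    gcongr
    exact Real.le_sqrt_of_sq_le (by linarith)
  refine Real.sqrt_le_iff.2 ⟨by positivity, ?_⟩
  calc 1 + x ^ 2 ≤ 1 + (y + c) ^ 2 := by gcongr
    _ ≤ (√(1 + y ^ 2) + c) ^ 2 := by nlinarith

theorem symbol_one_le_add (v w : E) :
    symbol 1 v ≤ symbol 1 w + √(2 * Real.pi) * √‖v - w‖ := by
  have hnorm : ‖(2 * Real.pi) • v‖ ≤ ‖(2 * Real.pi) • w‖ + 2 * Real.pi * ‖v - w‖ := by
    calc ‖(2 * Real.pi) • v‖ = ‖(2 * Real.pi) • w + (2 * Real.pi) • (v - w)‖ := by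
          rw [← smul_add, add_sub_cancel]
      _ ≤ ‖(2 * Real.pi) • w‖ + ‖(2 * Real.pi) • (v - w)‖ := norm_add_le _ _
      _ = ‖(2 * Real.pi) • w‖ + 2 * Real.pi * ‖v - w‖ := by
          rw [norm_smul _ (v - w), Real.norm_of_nonneg (by positivity)]
  rw [symbol_one_eq_sqrt, symbol_one_eq_sqrt, ← Real.sqrt_mul (by positivity)]
  calc √√(1 + ‖(2 * Real.pi) • v‖ ^ 2)
      ≤ √(√(1 + ‖(2 * Real.pi) • w‖ ^ 2) + 2 * Real.pi * ‖v - w‖) :=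
        Real.sqrt_le_sqrt (sqrt_one_add_sq_le_add (by positivity) (norm_nonneg _) hnorm)
    _ ≤ √√(1 + ‖(2 * Real.pi) • w‖ ^ 2) + √(2 * Real.pi * ‖v - w‖) := by
        simp only [Real.sqrt_eq_rpow]
        exact Real.rpow_add_le_add_rpow (by positivity) (by positivity) (by norm_num) (by norm_num)

theorem enorm_symbol_one_le_add (v w : E) :
    ‖symbol 1 v‖ₑ ≤ ‖symbol 1 w‖ₑ + shiftError (v - w) := by
  rw [shiftError, enorm_rpow_of_nonneg _ (by norm_num), ← Real.sqrt_eq_rpow,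
    ← ENNReal.ofReal_mul (Real.sqrt_nonneg _), Real.enorm_of_nonneg (symbol_pos 1 v).le,
    Real.enorm_of_nonneg (symbol_pos 1 w).le,
    ← ENNReal.ofReal_add (symbol_pos 1 w).le (by positivity)]
  exact ENNReal.ofReal_le_ofReal (symbol_one_le_add v w)

/-- The modulus of `S₁ ^ s S₂ ^ t f` in momentum space, at the pair of frequencies `ξ`. -/
def symbolModulus (s t : ℝ) (f : WithLp 2 (E × E) → ℂ) (ξ : WithLp 2 (E × E)) : ℝ≥0∞ :=
  ‖symbol s ξ.fst‖ₑ * ‖symbol t ξ.snd‖ₑ * ‖f ξ‖ₑ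

theorem symbolModulus_add_one_fst (s t : ℝ) (f : WithLp 2 (E × E) → ℂ) (ξ : WithLp 2 (E × E)) :
    symbolModulus (s + 1) t f ξ = ‖symbol 1 ξ.fst‖ₑ * symbolModulus s t f ξ := by
  simp only [symbolModulus, ← symbol_mul, enorm_mul]
  ring

theorem symbolModulus_add_one_snd (s t : ℝ) (f : WithLp 2 (E × E) → ℂ) (ξ : WithLp 2 (E × E)) :
    symbolModulus s (t + 1) f ξ = ‖symbol 1 ξ.snd‖ₑ * symbolModulus s t f ξ := by
  simp only [symbolModulus, ← symbol_mul, enorm_mul]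
  ring

theorem symbolModulus_sq_mul_momentumWeight_le {s t a c : ℝ} (ha : a ∈ Set.Icc 0 s)
    (hc : c ∈ Set.Icc 0 t) (f : WithLp 2 (E × E) → ℂ) (ξ : WithLp 2 (E × E)) :
    symbolModulus (-s) (-t) f ξ ^ 2 * momentumWeight a c ξ ≤ ‖f ξ‖ₑ ^ 2 := by
  calc symbolModulus (-s) (-t) f ξ ^ 2 * momentumWeight a c ξ
      = (‖symbol (-s) ξ.fst‖ₑ ^ 2 * ‖ξ.fst‖ₑ ^ a) *
          (‖symbol (-t) ξ.snd‖ₑ ^ 2 * ‖ξ.snd‖ₑ ^ c) * ‖f ξ‖ₑ ^ 2 := by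
        rw [symbolModulus, momentumWeight]
        ring
    _ ≤ 1 * 1 * ‖f ξ‖ₑ ^ 2 := by
        gcongr
        · exact enorm_symbol_neg_sq_mul_le ha.1 ha.2 ξ.fst
        · exact enorm_symbol_neg_sq_mul_le hc.1 hc.2 ξ.snd
    _ = ‖f ξ‖ₑ ^ 2 := by rw [one_mul, one_mul]

end SymbolShift

section Sandwich

theorem mem_graph_S₁ {s : ℝ} {ψ φ : Hilb} : (ψ, φ) ∈ (S₁ s).graph ↔
    (ft ψ, ft φ) ∈ (mulOp volume fun ξ : Config => symbol s ξ.fst).graph :=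
  mem_graph_momentumOp

theorem mem_graph_S₂ {s : ℝ} {ψ φ : Hilb} : (ψ, φ) ∈ (S₂ s).graph ↔
    (ft ψ, ft φ) ∈ (mulOp volume fun ξ : Config => symbol s ξ.snd).graph :=
  mem_graph_momentumOp

theorem exists_mem_graph_S₁ {s : ℝ} (hs : s ≤ 0) (ψ : Hilb) : ∃ φ, (ψ, φ) ∈ (S₁ s).graph := by
  obtain ⟨g, hg⟩ := exists_mem_graph_mulOp_of_abs_le (by fun_prop)
    (fun ξ : Config => abs_symbol_le_one hs ξ.fst) (ft ψ)
  exact ⟨ft.symm g, mem_graph_S₁.2 (by rwa [LinearIsometryEquiv.apply_symm_apply])⟩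

theorem exists_mem_graph_S₂ {s : ℝ} (hs : s ≤ 0) (ψ : Hilb) : ∃ φ, (ψ, φ) ∈ (S₂ s).graph := by
  obtain ⟨g, hg⟩ := exists_mem_graph_mulOp_of_abs_le (by fun_prop)
    (fun ξ : Config => abs_symbol_le_one hs ξ.snd) (ft ψ)
  exact ⟨ft.symm g, mem_graph_S₂.2 (by rwa [LinearIsometryEquiv.apply_symm_apply])⟩

theorem mem_graph_opComp_S₁_S₂ {s t : ℝ} (ht : t ≤ 0) {ψ φ : Hilb} :
    (ψ, φ) ∈ (opComp (S₁ s) (S₂ t)).graph ↔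
      (ft ψ, ft φ) ∈ (mulOp volume fun ξ : Config => symbol s ξ.fst * symbol t ξ.snd).graph := by
  rw [mem_graph_opComp]
  constructor
  · rintro ⟨χ, h2, h1⟩
    exact (mem_graph_mulOp_mul (mem_graph_S₂.1 h2)).2 (mem_graph_S₁.1 h1)
  · intro h
    obtain ⟨χ, h2⟩ := exists_mem_graph_S₂ ht ψ
    exact ⟨χ, h2, mem_graph_S₁.2 ((mem_graph_mulOp_mul (mem_graph_S₂.1 h2)).1 h)⟩

theorem mem_graph_sandwich {s t : ℝ} (ht : t ≤ 0) {W R : Hilb →ₗ.[ℂ] Hilb} {ψ w : Hilb} :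
    (ψ, w) ∈ (opComp (S₁ s) (opComp (S₂ t) (opComp W R))).graph ↔
      ∃ φ u, (ψ, φ) ∈ R.graph ∧ (φ, u) ∈ W.graph ∧
        (ft u, ft w) ∈
          (mulOp volume fun ξ : Config => symbol s ξ.fst * symbol t ξ.snd).graph := by
  simp only [← mem_graph_opComp_S₁_S₂ ht, mem_graph_opComp]
  constructor
  · rintro ⟨χ, ⟨u, ⟨φ, hφ, hu⟩, hχ⟩, hw⟩
    exact ⟨φ, u, hφ, hu, χ, hχ, hw⟩
  · rintro ⟨φ, u, hφ, hu, χ, hχ, hw⟩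
    exact ⟨χ, ⟨u, ⟨φ, hφ, hu⟩, hχ⟩, hw⟩

theorem enorm_ae_eq_symbolModulus {s t : ℝ} {f f' : Hilb}
    (h : (f, f') ∈ (mulOp volume fun ξ : Config => symbol s ξ.fst * symbol t ξ.snd).graph) :
    ∀ᵐ ξ, ‖f' ξ‖ₑ = symbolModulus s t f ξ := by
  filter_upwards [mem_graph_mulOp.1 h] with ξ hξ
  rw [hξ, enorm_mul, Complex.ofReal_mul, enorm_mul, enorm_ofReal_complex (symbol_pos _ _).le,
    enorm_ofReal_complex (symbol_pos _ _).le, symbolModulus,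
    Real.enorm_of_nonneg (symbol_pos _ _).le, Real.enorm_of_nonneg (symbol_pos _ _).le]

variable {μ : Measure ℝ} [SFinite μ] {W : Config → ℝ}

theorem enorm_inner_ft_le_shiftForm (hμ : ∀ᵐ u ∂μ, 0 < u)
    (hW : ∀ᵐ x : Config, 0 ≤ W x ∧ ENNReal.ofReal (W x) = mix μ (x.fst - x.snd)) {φ u : Hilb}
    (hu : (φ, u) ∈ (mulOp volume W).graph) (χ : Hilb) :
    ‖inner ℂ χ (ft u)‖ₑ ≤ shiftForm (mixKer μ) (fun ξ => ‖χ ξ‖ₑ) (fun ξ => ‖ft φ ξ‖ₑ) := by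
  have hWu := mem_graph_mulOp.1 hu
  have hinner : inner ℂ (ft.symm χ) u
      = ∫ x : Config, ((mix μ (x.fst - x.snd)).toReal : ℂ) * inner ℂ (ft.symm χ x) (φ x) := by
    rw [L2.inner_def]
    refine integral_congr_ae ?_
    filter_upwards [hW, hWu] with x ⟨h0, hmix⟩ hux
    rw [← hmix, ENNReal.toReal_ofReal h0, hux, ← smul_eq_mul (W x : ℂ), inner_smul_right]
  have hfin : ∫⁻ x : Config, mix μ (x.fst - x.snd) * (‖ft.symm χ x‖ₑ * ‖φ x‖ₑ)
      = ∫⁻ x, ‖inner ℂ (ft.symm χ x) (u x)‖ₑ := by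
    refine lintegral_congr_ae ?_
    filter_upwards [hW, hWu] with x ⟨h0, hmix⟩ hux
    rw [enorm_inner_complex, hux, enorm_mul, enorm_ofReal_complex h0, hmix, mul_left_comm]
  have h := enorm_integral_mix_mul_inner_le hμ (ft.symm χ) φ
    (hfin ▸ (L2.integrable_inner (ft.symm χ) u).2.ne)
  rwa [← hinner, ← LinearIsometryEquiv.inner_map_map ft, LinearIsometryEquiv.apply_symm_apply]
    at h

theorem exists_mem_graph_mulOp_of_shiftForm_le (hμ : ∀ᵐ u ∂μ, 0 < u)
    (hW : ∀ᵐ x : Config, 0 ≤ W x ∧ ENNReal.ofReal (W x) = mix μ (x.fst - x.snd)) {φ u : Hilb}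
    (hu : (φ, u) ∈ (mulOp volume W).graph) {s t : ℝ} {C : ℝ≥0∞} (hC : C ≠ ∞)
    (hbound : ∀ g : Hilb,
      shiftForm (mixKer μ) (symbolModulus s t g) (fun ξ => ‖ft φ ξ‖ₑ) ≤ C * ‖g‖ₑ) :
    ∃ w, (ft u, w) ∈ (mulOp volume fun ξ : Config => symbol s ξ.fst * symbol t ξ.snd).graph ∧
      ‖w‖ₑ ≤ C := by
  refine exists_mem_graph_mulOp_of_inner (by fun_prop) hC fun g χ hχ => ?_
  refine (enorm_inner_ft_le_shiftForm hμ hW hu χ).trans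
    ((shiftForm_mono (.of_forall fun _ => le_rfl) ?_ (.of_forall fun _ => le_rfl)).trans (hbound g))
  exact (enorm_ae_eq_symbolModulus hχ).mono fun ξ hξ => hξ.le

theorem normLE_sandwich (hμ : ∀ᵐ u ∂μ, 0 < u)
    (hW : ∀ᵐ x : Config, 0 ≤ W x ∧ ENNReal.ofReal (W x) = mix μ (x.fst - x.snd)) {s t : ℝ}
    (ht : t ≤ 0) {R : Hilb →ₗ.[ℂ] Hilb} (hR : Dense (R.domain : Set Hilb))
    (hRW : ∀ ψ φ, (ψ, φ) ∈ R.graph → φ ∈ (mulOp volume W).domain) {C : ℝ} (hC : 0 ≤ C)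
    (hbound : ∀ ψ φ g : Hilb, (ψ, φ) ∈ R.graph →
      shiftForm (mixKer μ) (symbolModulus s t g) (fun ξ => ‖ft φ ξ‖ₑ) ≤
        ENNReal.ofReal C * (‖g‖ₑ * ‖ψ‖ₑ)) :
    NormLE (opComp (S₁ s) (opComp (S₂ t) (opComp (mulOp volume W) R))) C := by
  have key {ψ φ u : Hilb} (hφ : (ψ, φ) ∈ R.graph) (hu : (φ, u) ∈ (mulOp volume W).graph) :
      ∃ w, (ft u, w) ∈ (mulOp volume fun ξ : Config => symbol s ξ.fst * symbol t ξ.snd).graph ∧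
        ‖w‖ₑ ≤ ENNReal.ofReal C * ‖ψ‖ₑ :=
    exists_mem_graph_mulOp_of_shiftForm_le hμ hW hu
      (ENNReal.mul_ne_top ENNReal.ofReal_ne_top enorm_ne_top)
      fun g => (hbound ψ φ g hφ).trans_eq (by ring)
  refine ⟨hR.mono fun ψ hψ => ?_, fun ψ => ?_⟩
  · obtain ⟨φ, hφ⟩ := LinearPMap.mem_domain_iff.1 hψ
    obtain ⟨u, hu⟩ := LinearPMap.mem_domain_iff.1 (hRW ψ φ hφ)
    obtain ⟨w, hw, -⟩ := key hφ hu
    refine LinearPMap.mem_domain_iff.2 ⟨ft.symm w, (mem_graph_sandwich ht).2 ⟨φ, u, hφ, hu, ?_⟩⟩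
    rwa [LinearIsometryEquiv.apply_symm_apply]
  · obtain ⟨φ, u, hφ, hu, hw⟩ := (mem_graph_sandwich ht).1 (LinearPMap.mem_graph _ ψ)
    obtain ⟨w, hw', hle⟩ := key hφ hu
    rw [LinearPMap.mem_graph_snd_inj _ hw' hw rfl, LinearIsometryEquiv.enorm_map, ← ofReal_norm,
      ← ofReal_norm, ← ENNReal.ofReal_mul hC] at hle
    exact (ENNReal.ofReal_le_ofReal_iff (by positivity)).1 hle

end Sandwich

/-! ### Schur estimates with symbols -/

section WeightedEstimates

variable {E : Type*} [NormedAddCommGroup E] [InnerProductSpace ℝ E] [FiniteDimensional ℝ E]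
  [MeasurableSpace E] [BorelSpace E]

@[fun_prop]
theorem measurable_symbolModulus (s t : ℝ) {f : WithLp 2 (E × E) → ℂ} (hf : Measurable f) :
    Measurable (symbolModulus s t f) := by
  unfold symbolModulus
  fun_prop

theorem shiftForm_mul_left_le {κ D : E → ℝ≥0∞} (hκ : Measurable κ)
    {p g f : WithLp 2 (E × E) → ℝ≥0∞} (hp : Measurable p) (hg : Measurable g) (hf : Measurable f)
    (h : ∀ ξ k, p ξ ≤ p (ξ - relShift k) + D k) :
    shiftForm κ (fun ξ => p ξ * g ξ) f ≤
      shiftForm κ g (fun ξ => p ξ * f ξ) + shiftForm (fun k => D k * κ k) g f := by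
  unfold shiftForm
  rw [← lintegral_add_left (by fun_prop)]
  refine lintegral_mono fun k => ?_
  calc κ k * ∫⁻ ξ, p ξ * g ξ * f (ξ - relShift k)
      ≤ κ k * ∫⁻ ξ, (g ξ * (p (ξ - relShift k) * f (ξ - relShift k)) +
          D k * (g ξ * f (ξ - relShift k))) := by
        gcongr with ξ
        grw [h ξ k]
        exact le_of_eq (by ring)
    _ = _ := by
        rw [lintegral_add_left (by fun_prop), lintegral_const_mul _ (by fun_prop)]
        ring

theorem shiftForm_mul_right_le {κ D : E → ℝ≥0∞} (hκ : Measurable κ)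
    {p g f : WithLp 2 (E × E) → ℝ≥0∞} (hp : Measurable p) (hg : Measurable g) (hf : Measurable f)
    (h : ∀ ξ k, p (ξ - relShift k) ≤ p ξ + D k) :
    shiftForm κ g (fun ξ => p ξ * f ξ) ≤
      shiftForm κ (fun ξ => p ξ * g ξ) f + shiftForm (fun k => D k * κ k) g f := by
  unfold shiftForm
  rw [← lintegral_add_left (by fun_prop)]
  refine lintegral_mono fun k => ?_
  calc κ k * ∫⁻ ξ, g ξ * (p (ξ - relShift k) * f (ξ - relShift k))
      ≤ κ k * ∫⁻ ξ, (p ξ * g ξ * f (ξ - relShift k) + D k * (g ξ * f (ξ - relShift k))) := by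
        gcongr with ξ
        grw [h ξ k]
        exact le_of_eq (by ring)
    _ = _ := by
        rw [lintegral_add_left (by fun_prop), lintegral_const_mul _ (by fun_prop)]
        ring

theorem shiftForm_symbolModulus_add_one_fst_le {κ : E → ℝ≥0∞} (hκ : Measurable κ)
    {g f : WithLp 2 (E × E) → ℂ} (hg : Measurable g) (hf : Measurable f) (s t s' t' : ℝ) :
    shiftForm κ (symbolModulus (s + 1) t g) (symbolModulus s' t' f) ≤
      shiftForm κ (symbolModulus s t g) (symbolModulus (s' + 1) t' f) +
        shiftForm (fun k => shiftError k * κ k) (symbolModulus s t g) (symbolModulus s' t' f) := by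
  have h := shiftForm_mul_left_le (p := fun ξ => ‖symbol 1 ξ.fst‖ₑ) hκ
    (by fun_prop) (measurable_symbolModulus s t hg) (measurable_symbolModulus s' t' hf)
    fun ξ k => by
      simpa only [sub_relShift_fst, sub_sub_cancel]
        using enorm_symbol_one_le_add ξ.fst (ξ - relShift k).fst
  simpa only [← symbolModulus_add_one_fst] using h

theorem shiftForm_symbolModulus_add_one_snd_le {κ : E → ℝ≥0∞} (hκ : Measurable κ)
    {g f : WithLp 2 (E × E) → ℂ} (hg : Measurable g) (hf : Measurable f) (s t s' t' : ℝ) :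
    shiftForm κ (symbolModulus s t g) (symbolModulus s' (t' + 1) f) ≤
      shiftForm κ (symbolModulus s (t + 1) g) (symbolModulus s' t' f) +
        shiftForm (fun k => shiftError k * κ k) (symbolModulus s t g) (symbolModulus s' t' f) := by
  have h := shiftForm_mul_right_le (p := fun ξ => ‖symbol 1 ξ.snd‖ₑ) hκ
    (by fun_prop) (measurable_symbolModulus s t hg) (measurable_symbolModulus s' t' hf)
    fun ξ k => by
      simpa only [sub_relShift_snd, add_sub_cancel_left]
        using enorm_symbol_one_le_add (ξ - relShift k).snd ξ.snd
  simpa only [← symbolModulus_add_one_snd] using h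

/-- The constant of the Schur test for the kernel `|k| ^ (b - d)` in dimension `d` with weights
homogeneous of degrees `-Z` and `-W`. -/
def schurConst (d b Z W : ℝ) : ℝ := √(powConvConst d b Z) * √(powConvConst d b W)

theorem schurConst_nonneg (d b Z W : ℝ) : 0 ≤ schurConst d b Z W := by
  unfold schurConst
  positivity

theorem powConvConst_nonneg {d b Z : ℝ} (hb : 0 < b) (hbZ : b < Z) (hZ : Z < d) :
    0 ≤ powConvConst d b Z :=
  (rieszConst_pos (by linarith) (by linarith) (by linarith)).le

theorem rpow_half_mul_lintegral_sq_le {s t a c K : ℝ} (hK : 0 ≤ K) (ha : a ∈ Set.Icc 0 s)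
    (hc : c ∈ Set.Icc 0 t) (f : SquareIntegrable (WithLp 2 (E × E))) :
    (ENNReal.ofReal K * ∫⁻ ξ, symbolModulus (-s) (-t) f ξ ^ 2 * momentumWeight a c ξ)
      ^ (1 / 2 : ℝ) ≤ ENNReal.ofReal √K * ‖f‖ₑ := by
  calc _ ≤ (ENNReal.ofReal K * ‖f‖ₑ ^ 2) ^ (1 / 2 : ℝ) := by
        rw [enorm_sq_eq_lintegral]
        gcongr with ξ
        exact symbolModulus_sq_mul_momentumWeight_le ha hc f ξ
    _ = ENNReal.ofReal √K * ‖f‖ₑ := by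
        rw [ENNReal.mul_rpow_of_nonneg _ _ (by norm_num), ENNReal.ofReal_rpow_of_nonneg hK
          (by norm_num), ← Real.sqrt_eq_rpow, ← ENNReal.rpow_two, ← ENNReal.rpow_mul]
        norm_num

theorem rpow_half_lintegral_symbolModulus_sq_le {s t : ℝ} (hs : 0 ≤ s) (ht : 0 ≤ t)
    (f : SquareIntegrable (WithLp 2 (E × E))) :
    (∫⁻ ξ, symbolModulus (-s) (-t) f ξ ^ 2) ^ (1 / 2 : ℝ) ≤ ‖f‖ₑ := by
  simpa [momentumWeight_zero] using
    rpow_half_mul_lintegral_sq_le zero_le_one ⟨le_rfl, hs⟩ ⟨le_rfl, ht⟩ f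

theorem shiftForm_symbolModulus_le [Nontrivial E] {b Z W θ θ' : ℝ} (hb : 0 < b) (hbZ : b < Z)
    (hZ : Z < Module.finrank ℝ E) (hbW : b < W) (hW : W < Module.finrank ℝ E)
    (hθ : θ ∈ Set.Icc 0 1) (hθ' : θ' ∈ Set.Icc 0 1) {s t s' t' : ℝ}
    (hs : θ' * W - θ * (Z - b) ∈ Set.Icc 0 s)
    (ht : (1 - θ') * W - (1 - θ) * (Z - b) ∈ Set.Icc 0 t)
    (hs' : θ * Z - θ' * (W - b) ∈ Set.Icc 0 s')
    (ht' : (1 - θ) * Z - (1 - θ') * (W - b) ∈ Set.Icc 0 t')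
    {κ : E → ℝ≥0∞} {C : ℝ} (hC : 0 ≤ C)
    (hκ : ∀ᵐ k, κ k ≤ ENNReal.ofReal C * ‖k‖ₑ ^ (b - Module.finrank ℝ E))
    (g f : SquareIntegrable (WithLp 2 (E × E))) :
    shiftForm κ (symbolModulus (-s) (-t) g) (symbolModulus (-s') (-t') f) ≤
      ENNReal.ofReal (C * schurConst (Module.finrank ℝ E) b Z W) * (‖g‖ₑ * ‖f‖ₑ) := by
  have hg := measurable_symbolModulus (-s) (-t) (Lp.stronglyMeasurable g).measurable
  have hf := measurable_symbolModulus (-s') (-t') (Lp.stronglyMeasurable f).measurable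
  calc _ ≤ shiftForm (fun k => ENNReal.ofReal C * ‖k‖ₑ ^ (b - Module.finrank ℝ E))
        (symbolModulus (-s) (-t) g) (symbolModulus (-s') (-t') f) :=
        shiftForm_mono hκ (.of_forall fun _ => le_rfl) (.of_forall fun _ => le_rfl)
    _ ≤ ENNReal.ofReal C *
        ((ENNReal.ofReal √(powConvConst (Module.finrank ℝ E) b Z) * ‖g‖ₑ) *
          (ENNReal.ofReal √(powConvConst (Module.finrank ℝ E) b W) * ‖f‖ₑ)) := by
        rw [shiftForm_const_mul (by fun_prop) hg hf]
        grw [shiftForm_rpow_le hb hbZ hZ hbW hW hθ.1 hθ.2 hθ'.1 hθ'.2 hg hf,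
          rpow_half_mul_lintegral_sq_le (powConvConst_nonneg hb hbZ hZ) hs ht g,
          rpow_half_mul_lintegral_sq_le (powConvConst_nonneg hb hbW hW) hs' ht' f]
    _ = _ := by
        rw [schurConst, ENNReal.ofReal_mul hC, ENNReal.ofReal_mul (Real.sqrt_nonneg _)]
        ring

end WeightedEstimates

section CoulombEstimates

/-- The kernel `κ` lies below `π⁻¹ |k| ^ (-2)`, the Fourier transform of the Coulomb potential. -/
def BelowCoulombKernel (κ : Space → ℝ≥0∞) : Prop :=
  ∀ᵐ k, κ k ≤ ENNReal.ofReal Real.pi⁻¹ * ‖k‖ₑ ^ (-2 : ℝ)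

theorem belowCoulombKernel_powDensity :
    BelowCoulombKernel (mixKer (mixMeasure (powDensity (1 / 2)))) := by
  filter_upwards [ae_mixKer_powDensity (E := Space) one_pos (by rw [finrank_space]; norm_num)]
    with k hk
  rw [hk, finrank_space, show (3 - 1) / 2 = (1 : ℝ) by norm_num, gammaPi_one,
    show 1 - 3 = (-2 : ℝ) by norm_num]

theorem belowCoulombKernel_regDensity {η : ℝ} (hη : 0 < η) :
    BelowCoulombKernel (mixKer (mixMeasure (regDensity η))) := by
  filter_upwards [Measure.ae_ne volume (0 : Space)] with k hk
  refine (mixKer_regDensity_le hη le_rfl zero_le_two (by rw [finrank_space]; norm_num)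
    hk).trans_eq ?_
  rw [finrank_space, neg_zero, Real.rpow_zero, ENNReal.ofReal_one, one_mul, add_zero, sub_zero,
    gammaPi_half, show (3 - 1) / 2 = (1 : ℝ) by norm_num, gammaPi_one, one_mul,
    show 1 - 3 = (-2 : ℝ) by norm_num]

/-- The bound for `S₁ S₂⁻¹ W S₁⁻¹ S₂⁻¹` with a potential `W` whose Fourier transform lies below that
of the Coulomb potential. -/
def sandwichAConst : ℝ :=
  Real.pi⁻¹ * schurConst 3 1 2 2 + √(2 * Real.pi) * Real.pi⁻¹ * schurConst 3 (3 / 2) (5 / 2) 2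

theorem sandwichAConst_nonneg : 0 ≤ sandwichAConst := by
  have := schurConst_nonneg 3 1 2 2
  have := schurConst_nonneg 3 (3 / 2) (5 / 2) 2
  unfold sandwichAConst
  positivity

theorem shiftForm_sandwichA_le {κ : Space → ℝ≥0∞} (hκm : Measurable κ) (hκ : BelowCoulombKernel κ)
    (g f : Hilb) :
    shiftForm κ (symbolModulus 1 (-1) g) (symbolModulus (-1) (-1) f) ≤
      ENNReal.ofReal sandwichAConst * (‖g‖ₑ * ‖f‖ₑ) := by
  have commute := shiftForm_symbolModulus_add_one_fst_le hκm
    (Lp.stronglyMeasurable g).measurable (Lp.stronglyMeasurable f).measurable 0 (-1) (-1) (-1)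
  have main := shiftForm_symbolModulus_le (κ := κ) (b := 1) (Z := 2) (W := 2) (θ := 0) (θ' := 0)
    (s := 0) (t := 1) (s' := 0) (t' := 1) (C := Real.pi⁻¹) (by norm_num) (by norm_num)
    (by norm_num) (by norm_num) (by norm_num) (by norm_num) (by norm_num) (by norm_num)
    (by norm_num) (by norm_num) (by norm_num) (by positivity)
    (by norm_num [finrank_space]; exact hκ) g f
  have error := shiftForm_symbolModulus_le (κ := fun k => shiftError k * κ k) (b := 3 / 2)
    (Z := 5 / 2) (W := 2) (θ := 4 / 9) (θ' := 2 / 9) (s := 0) (t := 1) (s' := 1) (t' := 1)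
    (C := √(2 * Real.pi) * Real.pi⁻¹) (by norm_num) (by norm_num) (by norm_num) (by norm_num)
    (by norm_num) (by norm_num) (by norm_num) (by norm_num) (by norm_num) (by norm_num)
    (by norm_num) (by positivity) ?_ g f
  · rw [zero_add, neg_add_cancel] at commute
    rw [finrank_space, neg_zero] at main error
    refine commute.trans ((add_le_add main error).trans_eq ?_)
    rw [← add_mul, ← ENNReal.ofReal_add, sandwichAConst]
    all_goals have := schurConst_nonneg 3 1 2 2
    all_goals have := schurConst_nonneg 3 (3 / 2) (5 / 2) 2
    all_goals positivity
  · filter_upwards [hκ, Measure.ae_ne volume (0 : Space)] with k hk hk0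
    refine (shiftError_mul_le_of_le hk0 hk).trans_eq ?_
    norm_num [finrank_space]

/-- The bound for `S₁⁻² S₂⁻¹ W S₂` with `W = (|x₁ - x₂| + η)⁻¹`, up to the factor `η ^ (-δ)`. -/
def sandwichBConst (δ : ℝ) : ℝ :=
  max (Real.pi⁻¹ * schurConst 3 1 (3 / 2) (5 / 2)) 1 +
    √(2 * Real.pi) * (gammaPi ((1 + δ) / 2) * gammaPi (1 + δ / 2)) *
      schurConst 3 (3 / 2 - δ) (3 / 2) (3 - δ)

theorem sandwichBConst_nonneg {δ : ℝ} (hδ : 0 < δ) : 0 ≤ sandwichBConst δ := by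
  have := gammaPi_pos (s := (1 + δ) / 2) (by positivity)
  have := gammaPi_pos (s := 1 + δ / 2) (by positivity)
  have := schurConst_nonneg 3 (3 / 2 - δ) (3 / 2) (3 - δ)
  unfold sandwichBConst
  positivity

theorem shiftForm_symbolModulus_neg_two_le {κ : Space → ℝ≥0∞} (hκ : BelowCoulombKernel κ)
    (g f : Hilb) :
    shiftForm κ (symbolModulus (-2) 0 g) (symbolModulus 0 0 f) ≤
      ENNReal.ofReal (Real.pi⁻¹ * schurConst 3 1 (3 / 2) (5 / 2)) * (‖g‖ₑ * ‖f‖ₑ) := by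
  have h := shiftForm_symbolModulus_le (κ := κ) (b := 1) (Z := 3 / 2) (W := 5 / 2) (θ := 1)
    (θ' := 1) (s := 2) (t := 0) (s' := 0) (t' := 0) (C := Real.pi⁻¹) (by norm_num) (by norm_num)
    (by norm_num) (by norm_num) (by norm_num) (by norm_num) (by norm_num) (by norm_num)
    (by norm_num) (by norm_num) (by norm_num) (by positivity)
    (by norm_num [finrank_space]; exact hκ) g f
  rwa [finrank_space, neg_zero] at h

theorem shiftForm_regDensity_symbolModulus_le_inv {η : ℝ} (hη : 0 < η) {s t s' t' : ℝ}
    (hs : 0 ≤ s) (ht : 0 ≤ t) (hs' : 0 ≤ s') (ht' : 0 ≤ t') (g f : Hilb) :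
    shiftForm (mixKer (mixMeasure (regDensity η))) (symbolModulus (-s) (-t) g)
      (symbolModulus (-s') (-t') f) ≤ ENNReal.ofReal η⁻¹ * (‖g‖ₑ * ‖f‖ₑ) := by
  have hg := measurable_symbolModulus (-s) (-t) (Lp.stronglyMeasurable g).measurable
  have hf := measurable_symbolModulus (-s') (-t') (Lp.stronglyMeasurable f).measurable
  grw [shiftForm_le_lintegral_mul measurable_mixKer hg hf,
    rpow_half_lintegral_symbolModulus_sq_le hs ht g,
    rpow_half_lintegral_symbolModulus_sq_le hs' ht' f]
  rw [lintegral_mixKer (ae_mixMeasure_pos _), mix_regDensity hη, norm_zero, zero_add]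

theorem shiftForm_regDensity_main_le {η δ : ℝ} (hη : 0 < η) (hδ : 0 ≤ δ) (hδ' : δ ≤ 1)
    (g f : Hilb) :
    shiftForm (mixKer (mixMeasure (regDensity η))) (symbolModulus (-2) 0 g)
      (symbolModulus 0 0 f) ≤
      ENNReal.ofReal (max (Real.pi⁻¹ * schurConst 3 1 (3 / 2) (5 / 2)) 1 * η ^ (-δ)) *
        (‖g‖ₑ * ‖f‖ₑ) := by
  rcases le_total η 1 with h | h
  · have hone : 1 ≤ η ^ (-δ) :=
      Real.one_le_rpow_of_pos_of_le_one_of_nonpos hη h (neg_nonpos.2 hδ)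
    grw [shiftForm_symbolModulus_neg_two_le (belowCoulombKernel_regDensity hη) g f, ← hone,
      mul_one]
    gcongr
    exact le_max_left _ _
  · have hinv := shiftForm_regDensity_symbolModulus_le_inv hη (s := 2) zero_le_two le_rfl le_rfl
      le_rfl g f
    rw [neg_zero] at hinv
    have hle : η⁻¹ ≤ η ^ (-δ) := by
      rw [← Real.rpow_neg_one]
      exact Real.rpow_le_rpow_of_exponent_le h (neg_le_neg hδ')
    grw [hinv, hle, ← le_max_right, one_mul]

theorem shiftForm_regDensity_error_le {η δ : ℝ} (hη : 0 < η) (hδ : 0 < δ) (hδ' : δ ≤ 1)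
    (g f : Hilb) :
    shiftForm (fun k => shiftError k * mixKer (mixMeasure (regDensity η)) k)
      (symbolModulus (-2) (-1) g) (symbolModulus 0 0 f) ≤
      ENNReal.ofReal (√(2 * Real.pi) * (gammaPi ((1 + δ) / 2) * gammaPi (1 + δ / 2)) *
        schurConst 3 (3 / 2 - δ) (3 / 2) (3 - δ) * η ^ (-δ)) * (‖g‖ₑ * ‖f‖ₑ) := by
  have hΓ := gammaPi_pos (s := (1 + δ) / 2) (by positivity)
  have hΓ' := gammaPi_pos (s := 1 + δ / 2) (by positivity)
  have kernel : ∀ᵐ k : Space, shiftError k * mixKer (mixMeasure (regDensity η)) k ≤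
      ENNReal.ofReal (√(2 * Real.pi) *
        (η ^ (-δ) * (gammaPi ((1 + δ) / 2) * gammaPi (1 + δ / 2)))) *
      ‖k‖ₑ ^ (3 / 2 - δ - Module.finrank ℝ Space) := by
    filter_upwards [Measure.ae_ne volume (0 : Space)] with k hk
    have h := mixKer_regDensity_le hη hδ.le (by linarith) (by rw [finrank_space]; linarith) hk
    rw [← mul_assoc, ← ENNReal.ofReal_mul (by positivity), finrank_space,
      show (3 - (1 - δ)) / 2 = 1 + δ / 2 by ring] at h
    refine (shiftError_mul_le_of_le hk h).trans_eq ?_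
    rw [finrank_space]
    ring_nf
  have h := shiftForm_symbolModulus_le (b := 3 / 2 - δ) (Z := 3 / 2) (W := 3 - δ)
    (θ := 2 / 3) (θ' := 2 / 3) (s := 2) (t := 1) (s' := 0) (t' := 0) (by linarith) (by linarith)
    (by norm_num) (by linarith) (by rw [finrank_space]; linarith) (by norm_num) (by norm_num)
    ⟨by linarith, by linarith⟩ ⟨by linarith, by linarith⟩ ⟨by linarith, by linarith⟩
    ⟨by linarith, by linarith⟩ (by positivity) kernel g f
  rw [finrank_space, neg_zero] at h
  refine h.trans_eq ?_
  ring_nf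

theorem shiftForm_sandwichB_le {η δ : ℝ} (hη : 0 < η) (hδ : 0 < δ) (hδ' : δ ≤ 1) (g f : Hilb) :
    shiftForm (mixKer (mixMeasure (regDensity η))) (symbolModulus (-2) (-1) g)
      (symbolModulus 0 1 f) ≤ ENNReal.ofReal (sandwichBConst δ * η ^ (-δ)) * (‖g‖ₑ * ‖f‖ₑ) := by
  have hΓ := gammaPi_pos (s := (1 + δ) / 2) (by positivity)
  have hΓ' := gammaPi_pos (s := 1 + δ / 2) (by positivity)
  have hschur := schurConst_nonneg 3 (3 / 2 - δ) (3 / 2) (3 - δ)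
  have commute := shiftForm_symbolModulus_add_one_snd_le
    (measurable_mixKer (E := Space) (μ := mixMeasure (regDensity η)))
    (Lp.stronglyMeasurable g).measurable (Lp.stronglyMeasurable f).measurable (-2) (-1) 0 0
  rw [zero_add, neg_add_cancel] at commute
  grw [commute, shiftForm_regDensity_main_le hη hδ.le hδ' g f,
    shiftForm_regDensity_error_le hη hδ hδ' g f]
  rw [← add_mul, ← ENNReal.ofReal_add (by positivity) (by positivity), ← add_mul, sandwichBConst]

end CoulombEstimates

section SandwichBounds

theorem mem_domain_mulOp_of_le_inv {W : Config → ℝ} (hWm : Measurable W)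
    (hW : ∀ᵐ x : Config, 0 ≤ W x ∧ W x ≤ ‖x.fst - x.snd‖⁻¹) {φ ψ : Hilb}
    (h : (ψ, φ) ∈ (opComp (S₁ (-1)) (S₂ (-1))).graph) : φ ∈ (mulOp volume W).domain := by
  have hφ := enorm_ae_eq_symbolModulus ((mem_graph_opComp_S₁_S₂ (by norm_num)).1 h)
  refine mem_domain_mulOp_of_lintegral_lt_top hWm.aemeasurable ?_
  calc ∫⁻ x, ‖(W x : ℂ) * φ x‖ₑ ^ 2
      ≤ ∫⁻ x : Config, ‖x.fst - x.snd‖ₑ ^ (-2 : ℝ) * ‖φ x‖ₑ ^ 2 := by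
        refine lintegral_mono_ae ?_
        filter_upwards [hW, ae_fst_sub_snd_ne_zero] with x ⟨h0, hle⟩ hx
        rw [enorm_mul, mul_pow, enorm_ofReal_complex h0, ← ofReal_norm_rpow hx,
          ← ENNReal.ofReal_pow h0, Real.rpow_neg (norm_nonneg _), Real.rpow_two, ← inv_pow]
        gcongr
    _ ≤ ENNReal.ofReal (hardyConst 3 2) * ∫⁻ ξ, momentumWeight 1 1 ξ * ‖ft φ ξ‖ₑ ^ 2 := by
        have hardy := lintegral_rpow_mul_sq_le (a := 2) (t := 1 / 2) two_pos
          (by rw [finrank_space]; norm_num) (by norm_num) (by norm_num) φ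
        rwa [finrank_space, show (2 : ℝ) * (1 / 2) = 1 by norm_num,
          show (2 : ℝ) * (1 - 1 / 2) = 1 by norm_num] at hardy
    _ ≤ ENNReal.ofReal (hardyConst 3 2) * ‖ft ψ‖ₑ ^ 2 := by
        rw [enorm_sq_eq_lintegral]
        refine mul_le_mul_right (lintegral_mono_ae ?_) _
        filter_upwards [hφ] with ξ hξ
        rw [hξ, mul_comm]
        exact symbolModulus_sq_mul_momentumWeight_le ⟨zero_le_one, le_rfl⟩ ⟨zero_le_one, le_rfl⟩
          _ ξ
    _ < ∞ := ENNReal.mul_lt_top ENNReal.ofReal_lt_top (ENNReal.pow_lt_top enorm_lt_top)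

theorem normLE_sandwichA {μ : Measure ℝ} [SFinite μ] (hμ : ∀ᵐ u ∂μ, 0 < u)
    (hκ : BelowCoulombKernel (mixKer μ)) {W : Config → ℝ} (hWm : Measurable W)
    (hW : ∀ᵐ x : Config, 0 ≤ W x ∧ ENNReal.ofReal (W x) = mix μ (x.fst - x.snd))
    (hWV : ∀ᵐ x : Config, W x ≤ ‖x.fst - x.snd‖⁻¹) :
    NormLE (sandwichA (mulOp volume W)) sandwichAConst := by
  refine normLE_sandwich hμ hW (by norm_num) ?_ (fun ψ φ h => mem_domain_mulOp_of_le_inv hWm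
    (by filter_upwards [hW, hWV] with x h0 hle using ⟨h0.1, hle⟩) h) sandwichAConst_nonneg
    fun ψ φ g h => ?_
  · convert dense_univ
    refine Set.eq_univ_of_forall fun ψ => ?_
    obtain ⟨χ, hχ⟩ := exists_mem_graph_S₂ (s := -1) (by norm_num) ψ
    obtain ⟨φ, hφ⟩ := exists_mem_graph_S₁ (s := -1) (by norm_num) χ
    exact LinearPMap.mem_domain_iff.2 ⟨φ, mem_graph_opComp.2 ⟨χ, hχ, hφ⟩⟩
  · have hφ := enorm_ae_eq_symbolModulus ((mem_graph_opComp_S₁_S₂ (by norm_num)).1 h)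
    rw [← LinearIsometryEquiv.enorm_map ft ψ]
    exact (shiftForm_mono (.of_forall fun _ => le_rfl) (.of_forall fun _ => le_rfl)
      (hφ.mono fun _ hξ => hξ.le)).trans (shiftForm_sandwichA_le measurable_mixKer hκ g (ft ψ))

theorem normLE_sandwichA_coulomb : NormLE (sandwichA V₁₂) sandwichAConst := by
  refine normLE_sandwichA (ae_mixMeasure_pos _) belowCoulombKernel_powDensity
    (by unfold V; fun_prop) ?_ (.of_forall fun _ => le_rfl)
  filter_upwards [ae_fst_sub_snd_ne_zero] with x hx
  refine ⟨inv_nonneg.2 (norm_nonneg _), ?_⟩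
  rw [mix_powDensity (by norm_num) hx, gammaPi_half, ENNReal.ofReal_one, one_mul, ofReal_V hx]
  norm_num

variable {ε : ℝ} {N : ℕ}

theorem reg_pos (hε : 0 < ε) (hN : 1 ≤ N) : 0 < ε * (N : ℝ)⁻¹ :=
  mul_pos hε (inv_pos.2 (Nat.cast_pos.2 hN))

@[fun_prop]
theorem measurable_Vreg (ε : ℝ) (N : ℕ) : Measurable (Vreg ε N) := by
  unfold Vreg
  fun_prop

theorem Vreg_nonneg (hε : 0 < ε) (hN : 1 ≤ N) (y : Space) : 0 ≤ Vreg ε N y :=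
  inv_nonneg.2 (add_nonneg (norm_nonneg _) (reg_pos hε hN).le)

theorem ofReal_Vreg (hε : 0 < ε) (hN : 1 ≤ N) (y : Space) :
    ENNReal.ofReal (Vreg ε N y) = mix (mixMeasure (regDensity (ε * (N : ℝ)⁻¹))) y :=
  (mix_regDensity (reg_pos hε hN) y).symm

theorem normLE_sandwichA_reg (hε : 0 < ε) (hN : 1 ≤ N) :
    NormLE (sandwichA (Vreg₁₂ ε N)) sandwichAConst := by
  refine normLE_sandwichA (ae_mixMeasure_pos _) (belowCoulombKernel_regDensity (reg_pos hε hN))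
    (by fun_prop) (.of_forall fun x => ⟨Vreg_nonneg hε hN _, ofReal_Vreg hε hN _⟩) ?_
  filter_upwards [ae_fst_sub_snd_ne_zero] with x hx
  exact inv_anti₀ (norm_pos_iff.2 hx) (le_add_of_nonneg_right (reg_pos hε hN).le)

theorem normLE_sandwichB_reg {δ : ℝ} (hε : 0 < ε) (hN : 1 ≤ N) (hδ : 0 < δ) (hδ' : δ ≤ 1) :
    NormLE (sandwichB (Vreg₁₂ ε N)) (sandwichBConst δ * (ε * (N : ℝ)⁻¹) ^ (-δ)) := by
  have hη := reg_pos hε hN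
  have bounded (x : Config) : |Vreg ε N (x.fst - x.snd)| ≤ (ε * (N : ℝ)⁻¹)⁻¹ := by
    rw [abs_of_nonneg (Vreg_nonneg hε hN _)]
    exact inv_anti₀ hη (le_add_of_nonneg_left (norm_nonneg _))
  refine normLE_sandwich (ae_mixMeasure_pos _)
    (.of_forall fun x => ⟨Vreg_nonneg hε hN _, ofReal_Vreg hε hN _⟩) (by norm_num)
    (dense_domain_momentumOp (by fun_prop)) (fun ψ φ _ => LinearPMap.mem_domain_iff.2
      (exists_mem_graph_mulOp_of_abs_le (by fun_prop) bounded φ))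
    (mul_nonneg (sandwichBConst_nonneg hδ) (by positivity)) fun ψ φ g h => ?_
  have hφ : ∀ᵐ ξ, ‖ft φ ξ‖ₑ = symbolModulus 0 1 (ft ψ) ξ :=
    enorm_ae_eq_symbolModulus (by simpa only [symbol_zero, one_mul] using mem_graph_S₂.1 h)
  rw [← LinearIsometryEquiv.enorm_map ft ψ]
  exact (shiftForm_mono (.of_forall fun _ => le_rfl) (.of_forall fun _ => le_rfl)
    (hφ.mono fun _ hξ => hξ.le)).trans (shiftForm_sandwichB_le hη hδ hδ' g (ft ψ))

theorem NormLE.mono {T : Hilb →ₗ.[ℂ] Hilb} {C C' : ℝ} (h : NormLE T C) (hC : C ≤ C') :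
    NormLE T C' :=
  ⟨h.1, fun ψ => (h.2 ψ).trans (mul_le_mul_of_nonneg_right hC (norm_nonneg _))⟩

theorem exists_normLE_sandwichB {δ : ℝ} (hδ : 0 < δ) : ∃ C : ℝ, ∀ (ε : ℝ) (N : ℕ), 0 < ε →
    1 ≤ N → (δ ≤ 1 ∨ ε ≤ N) →
      NormLE (sandwichB (Vreg₁₂ ε N)) (C * ε ^ (-δ) * (N : ℝ) ^ δ) := by
  refine ⟨sandwichBConst (min δ 1), fun ε N hε hN h => ?_⟩
  have hN' : (0 : ℝ) < N := Nat.cast_pos.2 hN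
  have rpow_eq : ε ^ (-δ) * (N : ℝ) ^ δ = (ε * (N : ℝ)⁻¹) ^ (-δ) := by
    rw [Real.mul_rpow hε.le (by positivity), Real.inv_rpow hN'.le, Real.rpow_neg hN'.le, inv_inv]
  have rpow_le : (ε * (N : ℝ)⁻¹) ^ (-min δ 1) ≤ (ε * (N : ℝ)⁻¹) ^ (-δ) := by
    rcases h with h | h
    · rw [min_eq_left h]
    · refine Real.rpow_le_rpow_of_exponent_ge (reg_pos hε hN) ?_ (neg_le_neg (min_le_left δ 1))
      rwa [← div_eq_mul_inv, div_le_one hN']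
  have hδ1 : 0 < min δ 1 := lt_min hδ one_pos
  refine (normLE_sandwichB_reg hε hN hδ1 (min_le_right δ 1)).mono ?_
  rw [mul_assoc, rpow_eq]
  exact mul_le_mul_of_nonneg_left rpow_le (sandwichBConst_nonneg hδ1)

end SandwichBounds

end TwoParticle

end

theorem lemma9p1 :
    -- (i): the bound for all `a < 3`, with a constant depending only on `a`
    (∀ a : ℝ, a < 3 → ∃ C : ℝ, ∀ α β : ℝ, 0 < α → 0 < β → α + β = 2 * a →
      TwoParticle.LeSS (fun x => 1 / ‖x.fst - x.snd‖ ^ a) C α β) ∧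
    -- (i): for `a = 1` the constant `π / 2` is admissible, and no smaller constant is
    (∀ α β : ℝ, 0 < α → 0 < β → α + β = 2 →
      TwoParticle.LeSS (fun x => TwoParticle.V (x.fst - x.snd)) (Real.pi / 2) α β ∧
      ∀ c : ℝ, TwoParticle.LeSS (fun x => TwoParticle.V (x.fst - x.snd)) c α β →
        Real.pi / 2 ≤ c) ∧
    -- (ii)
    (∃ C : ℝ, TwoParticle.NormLE (TwoParticle.sandwichA TwoParticle.V₁₂) C) ∧
    (∃ C : ℝ, ∀ (ε : ℝ) (N : ℕ), 0 < ε → 1 ≤ N →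
      TwoParticle.NormLE (TwoParticle.sandwichA (TwoParticle.Vreg₁₂ ε N)) C) ∧
    -- (iii)
    (∀ δ : ℝ, 0 < δ → ∃ C : ℝ, ∀ (ε : ℝ) (N : ℕ), 0 < ε → 1 ≤ N → (δ ≤ 1 ∨ ε ≤ N) →
      TwoParticle.NormLE (TwoParticle.sandwichB (TwoParticle.Vreg₁₂ ε N))
        (C * ε ^ (-δ) * (N : ℝ) ^ δ)) :=
  ⟨fun _ ha => TwoParticle.exists_leSS_rpow ha,
    fun _ _ hα hβ h => ⟨TwoParticle.leSS_coulomb hα.le hβ.le h,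
      fun _ hc => TwoParticle.pi_div_two_le_of_leSS hα.le hβ.le h hc⟩,
    ⟨_, TwoParticle.normLE_sandwichA_coulomb⟩,
    ⟨_, fun _ _ hε hN => TwoParticle.normLE_sandwichA_reg hε hN⟩,
    fun _ hδ => TwoParticle.exists_normLE_sandwichB hδ⟩
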